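/- Let $\mathbb T^2=\mathbb R^2/\mathbb Z^2$ and, for $\beta\in\mathbb R$, let $\mathcal B_\beta=H^{2\beta}(\mathbb T^2)$ with norm $\|f\|_{\mathcal B_\beta}^2=\sum_{k\in\mathbb Z^2}(1+|k|^2)^{2\beta}|\hat f(k)|^2$. Let $\tfrac12<\gamma<H<1$, $\alpha>1$ and $T>0$, let $W^H$ be a fractional Brownian motion with Hurst parameter $H$ and almost surely continuous paths on a probability space, let $\xi:\mathbb T^2\to\mathbb R^2$ be a $C^\infty$ vector field with $\nabla\cdot\xi=0$, and let $\omega_0$ be a (possibly random) real initial condition with $\omega_0\in\mathcal B_\alpha$ almost surely. Write $S_t=e^{t\Delta}$ for the heat semigroup on $\mathbb T^2$. For $t\in[0,T]$ let $u_t=K*\omega_t$ be the velocity given by the Biot–Savart law on $\mathbb T^2$, that is $\hat u_t(k)=\frac{i(k_2,-k_1)}{2\pi|k|^2}\hat\omega_t(k)$ for $k\ne0$ and $\hat u_t(0)=0$, so that $\nabla\cdot u_t=0$ and, if $\omega_t$ has mean zero, $\operatorname{curl}u_t=\omega_t$. Consider on $[0,T]$ the vorticity equation $$d\omega_t+u_t\cdot\nabla\omega_t\,dt+\xi\cdot\nabla\omega_t\,dW^H_t=\Delta\omega_t\,dt$$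 with initial condition $\omega_0$. A process $\omega$ with $\omega\in C([0,T];\mathcal B_\alpha)$ almost surely is a *mild solution* if, almost surely, for all $t\in[0,T]$, $$\omega_t=S_t\omega_0-\int_0^tS_{t-r}(u_r\cdot\nabla\omega_r)\,dr-\int_0^tS_{t-r}(\xi\cdot\nabla\omega_r)\,dW^H_r ,$$ where the last integral is the limit in $\mathcal B_\alpha$ of the left-point Riemann–Stieltjes sums over partitions of $[0,t]$ as the mesh tends to $0$ (Young integral). It is a *weak solution* if for every $\varphi\in C^\infty(\mathbb T^2)$ and every $t\in[0,T]$, almost surely, $$\langle\omega_t,\varphi\rangle=\langle\omega_0,\varphi\rangle+\int_0^t\langle\omega_r,u_r\cdot\nabla\varphi+\Delta\varphi\rangle\,dr+\int_0^t\langle\omega_r,\xi\cdot\nabla\varphi\rangle\,dW^H_r ,$$ where $\langle f,g\rangle=\int_{\mathbb T^2}fg\,dx$ and the last integral is a real-valued Young integral, defined in the same way. In both definitions the existence of the integrals is part of the requirement. **Theorem.** Let $\omega$ be a process whose paths almost surely belong to $$V^T=C([0,T];\mathcal B_\alpha)\cap C^\gamma([0,T];\mathcal B_{\alpha-\gamma}).$$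 Then $\omega$ is a mild solution if and only if it is a weak solution. -/

import Mathlib

open MeasureTheory ProbabilityTheory Filter Topology Set
open scoped NNReal ENNReal

namespace Vorticity

/-- The two-dimensional torus `ℝ² / ℤ²`. -/
abbrev Torus : Type := UnitAddTorus (Fin 2)

/-- The normalised Haar (Lebesgue) measure on the torus. -/
noncomputable def torusMeasure : Measure Torus :=
  Measure.pi fun _ => AddCircle.haarAddCircle

/-! ### Functions on the torus -/

/-- The Fourier coefficient `f̂(k) = ∫ f(x) exp(-2πi k·x) dx` of a real function on the torus. -/
noncomputable def coeff (f : Torus → ℝ) (k : Fin 2 → ℤ) : ℂ :=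
  UnitAddTorus.mFourierCoeff (fun x => (f x : ℂ)) k

/-- `|k|²` for a frequency `k ∈ ℤ²`. -/
def freqSq (k : Fin 2 → ℤ) : ℝ := (k 0 : ℝ) ^ 2 + (k 1 : ℝ) ^ 2

/-- The function `x ↦ ∑ₖ m(k) f̂(k) exp(2πi k·x)`. The sum is real for a real `f` and a symbol
with `m(-k) = conj (m(k))`, which is the case for all symbols used below. -/
noncomputable def fourierMultiplier (m : (Fin 2 → ℤ) → ℂ) (f : Torus → ℝ) : Torus → ℝ :=
  fun x => (∑' k, m k * coeff f k * UnitAddTorus.mFourier k x).re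

/-- The norm `‖f‖_{H^s} = (∑ₖ (1 + |k|²)^s |f̂(k)|²)^{1/2}`, with values in `[0, ∞]`. -/
noncomputable def sobolevNorm (s : ℝ) (f : Torus → ℝ) : ℝ≥0∞ :=
  (∑' k, ENNReal.ofReal ((1 + freqSq k) ^ s) * ‖coeff f k‖ₑ ^ 2) ^ (1 / 2 : ℝ)

/-- The norm of the space `𝓑_α = H^{2α}`. -/
noncomputable def normB (α : ℝ) (f : Torus → ℝ) : ℝ≥0∞ := sobolevNorm (2 * α) f

/-- `f` belongs to `𝓑_α = H^{2α}`. This is used for `α > 1` only, where every element of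
`H^{2α}` has a unique continuous representative, with which we identify it. -/
def MemB (α : ℝ) (f : Torus → ℝ) : Prop := Continuous f ∧ normB α f < ⊤

/-- `f ∈ 𝓑_∞ = C^∞`: the periodic lift of `f` to `ℝ²` is smooth. -/
def Smooth (f : Torus → ℝ) : Prop :=
  ContDiff ℝ (⊤ : ℕ∞) fun y : Fin 2 → ℝ => f fun i => (y i : UnitAddCircle)

/-- The partial derivative `∂ᵢ f`. -/
noncomputable def pderiv (i : Fin 2) (f : Torus → ℝ) (x : Torus) : ℝ :=
  deriv (fun h : ℝ => f (x + Pi.single i (h : UnitAddCircle))) 0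

/-- The Laplacian `Δ f`. -/
noncomputable def laplacian (f : Torus → ℝ) (x : Torus) : ℝ :=
  ∑ i, pderiv i (pderiv i f) x

/-- The transport term `v · ∇ f`. -/
noncomputable def transport (v : Torus → Fin 2 → ℝ) (f : Torus → ℝ) (x : Torus) : ℝ :=
  ∑ i, v x i * pderiv i f x

/-- `∇ · v = 0`. -/
def DivFree (v : Torus → Fin 2 → ℝ) : Prop :=
  ∀ x, ∑ i, pderiv i (fun y => v y i) x = 0

/-- The pairing `⟨f, g⟩ = ∫ f g dx`. -/
noncomputable def pairing (f g : Torus → ℝ) : ℝ := ∫ x, f x * g x ∂torusMeasure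

/-- The heat semigroup `S_t = exp(tΔ)`. -/
noncomputable def heat (t : ℝ) : (Torus → ℝ) → Torus → ℝ :=
  fourierMultiplier fun k => (Real.exp (-(4 * Real.pi ^ 2 * freqSq k * t)) : ℂ)

/-- The velocity `u = K ∗ ω` given by the Biot–Savart law: `u = (-∂₂ψ, ∂₁ψ)`, where `ψ` is the
mean-zero solution of `Δψ = ω` (up to the mean of `ω`). On the Fourier side
`û(k) = i (k₂, -k₁) ω̂(k) / (2π|k|²)` for `k ≠ 0` and `û(0) = 0`. -/
noncomputable def biotSavart (w : Torus → ℝ) (x : Torus) : Fin 2 → ℝ :=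
  ![fourierMultiplier (fun k => Complex.I * (k 1 : ℂ) / (2 * Real.pi * freqSq k : ℝ)) w x,
    fourierMultiplier (fun k => -(Complex.I * (k 0 : ℂ)) / (2 * Real.pi * freqSq k : ℝ)) w x]

/-! ### Spaces of paths -/

/-- `y ∈ C([0,T], 𝓑_α)`. -/
def MemC (T α : ℝ) (y : ℝ → Torus → ℝ) : Prop :=
  (∀ t ∈ Icc 0 T, MemB α (y t)) ∧
    ∀ t ∈ Icc 0 T, Tendsto (fun s => normB α (y s - y t)) (𝓝[Icc 0 T] t) (𝓝 0)

/-- `y` has a finite `γ`-Hölder seminorm on `[0,T]` with respect to the norm of `𝓑_β`. -/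
def HolderB (T γ β : ℝ) (y : ℝ → Torus → ℝ) : Prop :=
  ∃ C : ℝ≥0, ∀ s ∈ Icc 0 T, ∀ t ∈ Icc 0 T,
    normB β (y t - y s) ≤ C * ENNReal.ofReal (|t - s| ^ γ)

/-- `y ∈ V^T = C([0,T], 𝓑_α) ∩ C^γ([0,T], 𝓑_{α-γ})`. -/
def MemV (T α γ : ℝ) (y : ℝ → Torus → ℝ) : Prop :=
  MemC T α y ∧ HolderB T γ (α - γ) y

/-! ### Young integrals and the noise -/

/-- `J = ∫₀ᵗ F_r dg_r` as a Young integral: the Riemann–Stieltjes sums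
`∑ F_{p i} (g_{p (i+1)} - g_{p i})` over the partitions `0 = p 0 ≤ ⋯ ≤ p n = t` of `[0,t]`
converge to `J` in the norm `N` as the mesh of the partition tends to zero. -/
def HasYoungIntegral {E : Type*} [AddCommGroup E] [Module ℝ E] (N : E → ℝ≥0∞)
    (F : ℝ → E) (g : ℝ → ℝ) (t : ℝ) (J : E) : Prop :=
  ∀ ε : ℝ≥0∞, 0 < ε → ∃ δ : ℝ, 0 < δ ∧ ∀ (n : ℕ) (p : ℕ → ℝ),
    Monotone p → p 0 = 0 → p n = t → (∀ i < n, p (i + 1) - p i < δ) →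
      N (∑ i ∈ Finset.range n, (g (p (i + 1)) - g (p i)) • F (p i) - J) < ε

/-- `W` is a fractional Brownian motion with Hurst parameter `H`: a centred Gaussian process with
covariance `(s^{2H} + t^{2H} - |t-s|^{2H}) / 2` and almost surely continuous paths. -/
structure IsFractionalBrownianMotion {Ω : Type*} [MeasurableSpace Ω] (H : ℝ)
    (W : ℝ≥0 → Ω → ℝ) (P : Measure Ω) : Prop where
  gaussian : IsGaussianProcess W P
  mean_zero : ∀ t, ∫ a, W t a ∂P = 0
  cov : ∀ s t : ℝ≥0, covariance (W s) (W t) P =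
    ((s : ℝ) ^ (2 * H) + (t : ℝ) ^ (2 * H) - |(t : ℝ) - s| ^ (2 * H)) / 2
  continuous_paths : ∀ᵐ a ∂P, Continuous fun t => W t a

/-- The path `r ↦ W_r(a)`, as a function of a real variable (only `r ≥ 0` matters). -/
def path {Ω : Type*} (W : ℝ≥0 → Ω → ℝ) (a : Ω) (r : ℝ) : ℝ := W r.toNNReal a

/-! ### Solutions -/

/-- Mild solutions on `[0,T]` of
`dω + u·∇ω dt + ξ·∇ω dW = Δω dt`, `u = K ∗ ω`, with initial condition `ω₀`:
almost surely, `ω ∈ C([0,T], 𝓑_α)` and for all `t ∈ [0,T]`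
`ω_t = S_t ω₀ - ∫₀ᵗ S_{t-r}(u_r·∇ω_r) dr - ∫₀ᵗ S_{t-r}(ξ·∇ω_r) dW_r`.
The last integral `J` is the limit of Riemann–Stieltjes sums in `𝓑_α`; the identity is between
continuous functions, hence is stated at every point `x`. -/
def IsMildSolution {Ω : Type*} [MeasurableSpace Ω] (P : Measure Ω) (T α : ℝ)
    (ξ : Torus → Fin 2 → ℝ) (W : ℝ≥0 → Ω → ℝ) (ω₀ : Ω → Torus → ℝ)
    (ω : Ω → ℝ → Torus → ℝ) : Prop :=
  ∀ᵐ a ∂P, MemC T α (ω a) ∧ ∀ t ∈ Icc 0 T, ∃ J : Torus → ℝ, MemB α J ∧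
    HasYoungIntegral (normB α) (fun r => heat (t - r) (transport ξ (ω a r))) (path W a) t J ∧
    ∀ x, IntervalIntegrable
        (fun r => heat (t - r) (transport (biotSavart (ω a r)) (ω a r)) x) volume 0 t ∧
      ω a t x = heat t (ω₀ a) x
        - (∫ r in (0 : ℝ)..t, heat (t - r) (transport (biotSavart (ω a r)) (ω a r)) x) - J x

/-- Weak solutions on `[0,T]` of the same equation: almost surely `ω ∈ C([0,T], 𝓑_α)`, and for
every test function `φ ∈ C^∞` and every `t ∈ [0,T]`, almost surely
`⟨ω_t,φ⟩ = ⟨ω₀,φ⟩ + ∫₀ᵗ ⟨ω_r, u_r·∇φ + Δφ⟩ dr + ∫₀ᵗ ⟨ω_r, ξ·∇φ⟩ dW_r`,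
where the last integral `J` is a real-valued Young integral. -/
def IsWeakSolution {Ω : Type*} [MeasurableSpace Ω] (P : Measure Ω) (T α : ℝ)
    (ξ : Torus → Fin 2 → ℝ) (W : ℝ≥0 → Ω → ℝ) (ω₀ : Ω → Torus → ℝ)
    (ω : Ω → ℝ → Torus → ℝ) : Prop :=
  (∀ᵐ a ∂P, MemC T α (ω a)) ∧
  ∀ φ : Torus → ℝ, Smooth φ → ∀ t ∈ Icc 0 T, ∀ᵐ a ∂P, ∃ J : ℝ,
    HasYoungIntegral enorm (fun r => pairing (ω a r) (transport ξ φ)) (path W a) t J ∧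
    IntervalIntegrable
      (fun r => pairing (ω a r) (transport (biotSavart (ω a r)) φ + laplacian φ)) volume 0 t ∧
    pairing (ω a t) φ = pairing (ω₀ a) φ
      + (∫ r in (0 : ℝ)..t, pairing (ω a r) (transport (biotSavart (ω a r)) φ + laplacian φ)) + J

end Vorticity

/-!
# Mild and weak solutions of the vorticity equation with fractional transport noise

Almost every path `g` of the noise is `γ`-Hölder continuous on `[0, T]`
(`IsFractionalBrownianMotion.ae_holder`, from Gaussian moments and Kolmogorov's criterion on dyadic
points), so the equivalence can be proved one path at a time.

*Young integration.* Riemann–Stieltjes sums in a Banach space converge as soon as the products of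
increments are dominated by `(Φ v - Φ s) ^ θ` with `θ > 1` for a continuous monotone `Φ`
(`YoungControl.exists_integral`, with the Young–Love estimate `YoungControl.norm_rsSum_sub_le`).
For the scalar integral `Y_φ = ∫ ⟨y, ξ·∇φ⟩ dg` of the weak formulation, `Φ` is the identity. For the
stochastic convolution the integrand `S_{t-r}(ξ·∇y_r)` is singular at `r = t`: measured in `𝓑_α`, its
increment from `s` to `m` is of size `(t-m)^{-1/2} min(1, (m-s)/(t-m))^γ`. With `2γβ = γ - 1/2`, the
control `Φ(r) = -(t-r)^β` still dominates (`singular_control`), and the convolution exists in `𝓑_α`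
for every path in `V^T` (`MemV.exists_convolution`).

*Equivalence.* Tested against a Fourier mode of frequency `k`, with eigenvalue `λ` of `-Δ`, the weak
formulation is the scalar equation `dc = (b - λ c) dt + dY`; the two transport terms are moved onto
the test function by incompressibility (`pairing_transport`). Variation of constants turns it into
Duhamel's formula (`variation_of_constants`), and the forcing there is a Young integral with a smooth
factor, `∫ e^{-λ(t-r)} dY = Y(t) - ∫ λ e^{-λ(t-r)} Y dr` (`hasYoungIntegral_mul_smooth`). Mode by mode
this is exactly the mild formulation (`PathData.duhamel_of_mild`, `PathData.mild_of_duhamel`), since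
continuous functions are determined by their Fourier coefficients. The weak formulation for
trigonometric functions extends to all smooth test functions, because all its terms are bounded by
`∑ (1 + |k|²) |φ̂(k)|` (`PathData.weak_of_trig`).

*Null sets.* In the weak formulation the exceptional set depends on the test function and on the
time. For the converse only countably many modes and rational times are used, and both sides are
continuous in time (`PathData.weak_of_rat`).
-/

namespace Vorticity

/-! ### Young integration against a control -/

section Young

variable {E : Type*} [NormedAddCommGroup E]

/-- The pair `F`, `g` satisfies Young's condition on `[0, t]` with respect to the additive control
`(s, v) ↦ Φ v - Φ s`. When `θ > 1`, refining a partition changes the Riemann–Stieltjes sums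
little. -/
structure YoungControl (F : ℝ → E) (g Φ : ℝ → ℝ) (C θ t : ℝ) : Prop where
  mono : MonotoneOn Φ (Icc 0 t)
  one_lt : 1 < θ
  nonneg : 0 ≤ C
  bound : ∀ s m v, 0 ≤ s → s ≤ m → m ≤ v → v ≤ t →
    ‖F m - F s‖ * |g v - g m| ≤ C * (Φ v - Φ s) ^ θ

/-- The constant of the Young–Love estimate. -/
noncomputable def youngConst (θ : ℝ) : ℝ := 2 / (1 - 2 ^ (1 - θ))

lemma youngConst_pos {θ : ℝ} (h : 1 < θ) : 0 < youngConst θ := by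
  have : (2 : ℝ) ^ (1 - θ) < 1 := Real.rpow_lt_one_of_one_lt_of_neg (by norm_num) (by linarith)
  unfold youngConst
  exact div_pos (by norm_num) (by linarith)

lemma youngConst_eq {θ : ℝ} (h : 1 < θ) :
    2 * youngConst θ * (1 / 2) ^ θ + 2 = youngConst θ := by
  have h1 : (2 : ℝ) ^ (1 - θ) < 1 :=
    Real.rpow_lt_one_of_one_lt_of_neg (by norm_num) (by linarith)
  have h2 : (2 : ℝ) ^ (1 - θ) = 2 * (1 / 2) ^ θ := by
    rw [Real.rpow_sub (by norm_num), Real.rpow_one, Real.div_rpow (by norm_num) (by norm_num),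
      Real.one_rpow]; ring
  have h3 : (1 - (2 : ℝ) ^ (1 - θ)) ≠ 0 := by linarith
  unfold youngConst
  rw [h2] at *
  field_simp
  ring

lemma YoungControl.mono_sub {F : ℝ → E} {g Φ : ℝ → ℝ} {C θ t : ℝ}
    (h : YoungControl F g Φ C θ t) {s v : ℝ} (hs : 0 ≤ s) (hsv : s ≤ v) (hv : v ≤ t) :
    0 ≤ Φ v - Φ s :=
  sub_nonneg.2 (h.mono ⟨hs, hsv.trans hv⟩ ⟨hs.trans hsv, hv⟩ hsv)

variable [NormedSpace ℝ E]

/-- The left-point Riemann–Stieltjes sum of `F` against `g` over the points `p a, …, p b`. -/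
noncomputable def rsSum (F : ℝ → E) (g : ℝ → ℝ) (p : ℕ → ℝ) (a b : ℕ) : E :=
  ∑ i ∈ Finset.Ico a b, (g (p (i + 1)) - g (p i)) • F (p i)

/-- The **Young–Love estimate**: a Riemann–Stieltjes sum differs from the one-interval
approximation by at most a power of the control. The partition is cut where the control reaches
half of its value and the estimate is applied to both sides. -/
lemma YoungControl.norm_rsSum_sub_le {F : ℝ → E} {g Φ : ℝ → ℝ} {C θ t : ℝ}
    (h : YoungControl F g Φ C θ t) {p : ℕ → ℝ} (hp : Monotone p) :
    ∀ (n a b : ℕ), b - a ≤ n → a ≤ b → 0 ≤ p a → p b ≤ t →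
      ‖rsSum F g p a b - (g (p b) - g (p a)) • F (p a)‖ ≤
        youngConst θ * C * (Φ (p b) - Φ (p a)) ^ θ := by
  have hθ := h.one_lt
  have hK := youngConst_pos hθ
  intro n
  induction n with
  | zero =>
    intro a b hn hab ha hb
    obtain rfl : a = b := by omega
    have : 0 ≤ youngConst θ * C * (0 : ℝ) ^ θ :=
      mul_nonneg (mul_nonneg hK.le h.nonneg) (Real.rpow_nonneg le_rfl _)
    simpa [rsSum] using this
  | succ n ih =>
    intro a b hn hab ha hb
    rcases hab.eq_or_lt with rfl | hab'
    · exact ih a a (by omega) le_rfl ha hb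
    set w := Φ (p b) - Φ (p a) with hw
    have hpt : ∀ j, a ≤ j → j ≤ b → p j ∈ Icc 0 t := fun j h1 h2 =>
      ⟨ha.trans (hp h1), (hp h2).trans hb⟩
    have hw0 : 0 ≤ w := h.mono_sub ha (hp hab) hb
    obtain ⟨i, hi1, hi2, hi3, hi4⟩ : ∃ i, a ≤ i ∧ i < b ∧ Φ (p i) - Φ (p a) ≤ w / 2 ∧
        Φ (p b) - Φ (p (i + 1)) ≤ w / 2 := by
      classical
      set S := (Finset.Ico a b).filter fun i => Φ (p i) - Φ (p a) ≤ w / 2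
      have hS : S.Nonempty := ⟨a, by simp [S, hab']; linarith⟩
      have hm := S.max'_mem hS
      set i := S.max' hS
      simp only [S, Finset.mem_filter, Finset.mem_Ico] at hm
      refine ⟨i, hm.1.1, hm.1.2, hm.2, ?_⟩
      rcases (Nat.succ_le_of_lt hm.1.2).eq_or_lt with hib | hib
      · rw [show i + 1 = b from hib]; simp; linarith
      · by_contra hcon
        have : i + 1 ∈ S := by
          simp only [S, Finset.mem_filter, Finset.mem_Ico]
          refine ⟨⟨by omega, hib⟩, ?_⟩
          simp only [hw] at hcon ⊢
          linarith
        have := S.le_max' _ this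
        change i + 1 ≤ i at this
        omega
    have e1 := ih a i (by omega) hi1 ha (hpt i hi1 hi2.le).2
    have e2 := ih (i + 1) b (by omega) hi2 (hpt (i + 1) (by omega) hi2).1 hb
    have c1 := h.bound (p a) (p i) (p (i + 1)) ha (hp hi1) (hp (Nat.le_succ i))
      (hpt (i + 1) (by omega) hi2).2
    have c2 := h.bound (p a) (p (i + 1)) (p b) ha (hp (by omega)) (hp hi2) hb
    have hsplit : rsSum F g p a b - (g (p b) - g (p a)) • F (p a) =
        (rsSum F g p a i - (g (p i) - g (p a)) • F (p a)) +
        (rsSum F g p (i + 1) b - (g (p b) - g (p (i + 1))) • F (p (i + 1))) +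
        (g (p (i + 1)) - g (p i)) • (F (p i) - F (p a)) +
        (g (p b) - g (p (i + 1))) • (F (p (i + 1)) - F (p a)) := by
      have : rsSum F g p a b = rsSum F g p a i + (g (p (i + 1)) - g (p i)) • F (p i) +
          rsSum F g p (i + 1) b := by
        unfold rsSum
        rw [← Finset.sum_Ico_consecutive _ hi1 hi2.le, Finset.sum_eq_sum_Ico_succ_bot hi2, add_assoc]
      rw [this]
      module
    have hhalf : ∀ x, 0 ≤ x → x ≤ w / 2 → youngConst θ * C * x ^ θ ≤
        youngConst θ * C * ((1 / 2) ^ θ * w ^ θ) := by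
      intro x hx hxw
      rw [← Real.mul_rpow (by norm_num) hw0]
      have := h.nonneg
      gcongr
      linarith
    have d1 := e1.trans (hhalf _ (h.mono_sub ha (hp hi1) (hpt i hi1 hi2.le).2) hi3)
    have d2 := e2.trans (hhalf _ (h.mono_sub (hpt (i + 1) (by omega) hi2).1 (hp hi2) hb) hi4)
    have d3 : ‖(g (p (i + 1)) - g (p i)) • (F (p i) - F (p a))‖ ≤ C * w ^ θ := by
      rw [norm_smul, mul_comm, Real.norm_eq_abs]
      refine c1.trans ?_
      have h0 := h.mono_sub ha (hp (show a ≤ i + 1 by omega)) (hpt (i + 1) (by omega) hi2).2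
      have h1 := h.mono_sub (hpt (i + 1) (by omega) hi2).1 (hp hi2) hb
      exact mul_le_mul_of_nonneg_left (Real.rpow_le_rpow h0 (by linarith) (by linarith)) h.nonneg
    have d4 : ‖(g (p b) - g (p (i + 1))) • (F (p (i + 1)) - F (p a))‖ ≤ C * w ^ θ := by
      rw [norm_smul, mul_comm, Real.norm_eq_abs]
      exact c2
    rw [hsplit]
    refine (norm_add_le _ _).trans ?_
    refine (add_le_add_left ((norm_add_le _ _).trans
      (add_le_add_left (norm_add_le _ _) _)) _).trans ?_
    have key : youngConst θ * C * w ^ θ = 2 * (youngConst θ * C * ((1 / 2) ^ θ * w ^ θ)) +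
        2 * (C * w ^ θ) := by
      conv_lhs => rw [← youngConst_eq hθ]
      ring
    rw [key]
    linarith

/-- Two partitions of `[0, t]` have a common refinement. -/
lemma exists_common_refinement {t : ℝ} {p q : ℕ → ℝ} {n m : ℕ} (hp : Monotone p)
    (hq : Monotone q) (hp0 : p 0 = 0) (hq0 : q 0 = 0) (hpn : p n = t) (hqm : q m = t) :
    ∃ (e : ℕ → ℝ) (N : ℕ) (κ κ' : ℕ → ℕ), Monotone e ∧ Monotone κ ∧ Monotone κ' ∧
      κ 0 = 0 ∧ κ' 0 = 0 ∧ κ n = N ∧ κ' m = N ∧ (∀ i ≤ n, e (κ i) = p i) ∧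
      (∀ i ≤ m, e (κ' i) = q i) := by
  classical
  set S := (Finset.range (n + 1)).image p ∪ (Finset.range (m + 1)).image q
  have hpS : ∀ i, p (min i n) ∈ S := fun i =>
    Finset.mem_union_left _ (Finset.mem_image_of_mem _ (by simp))
  have hqS : ∀ i, q (min i m) ∈ S := fun i =>
    Finset.mem_union_right _ (Finset.mem_image_of_mem _ (by simp))
  have hS0 : ∀ x ∈ S, 0 ≤ x ∧ x ≤ t := by
    intro x hx
    simp only [S, Finset.mem_union, Finset.mem_image, Finset.mem_range] at hx
    rcases hx with ⟨i, hi, rfl⟩ | ⟨i, hi, rfl⟩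
    · exact ⟨hp0 ▸ hp (Nat.zero_le i), hpn ▸ hp (by omega)⟩
    · exact ⟨hq0 ▸ hq (Nat.zero_le i), hqm ▸ hq (by omega)⟩
  obtain ⟨N, hN⟩ : ∃ N, S.card = N + 1 :=
    Nat.exists_eq_succ_of_ne_zero (Finset.card_ne_zero_of_mem (hpS 0))
  set φ := S.orderIsoOfFin hN
  have hbot : ∀ x : S, (x : ℝ) = 0 → φ.symm x = 0 := by
    intro x hx
    have : φ.symm x ≤ φ.symm (φ 0) := φ.symm.monotone (by
      rw [← Subtype.coe_le_coe, hx]; exact (hS0 _ (φ 0).2).1)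
    simpa using this
  have htop : ∀ x : S, (x : ℝ) = t → φ.symm x = Fin.last N := by
    intro x hx
    have : φ.symm (φ (Fin.last N)) ≤ φ.symm x := φ.symm.monotone (by
      rw [← Subtype.coe_le_coe, hx]; exact (hS0 _ (φ _).2).2)
    simpa using this
  have hφ : ∀ x : S, ((φ ⟨min (φ.symm x : ℕ) N, by omega⟩ : S) : ℝ) = x := by
    intro x
    have : (⟨min (φ.symm x : ℕ) N, by omega⟩ : Fin (N + 1)) = φ.symm x := by
      ext; simp; omega
    rw [this, φ.apply_symm_apply]
  refine ⟨fun i => φ ⟨min i N, by omega⟩, N, fun i => φ.symm ⟨p (min i n), hpS i⟩,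
    fun i => φ.symm ⟨q (min i m), hqS i⟩, ?_, ?_, ?_, ?_, ?_, ?_, ?_, ?_, ?_⟩
  · intro i j hij
    have : (⟨min i N, by omega⟩ : Fin (N + 1)) ≤ ⟨min j N, by omega⟩ := by
      rw [Fin.le_def]; simp; omega
    exact φ.monotone this
  · intro i j hij
    exact φ.symm.monotone (by rw [← Subtype.coe_le_coe]; exact hp (by omega))
  · intro i j hij
    exact φ.symm.monotone (by rw [← Subtype.coe_le_coe]; exact hq (by omega))
  · simp only [hbot ⟨p (min 0 n), hpS 0⟩ (by simpa using hp0)]; rfl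
  · simp only [hbot ⟨q (min 0 m), hqS 0⟩ (by simpa using hq0)]; rfl
  · simp only [htop ⟨p (min n n), hpS n⟩ (by simpa using hpn)]; rfl
  · simp only [htop ⟨q (min m m), hqS m⟩ (by simpa using hqm)]; rfl
  · intro i hi
    simp only [hφ, min_eq_left hi]
  · intro i hi
    simp only [hφ, min_eq_left hi]

/-- The distance of a Riemann–Stieltjes sum from the sum over a finer partition. -/
lemma YoungControl.norm_rsSum_sub_rsSum_le {F : ℝ → E} {g Φ : ℝ → ℝ} {C θ t η : ℝ}
    (h : YoungControl F g Φ C θ t) {e p : ℕ → ℝ} {κ : ℕ → ℕ} {n : ℕ}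
    (he : Monotone e) (hκ : Monotone κ) (hp0 : p 0 = 0) (hpn : p n = t)
    (hκp : ∀ i ≤ n, e (κ i) = p i) (hη : ∀ i < n, Φ (p (i + 1)) - Φ (p i) ≤ η) :
    ‖rsSum F g e (κ 0) (κ n) - rsSum F g p 0 n‖ ≤
      youngConst θ * C * (η ^ (θ - 1) * (Φ t - Φ 0)) := by
  have hK := youngConst_pos h.one_lt
  have hmono : ∀ i j, i ≤ j → j ≤ n → p i ≤ p j := fun i j h1 h2 => by
    rw [← hκp i (by omega), ← hκp j h2]; exact he (hκ h1)
  have h1 : ∀ k ≤ n, rsSum F g e (κ 0) (κ k) =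
      ∑ i ∈ Finset.range k, rsSum F g e (κ i) (κ (i + 1)) := by
    intro k
    induction k with
    | zero => intro _; simp [rsSum]
    | succ k ih =>
      intro hk
      rw [Finset.sum_range_succ, ← ih (by omega)]
      exact (Finset.sum_Ico_consecutive _ (hκ (Nat.zero_le k)) (hκ (Nat.le_succ k))).symm
  have h2 : Φ t - Φ 0 = ∑ i ∈ Finset.range n, (Φ (p (i + 1)) - Φ (p i)) := by
    rw [Finset.sum_range_sub (fun i => Φ (p i)), hpn, hp0]
  rw [h1 n le_rfl, rsSum, ← Finset.range_eq_Ico, ← Finset.sum_sub_distrib, h2, Finset.mul_sum,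
    Finset.mul_sum]
  refine (norm_sum_le _ _).trans (Finset.sum_le_sum fun i hi => ?_)
  have hi' : i < n := Finset.mem_range.1 hi
  have e1 := h.norm_rsSum_sub_le he _ (κ i) (κ (i + 1)) le_rfl (hκ (Nat.le_succ i))
    (by rw [hκp i hi'.le, ← hp0]; exact hmono _ _ (Nat.zero_le i) hi'.le)
    (by rw [hκp _ hi', ← hpn]; exact hmono _ _ hi' le_rfl)
  rw [hκp i hi'.le, hκp _ hi'] at e1
  refine e1.trans ?_
  have hd : 0 ≤ Φ (p (i + 1)) - Φ (p i) := h.mono_sub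
    (by rw [← hp0]; exact hmono _ _ (Nat.zero_le i) hi'.le) (hmono _ _ (Nat.le_succ i) hi')
    (by rw [← hpn]; exact hmono _ _ hi' le_rfl)
  have hd2 : (Φ (p (i + 1)) - Φ (p i)) ^ θ =
      (Φ (p (i + 1)) - Φ (p i)) ^ (θ - 1) * (Φ (p (i + 1)) - Φ (p i)) := by
    have hθ := h.one_lt
    conv_rhs => rw [← Real.rpow_one (Φ (p (i + 1)) - Φ (p i)), ← Real.rpow_mul hd,
      ← Real.rpow_add_of_nonneg hd (by linarith) (by norm_num)]
    congr 1; ring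
  rw [hd2]
  have := h.nonneg
  have hθ := h.one_lt
  exact mul_le_mul_of_nonneg_left (mul_le_mul_of_nonneg_right
    (Real.rpow_le_rpow hd (hη i hi') (by linarith)) hd) (mul_nonneg hK.le h.nonneg)

/-- Fine partitions of `[0, t]` through a given intermediate point. -/
lemma exists_fine_partition {s t δ : ℝ} (hs : 0 ≤ s) (hst : s ≤ t) (hδ : 0 < δ) :
    ∃ (p : ℕ → ℝ) (n m : ℕ), Monotone p ∧ p 0 = 0 ∧ n ≤ m ∧ p n = s ∧ p m = t ∧
      ∀ i, p (i + 1) - p i < δ := by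
  set d := δ / 3 with hd
  have hd0 : 0 < d := by positivity
  set n := ⌈s / d⌉₊ with hn
  set k := ⌈(t - s) / d⌉₊ with hk
  have hnd : s ≤ n * d := (div_le_iff₀ hd0).1 (Nat.le_ceil _)
  have hkd : t - s ≤ k * d := (div_le_iff₀ hd0).1 (Nat.le_ceil _)
  refine ⟨fun i => min (i * d) s + min (((i - n : ℕ) : ℝ) * d) (t - s), n, n + k, ?_, ?_, by omega,
    ?_, ?_, ?_⟩
  · intro i j hij
    have h2 : i - n ≤ j - n := by omega
    dsimp only
    gcongr
  · simp [hs, hst]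
  · simp [hnd, hst]
  · simp [hkd]
    rw [min_eq_right]
    · ring
    · have : (0 : ℝ) ≤ k * d := by positivity
      linarith
  · intro i
    have h1 : min (((i + 1 : ℕ) : ℝ) * d) s ≤ min (i * d) s + d := by
      rw [← min_add_add_right]; push_cast
      exact min_le_min (by linarith) (by linarith)
    have h2 : min (((i + 1 - n : ℕ) : ℝ) * d) (t - s) ≤ min (((i - n : ℕ) : ℝ) * d) (t - s) + d := by
      rw [← min_add_add_right]
      refine min_le_min ?_ (by linarith)
      have : ((i + 1 - n : ℕ) : ℝ) ≤ ((i - n : ℕ) : ℝ) + 1 := by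
        exact_mod_cast (by omega : i + 1 - n ≤ i - n + 1)
      nlinarith
    dsimp only
    linarith

lemma HasYoungIntegral.exists_norm_lt {F : ℝ → E} {g : ℝ → ℝ} {t : ℝ} {J : E}
    (h : HasYoungIntegral (enorm : E → ℝ≥0∞) F g t J) {ε : ℝ} (hε : 0 < ε) :
    ∃ δ : ℝ, 0 < δ ∧ ∀ (n : ℕ) (p : ℕ → ℝ), Monotone p → p 0 = 0 → p n = t →
      (∀ i < n, p (i + 1) - p i < δ) → ‖rsSum F g p 0 n - J‖ < ε := by
  obtain ⟨δ, hδ, hδ'⟩ := h (ENNReal.ofReal ε) (by simpa using hε)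
  refine ⟨δ, hδ, fun n p h1 h2 h3 h4 => ?_⟩
  have := hδ' n p h1 h2 h3 h4
  rw [← ofReal_norm] at this
  rw [rsSum, ← Finset.range_eq_Ico]
  exact (ENNReal.ofReal_lt_ofReal_iff hε).1 this

lemma hasYoungIntegral_of_norm_lt {F : ℝ → E} {g : ℝ → ℝ} {t : ℝ} {J : E}
    (h : ∀ ε : ℝ, 0 < ε → ∃ δ : ℝ, 0 < δ ∧ ∀ (n : ℕ) (p : ℕ → ℝ), Monotone p → p 0 = 0 →
      p n = t → (∀ i < n, p (i + 1) - p i < δ) → ‖rsSum F g p 0 n - J‖ < ε) :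
    HasYoungIntegral (enorm : E → ℝ≥0∞) F g t J := by
  intro ε hε
  obtain ⟨ε', hε', hε''⟩ : ∃ ε' : ℝ, 0 < ε' ∧ ENNReal.ofReal ε' ≤ ε := by
    rcases eq_or_ne ε ⊤ with rfl | hne
    · exact ⟨1, one_pos, le_top⟩
    · exact ⟨ε.toReal, ENNReal.toReal_pos hε.ne' hne, by rw [ENNReal.ofReal_toReal hne]⟩
  obtain ⟨δ, hδ, hδ'⟩ := h ε' hε'
  refine ⟨δ, hδ, fun n p h1 h2 h3 h4 => lt_of_lt_of_le ?_ hε''⟩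
  have := hδ' n p h1 h2 h3 h4
  rw [rsSum, ← Finset.range_eq_Ico] at this
  rw [← ofReal_norm]
  exact (ENNReal.ofReal_lt_ofReal_iff hε').2 this

/-- Young integrals are unique. -/
lemma HasYoungIntegral.unique {F : ℝ → E} {g : ℝ → ℝ} {t : ℝ} {J J' : E} (ht : 0 ≤ t)
    (h : HasYoungIntegral (enorm : E → ℝ≥0∞) F g t J)
    (h' : HasYoungIntegral (enorm : E → ℝ≥0∞) F g t J') : J = J' := by
  by_contra hne
  have hε : 0 < ‖J - J'‖ / 2 := half_pos (norm_pos_iff.2 (sub_ne_zero.2 hne))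
  obtain ⟨δ, hδ, h1⟩ := h.exists_norm_lt hε
  obtain ⟨δ', hδ', h2⟩ := h'.exists_norm_lt hε
  obtain ⟨p, n, m, hp, hp0, -, -, hpm, hmesh⟩ :=
    exists_fine_partition (le_refl (0 : ℝ)) ht (lt_min hδ hδ')
  have a1 := h1 m p hp hp0 hpm fun i _ => (hmesh i).trans_le (min_le_left _ _)
  have a2 := h2 m p hp hp0 hpm fun i _ => (hmesh i).trans_le (min_le_right _ _)
  have : ‖J - J'‖ ≤ ‖rsSum F g p 0 m - J'‖ + ‖rsSum F g p 0 m - J‖ := by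
    rw [show J - J' = (rsSum F g p 0 m - J') - (rsSum F g p 0 m - J) by abel]
    exact norm_sub_le _ _
  linarith

/-- Existence of the Young integral of a controlled pair. -/
theorem YoungControl.exists_integral [CompleteSpace E] {F : ℝ → E} {g Φ : ℝ → ℝ} {C θ t : ℝ}
    (h : YoungControl F g Φ C θ t) (ht : 0 ≤ t) (hΦ : ContinuousOn Φ (Icc 0 t)) :
    ∃ J : E, HasYoungIntegral (enorm : E → ℝ≥0∞) F g t J := by
  have hK := youngConst_pos h.one_lt
  have hθ := h.one_lt
  -- Sums over any two fine partitions are close, by comparison with a common refinement.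
  have cauchy : ∀ ε : ℝ, 0 < ε → ∃ δ : ℝ, 0 < δ ∧ ∀ (n m : ℕ) (p q : ℕ → ℝ), Monotone p →
      Monotone q → p 0 = 0 → q 0 = 0 → p n = t → q m = t → (∀ i < n, p (i + 1) - p i < δ) →
      (∀ i < m, q (i + 1) - q i < δ) → ‖rsSum F g p 0 n - rsSum F g q 0 m‖ < ε := by
    intro ε hε
    obtain ⟨η, hη, hη'⟩ : ∃ η : ℝ, 0 < η ∧
        youngConst θ * C * (η ^ (θ - 1) * (Φ t - Φ 0)) < ε / 2 := by
      have hc : Tendsto (fun η : ℝ => youngConst θ * C * (η ^ (θ - 1) * (Φ t - Φ 0))) (𝓝[>] 0)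
          (𝓝 (youngConst θ * C * ((0 : ℝ) ^ (θ - 1) * (Φ t - Φ 0)))) := by
        refine Tendsto.mono_left ?_ nhdsWithin_le_nhds
        exact (((Real.continuousAt_rpow_const 0 (θ - 1) (Or.inr (by linarith))).tendsto).mul_const
          _).const_mul _
      rw [Real.zero_rpow (by linarith), zero_mul, mul_zero] at hc
      have := (hc.eventually (gt_mem_nhds (half_pos hε))).and self_mem_nhdsWithin
      obtain ⟨η, h1, h2⟩ := this.exists
      exact ⟨η, h2, h1⟩
    obtain ⟨δ, hδ, hδ'⟩ := Metric.uniformContinuousOn_iff.1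
      (isCompact_Icc.uniformContinuousOn_of_continuous hΦ) η hη
    have aux : ∀ (n : ℕ) (p : ℕ → ℝ), Monotone p → p 0 = 0 → p n = t →
        (∀ i < n, p (i + 1) - p i < δ) → ∀ i < n, Φ (p (i + 1)) - Φ (p i) ≤ η := by
      intro n p hp hp0 hpn hm i hi
      have hmem : ∀ j ≤ n, p j ∈ Icc 0 t := fun j hj =>
        ⟨hp0 ▸ hp (Nat.zero_le j), hpn ▸ hp hj⟩
      have := hδ' (p (i + 1)) (hmem _ hi) (p i) (hmem _ hi.le) (by
        rw [Real.dist_eq, abs_of_nonneg (sub_nonneg.2 (hp (Nat.le_succ i)))]; exact hm i hi)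
      rw [Real.dist_eq] at this
      exact (le_abs_self _).trans this.le
    refine ⟨δ, hδ, fun n m p q hp hq hp0 hq0 hpn hqm hmp hmq => ?_⟩
    obtain ⟨e, N, κ, κ', he, hκ, hκ', k0, k0', kn, kn', kp, kq⟩ :=
      exists_common_refinement hp hq hp0 hq0 hpn hqm
    have a1 := h.norm_rsSum_sub_rsSum_le he hκ hp0 hpn kp (aux n p hp hp0 hpn hmp)
    have a2 := h.norm_rsSum_sub_rsSum_le he hκ' hq0 hqm kq (aux m q hq hq0 hqm hmq)
    rw [k0, kn] at a1
    rw [k0', kn'] at a2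
    have : ‖rsSum F g p 0 n - rsSum F g q 0 m‖ ≤ ‖rsSum F g e 0 N - rsSum F g q 0 m‖ +
        ‖rsSum F g e 0 N - rsSum F g p 0 n‖ := by
      rw [show rsSum F g p 0 n - rsSum F g q 0 m = (rsSum F g e 0 N - rsSum F g q 0 m) -
        (rsSum F g e 0 N - rsSum F g p 0 n) by abel]
      exact norm_sub_le _ _
    linarith
  choose q N M hq hq0 _ _ hqM hmesh using fun k : ℕ =>
    exists_fine_partition (le_refl (0 : ℝ)) ht (Nat.one_div_pos_of_nat (α := ℝ) (n := k))
  have hsmall : ∀ δ : ℝ, 0 < δ → ∃ K : ℕ, ∀ k ≥ K, ∀ i, q k (i + 1) - q k i < δ := by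
    intro δ hδ
    obtain ⟨K, hK⟩ := exists_nat_one_div_lt hδ
    exact ⟨K, fun k hk i => (hmesh k i).trans_le ((Nat.one_div_le_one_div hk).trans hK.le)⟩
  have hcs : CauchySeq fun k => rsSum F g (q k) 0 (M k) := by
    rw [Metric.cauchySeq_iff]
    intro ε hε
    obtain ⟨δ, hδ, hδ'⟩ := cauchy ε hε
    obtain ⟨K, hK⟩ := hsmall δ hδ
    refine ⟨K, fun k hk l hl => ?_⟩
    rw [dist_eq_norm]
    exact hδ' _ _ _ _ (hq k) (hq l) (hq0 k) (hq0 l) (hqM k) (hqM l) (fun i _ => hK k hk i)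
      (fun i _ => hK l hl i)
  obtain ⟨J, hJ⟩ := cauchySeq_tendsto_of_complete hcs
  refine ⟨J, hasYoungIntegral_of_norm_lt fun ε hε => ?_⟩
  obtain ⟨δ, hδ, hδ'⟩ := cauchy (ε / 2) (half_pos hε)
  obtain ⟨K, hK⟩ := hsmall δ hδ
  refine ⟨δ, hδ, fun n p hp hp0 hpn hm => ?_⟩
  have hlim : Tendsto (fun k => ‖rsSum F g p 0 n - rsSum F g (q k) 0 (M k)‖) atTop
      (𝓝 ‖rsSum F g p 0 n - J‖) := (tendsto_const_nhds.sub hJ).norm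
  have : ‖rsSum F g p 0 n - J‖ ≤ ε / 2 := le_of_tendsto hlim (by
    filter_upwards [eventually_ge_atTop K] with k hk
    exact (hδ' _ _ _ _ hp (hq k) hp0 (hq0 k) hpn (hqM k) hm fun i _ => hK k hk i).le)
  linarith

/-- The Young–Love estimate for the increments of the indefinite Young integral. -/
lemma YoungControl.norm_integral_sub_le {F : ℝ → E} {g Φ : ℝ → ℝ} {C θ T s t : ℝ} {Js Jt : E}
    (h : YoungControl F g Φ C θ T) (hs : 0 ≤ s) (hst : s ≤ t) (htT : t ≤ T)
    (hJs : HasYoungIntegral (enorm : E → ℝ≥0∞) F g s Js)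
    (hJt : HasYoungIntegral (enorm : E → ℝ≥0∞) F g t Jt) :
    ‖Jt - Js - (g t - g s) • F s‖ ≤ youngConst θ * C * (Φ t - Φ s) ^ θ := by
  refine le_of_forall_pos_lt_add fun ε hε => ?_
  obtain ⟨δ, hδ, h1⟩ := hJs.exists_norm_lt (half_pos hε)
  obtain ⟨δ', hδ', h2⟩ := hJt.exists_norm_lt (half_pos hε)
  obtain ⟨p, n, m, hp, hp0, hnm, hpn, hpm, hmesh⟩ := exists_fine_partition hs hst (lt_min hδ hδ')
  have a1 := h1 n p hp hp0 hpn fun i _ => (hmesh i).trans_le (min_le_left _ _)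
  have a2 := h2 m p hp hp0 hpm fun i _ => (hmesh i).trans_le (min_le_right _ _)
  have a3 := h.norm_rsSum_sub_le hp _ n m le_rfl hnm (hpn ▸ hs) (hpm ▸ htT)
  rw [hpn, hpm] at a3
  have hsum : rsSum F g p 0 m = rsSum F g p 0 n + rsSum F g p n m :=
    (Finset.sum_Ico_consecutive _ (Nat.zero_le n) hnm).symm
  have : Jt - Js - (g t - g s) • F s = (rsSum F g p n m - (g t - g s) • F s) +
      (rsSum F g p 0 n - Js) - (rsSum F g p 0 m - Jt) := by
    rw [hsum]; abel
  rw [this]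
  have b1 := norm_sub_le ((rsSum F g p n m - (g t - g s) • F s) + (rsSum F g p 0 n - Js))
    (rsSum F g p 0 m - Jt)
  have b2 := norm_add_le (rsSum F g p n m - (g t - g s) • F s) (rsSum F g p 0 n - Js)
  linarith

lemma HasYoungIntegral.add {F G : ℝ → E} {g : ℝ → ℝ} {t : ℝ} {I J : E}
    (hF : HasYoungIntegral (enorm : E → ℝ≥0∞) F g t I)
    (hG : HasYoungIntegral (enorm : E → ℝ≥0∞) G g t J) :
    HasYoungIntegral (enorm : E → ℝ≥0∞) (fun r => F r + G r) g t (I + J) := by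
  refine hasYoungIntegral_of_norm_lt fun ε hε => ?_
  obtain ⟨δ, hδ, h1⟩ := hF.exists_norm_lt (half_pos hε)
  obtain ⟨δ', hδ', h2⟩ := hG.exists_norm_lt (half_pos hε)
  refine ⟨min δ δ', lt_min hδ hδ', fun n p hp hp0 hpn hm => ?_⟩
  have a1 := h1 n p hp hp0 hpn fun i hi => (hm i hi).trans_le (min_le_left _ _)
  have a2 := h2 n p hp hp0 hpn fun i hi => (hm i hi).trans_le (min_le_right _ _)
  have : rsSum (fun r => F r + G r) g p 0 n - (I + J) =
      (rsSum F g p 0 n - I) + (rsSum G g p 0 n - J) := by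
    simp only [rsSum, smul_add, Finset.sum_add_distrib]; abel
  rw [this]
  exact (norm_add_le _ _).trans_lt (by linarith)

lemma HasYoungIntegral.const_smul {F : ℝ → E} {g : ℝ → ℝ} {t : ℝ} {I : E} (c : ℝ)
    (hF : HasYoungIntegral (enorm : E → ℝ≥0∞) F g t I) :
    HasYoungIntegral (enorm : E → ℝ≥0∞) (fun r => c • F r) g t (c • I) := by
  refine hasYoungIntegral_of_norm_lt fun ε hε => ?_
  obtain ⟨δ, hδ, h1⟩ := hF.exists_norm_lt (show 0 < ε / (|c| + 1) by positivity)
  refine ⟨δ, hδ, fun n p hp hp0 hpn hm => ?_⟩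
  have a1 := h1 n p hp hp0 hpn hm
  have : rsSum (fun r => c • F r) g p 0 n - c • I = c • (rsSum F g p 0 n - I) := by
    simp only [rsSum, smul_sub, Finset.smul_sum]
    congr 1
    exact Finset.sum_congr rfl fun i _ => smul_comm _ _ _
  rw [this, norm_smul, Real.norm_eq_abs]
  rw [lt_div_iff₀ (by positivity)] at a1
  nlinarith [norm_nonneg (rsSum F g p 0 n - I), abs_nonneg c]

lemma HasYoungIntegral.congr {F G : ℝ → E} {g : ℝ → ℝ} {t : ℝ} {I : E}
    (hF : HasYoungIntegral (enorm : E → ℝ≥0∞) F g t I) (h : ∀ r ∈ Icc 0 t, F r = G r) :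
    HasYoungIntegral (enorm : E → ℝ≥0∞) G g t I := by
  refine hasYoungIntegral_of_norm_lt fun ε hε => ?_
  obtain ⟨δ, hδ, h1⟩ := hF.exists_norm_lt hε
  refine ⟨δ, hδ, fun n p hp hp0 hpn hm => ?_⟩
  have : rsSum G g p 0 n = rsSum F g p 0 n := by
    refine Finset.sum_congr rfl fun i hi => ?_
    rw [Finset.mem_Ico] at hi
    rw [h (p i) ⟨hp0 ▸ hp (Nat.zero_le i), hpn ▸ hp hi.2.le⟩]
  rw [this]
  exact h1 n p hp hp0 hpn hm

end Young

/-! ### Hölder regularity of fractional Brownian paths -/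

/-- The Hölder estimate behind Kolmogorov's continuity theorem: a continuous function on `[0, 1]`
whose increments over dyadic intervals of length `2⁻ⁿ` are at most `M 2^{-γn}` is `γ`-Hölder. -/
lemma holder_of_dyadic {f : ℝ → ℝ} {M γ : ℝ} (hγ : 0 < γ) (hM : 0 ≤ M)
    (hf : ContinuousOn f (Icc 0 1))
    (h : ∀ n i : ℕ, i < 2 ^ n →
      |f ((i + 1 : ℕ) / 2 ^ n) - f ((i : ℕ) / 2 ^ n)| ≤ M * ((1 / 2) ^ γ) ^ n) :
    ∃ C, 0 ≤ C ∧ ∀ s ∈ Icc (0 : ℝ) 1, ∀ t ∈ Icc (0 : ℝ) 1, |f t - f s| ≤ C * |t - s| ^ γ := by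
  set ρ : ℝ := (1 / 2) ^ γ with hρ
  have hρ0 : 0 < ρ := by positivity
  have hρ1 : ρ < 1 := Real.rpow_lt_one (by norm_num) (by norm_num) hγ
  -- dyadic approximation from below
  let D : ℕ → ℝ → ℝ := fun n s => (⌊2 ^ n * s⌋₊ : ℝ) / 2 ^ n
  have hDle : ∀ n s, 0 ≤ s → D n s ≤ s := fun n s hs => by
    rw [div_le_iff₀ (by positivity), mul_comm]
    exact Nat.floor_le (by positivity)
  have hDge : ∀ n s, s - 1 / 2 ^ n ≤ D n s := fun n s => by
    have := Nat.lt_floor_add_one (2 ^ n * s)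
    rw [sub_le_iff_le_add, ← add_div, le_div_iff₀ (by positivity), mul_comm]
    exact this.le
  have hDmem : ∀ n s, s ∈ Icc (0 : ℝ) 1 → D n s ∈ Icc (0 : ℝ) 1 := fun n s hs =>
    ⟨by positivity, (hDle n s hs.1).trans hs.2⟩
  have hfloor : ∀ n s, s ∈ Icc (0 : ℝ) 1 → ⌊2 ^ n * s⌋₊ ≤ 2 ^ n := fun n s hs => by
    apply Nat.floor_le_of_le
    push_cast
    nlinarith [hs.1, hs.2, show (0 : ℝ) < 2 ^ n by positivity]
  have hDlim : ∀ s ∈ Icc (0 : ℝ) 1, Tendsto (fun n => f (D n s)) atTop (𝓝 (f s)) := by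
    intro s hs
    refine (hf s hs).tendsto.comp (tendsto_nhdsWithin_iff.2 ⟨?_, .of_forall fun n => hDmem n s hs⟩)
    refine tendsto_of_tendsto_of_tendsto_of_le_of_le (g := fun n : ℕ => s - 1 / 2 ^ n)
      (h := fun _ => s) ?_ tendsto_const_nhds (fun n => hDge n s) (fun n => hDle n s hs.1)
    have : Tendsto (fun n : ℕ => ((1 : ℝ) / 2) ^ n) atTop (𝓝 0) :=
      tendsto_pow_atTop_nhds_zero_of_lt_one (by norm_num) (by norm_num)
    simpa [one_div, inv_pow] using (tendsto_const_nhds (x := s)).sub this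
  have hstep : ∀ s ∈ Icc (0 : ℝ) 1, ∀ n, dist (f (D n s)) (f (D (n + 1) s)) ≤ M * ρ * ρ ^ n := by
    intro s hs n
    rw [dist_comm, Real.dist_eq, mul_assoc, ← pow_succ']
    have e1 : ⌊(2 : ℝ) ^ (n + 1) * s⌋₊ / 2 = ⌊(2 : ℝ) ^ n * s⌋₊ := by
      rw [← Nat.floor_div_ofNat]
      congr 1
      rw [pow_succ]; ring
    have e2 : D n s = ((2 * ⌊(2 : ℝ) ^ n * s⌋₊ : ℕ) : ℝ) / 2 ^ (n + 1) := by
      simp only [D, pow_succ]; push_cast; field_simp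
    rcases Nat.even_or_odd' ⌊(2 : ℝ) ^ (n + 1) * s⌋₊ with ⟨k, hk | hk⟩
    · have : D (n + 1) s = D n s := by
        rw [e2]; simp only [D]; rw [hk, show ⌊(2 : ℝ) ^ n * s⌋₊ = k by omega]
      rw [this, sub_self, abs_zero]; positivity
    · have : D (n + 1) s = ((2 * ⌊(2 : ℝ) ^ n * s⌋₊ + 1 : ℕ) : ℝ) / 2 ^ (n + 1) := by
        simp only [D]; rw [hk, show ⌊(2 : ℝ) ^ n * s⌋₊ = k by omega]
      rw [e2, this]
      refine h (n + 1) _ ?_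
      have := hfloor (n + 1) s hs
      rw [hk] at this
      omega
  have htail : ∀ s ∈ Icc (0 : ℝ) 1, ∀ n, |f (D n s) - f s| ≤ M * ρ * ρ ^ n / (1 - ρ) :=
    fun s hs n => by
      rw [← Real.dist_eq]
      exact dist_le_of_le_geometric_of_tendsto ρ (M * ρ) hρ1 (hstep s hs) (hDlim s hs) n
  set C : ℝ := (2 * (M * ρ / (1 - ρ)) + M) * 2 ^ γ with hC
  have hC0 : 0 ≤ C := by
    have : 0 < 1 - ρ := by linarith
    positivity
  have main : ∀ s ∈ Icc (0 : ℝ) 1, ∀ t ∈ Icc (0 : ℝ) 1, s < t → |f t - f s| ≤ C * |t - s| ^ γ := by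
    intro s hs t ht hst
    have hts : 0 < t - s := sub_pos.2 hst
    obtain ⟨n, hn1, hn2⟩ : ∃ n : ℕ, (1 / 2 : ℝ) ^ (n + 1) < t - s ∧ t - s ≤ (1 / 2) ^ n :=
      exists_nat_pow_near_of_lt_one hts (by linarith [hs.1, ht.2]) (by norm_num) (by norm_num)
    have hpow : ρ ^ n ≤ 2 ^ γ * (t - s) ^ γ := by
      rw [← Real.mul_rpow (by norm_num) hts.le, hρ, ← Real.rpow_natCast, ← Real.rpow_mul (by norm_num),
        mul_comm, Real.rpow_mul (by norm_num), Real.rpow_natCast]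
      refine Real.rpow_le_rpow (by positivity) ?_ hγ.le
      rw [pow_succ] at hn1
      linarith
    have hmid : |f (D n t) - f (D n s)| ≤ M * ρ ^ n := by
      have hle : ⌊(2 : ℝ) ^ n * s⌋₊ ≤ ⌊(2 : ℝ) ^ n * t⌋₊ := Nat.floor_le_floor (by gcongr)
      have hle2 : ⌊(2 : ℝ) ^ n * t⌋₊ ≤ ⌊(2 : ℝ) ^ n * s⌋₊ + 1 := by
        rw [← Nat.floor_add_one (by have := hs.1; positivity)]
        apply Nat.floor_le_floor
        have : (2 : ℝ) ^ n * (t - s) ≤ 1 := by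
          calc (2 : ℝ) ^ n * (t - s) ≤ 2 ^ n * (1 / 2) ^ n := by gcongr
            _ = 1 := by rw [← mul_pow]; norm_num
        linarith
      rcases hle.eq_or_lt with he | hlt
      · have : D n t = D n s := by simp only [D]; rw [he]
        rw [this, sub_self, abs_zero]; positivity
      · have he : ⌊(2 : ℝ) ^ n * t⌋₊ = ⌊(2 : ℝ) ^ n * s⌋₊ + 1 := by omega
        have h1 := hfloor n t ht
        have := h n ⌊(2 : ℝ) ^ n * s⌋₊ (by omega)
        rw [← he] at this
        exact this
    have a1 := htail s hs n
    have a2 := htail t ht n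
    have : |f t - f s| ≤ |f (D n t) - f t| + |f (D n t) - f (D n s)| + |f (D n s) - f s| := by
      rw [show f t - f s = -(f (D n t) - f t) + (f (D n t) - f (D n s)) + (f (D n s) - f s) by ring]
      refine (abs_add_le _ _).trans (add_le_add_left ((abs_add_le _ _).trans ?_) _)
      rw [abs_neg]
    rw [abs_of_pos hts]
    calc |f t - f s| ≤ (2 * (M * ρ / (1 - ρ)) + M) * ρ ^ n := by
          refine this.trans ((add_le_add (add_le_add a2 hmid) a1).trans (le_of_eq ?_))
          ring
      _ ≤ (2 * (M * ρ / (1 - ρ)) + M) * (2 ^ γ * (t - s) ^ γ) := by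
          have : 0 < 1 - ρ := by linarith
          gcongr
      _ = C * (t - s) ^ γ := by rw [hC]; ring
  refine ⟨C, hC0, fun s hs t ht => ?_⟩
  rcases lt_trichotomy s t with hst | rfl | hst
  · exact main s hs t ht hst
  · simp; positivity
  · rw [abs_sub_comm, abs_sub_comm t s]; exact main t ht s hs hst

/-- The even moments of a centred real Gaussian variable. -/
lemma lintegral_pow_gaussianReal_le (m : ℕ) : ∃ A : ℝ≥0, ∀ v : ℝ≥0,
    ∫⁻ x, ENNReal.ofReal (x ^ (2 * m)) ∂(gaussianReal 0 v) = A * (v : ℝ≥0∞) ^ m := by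
  have hfin : ∫⁻ x, ENNReal.ofReal (x ^ (2 * m)) ∂(gaussianReal 0 1) < ⊤ := by
    have h := (memLp_id_gaussianReal (μ := 0) (v := 1) (2 * m : ℕ)).integrable_norm_pow'
    refine lt_of_le_of_lt (lintegral_mono fun x => ?_) h.hasFiniteIntegral
    simp only [id, ← ofReal_norm]
    refine ENNReal.ofReal_le_ofReal (le_of_eq ?_)
    rw [norm_pow, norm_norm, Real.norm_eq_abs, pow_mul, pow_mul, sq_abs]
  refine ⟨(∫⁻ x, ENNReal.ofReal (x ^ (2 * m)) ∂(gaussianReal 0 1)).toNNReal, fun v => ?_⟩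
  rw [ENNReal.coe_toNNReal hfin.ne]
  have hmap : gaussianReal 0 v = (gaussianReal 0 1).map (fun x => Real.sqrt v * x) := by
    rw [gaussianReal_map_const_mul]
    congr 1
    · simp
    · ext; simp
  rw [hmap, lintegral_map (by fun_prop) (by fun_prop), ← lintegral_mul_const _ (by fun_prop)]
  refine lintegral_congr fun x => ?_
  rw [mul_pow, pow_mul (Real.sqrt v), Real.sq_sqrt (NNReal.coe_nonneg v), mul_comm,
    ENNReal.ofReal_mul (by rw [pow_mul]; positivity), ENNReal.ofReal_pow (NNReal.coe_nonneg v),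
    ENNReal.ofReal_coe_nnreal]

lemma IsFractionalBrownianMotion.lintegral_increment {Ω : Type*} [MeasurableSpace Ω] {H : ℝ}
    {W : ℝ≥0 → Ω → ℝ} {P : Measure Ω} (hW : IsFractionalBrownianMotion H W P) (hH : 0 < H)
    (m : ℕ) : ∃ A : ℝ≥0, ∀ s t : ℝ≥0,
      ∫⁻ a, ENNReal.ofReal ((W t a - W s a) ^ (2 * m)) ∂P =
        A * ENNReal.ofReal (|(t : ℝ) - s| ^ (2 * H)) ^ m := by
  obtain ⟨A, hA⟩ := lintegral_pow_gaussianReal_le m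
  refine ⟨A, fun s t => ?_⟩
  have := hW.gaussian.isProbabilityMeasure
  have hL := hW.gaussian.hasGaussianLaw_fun_sub (s := t) (t := s)
  have h2 : ∀ r, MemLp (W r) 2 P := fun r => (hW.gaussian.hasGaussianLaw_eval r).memLp_two
  have hmean : ∫ a, (W t a - W s a) ∂P = 0 := by
    rw [integral_sub ((h2 t).integrable one_le_two) ((h2 s).integrable one_le_two),
      hW.mean_zero, hW.mean_zero, sub_zero]
  have hvar : variance (fun a => W t a - W s a) P = |(t : ℝ) - s| ^ (2 * H) := by
    have h0 : (0 : ℝ) ^ (2 * H) = 0 := Real.zero_rpow (by linarith)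
    rw [variance_fun_sub (h2 t) (h2 s), ← covariance_self (h2 t).aemeasurable,
      ← covariance_self (h2 s).aemeasurable, hW.cov, hW.cov, hW.cov, abs_sub_comm (s : ℝ) t]
    simp only [sub_self, abs_zero, h0]
    ring
  have hmap := hL.map_eq_gaussianReal
  rw [hmean, hvar] at hmap
  have := lintegral_map' (μ := P) (f := fun x : ℝ => ENNReal.ofReal (x ^ (2 * m)))
    (g := fun a => W t a - W s a) (by fun_prop) hL.aemeasurable
  rw [← this, hmap, hA]
  rfl

/-- Kolmogorov's continuity theorem for fractional Brownian motion: the paths are almost surely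
`γ`-Hölder on `[0, T]` for every `γ < H`. -/
theorem IsFractionalBrownianMotion.ae_holder {Ω : Type*} [MeasurableSpace Ω] {H γ T : ℝ}
    {W : ℝ≥0 → Ω → ℝ} {P : Measure Ω} (hW : IsFractionalBrownianMotion H W P) (hγ : 0 < γ)
    (hγH : γ < H) (hT : 0 < T) :
    ∀ᵐ a ∂P, ∃ C, 0 ≤ C ∧ ∀ s ∈ Icc 0 T, ∀ t ∈ Icc 0 T,
      |path W a t - path W a s| ≤ C * |t - s| ^ γ := by
  have hH : 0 < H := hγ.trans hγH
  obtain ⟨m, hm⟩ := exists_nat_gt (1 / (2 * (H - γ)))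
  have hHγ : 0 < 2 * (H - γ) := by linarith
  rw [div_lt_iff₀ hHγ] at hm
  have hm1 : m ≠ 0 := by rintro rfl; norm_num at hm
  obtain ⟨A, hA⟩ := hW.lintegral_increment hH m
  set ρ : ℝ := (1 / 2) ^ γ with hρ
  have hρ0 : 0 < ρ := by positivity
  -- the time grid
  let τ : ℕ → ℕ → ℝ≥0 := fun n i => (T * (i / 2 ^ n)).toNNReal
  have hτ : ∀ n i, (τ n i : ℝ) = T * (i / 2 ^ n) := fun n i =>
    Real.coe_toNNReal _ (by positivity)
  let S : Ω → ℝ≥0∞ := fun a => ∑' n : ℕ, ∑ i ∈ Finset.range (2 ^ n),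
    ENNReal.ofReal ((ρ ^ (2 * m))⁻¹ ^ n) *
      ENNReal.ofReal ((W (τ n (i + 1)) a - W (τ n i) a) ^ (2 * m))
  set q : ℝ := 2 * ((ρ ^ (2 * m))⁻¹ * ((1 / 2) ^ (2 * H)) ^ m) with hq
  have hq0 : 0 ≤ q := by positivity
  have hq1 : q < 1 := by
    have : q = 2 ^ (1 - m * (2 * (H - γ))) := by
      rw [hq, hρ, one_div, Real.inv_rpow (by norm_num), Real.inv_rpow (by norm_num), inv_pow, inv_inv,
        inv_pow, ← Real.rpow_natCast, ← Real.rpow_natCast, ← Real.rpow_mul (by norm_num),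
        ← Real.rpow_mul (by norm_num), ← Real.rpow_neg (by norm_num),
        ← Real.rpow_add (by norm_num), mul_comm, ← Real.rpow_add_one (by norm_num)]
      congr 1
      push_cast
      ring
    rw [this]
    exact Real.rpow_lt_one_of_one_lt_of_neg (by norm_num) (by linarith)
  have hS : ∫⁻ a, S a ∂P ≠ ⊤ := by
    have hmeas : ∀ n i, AEMeasurable (fun a => ENNReal.ofReal ((ρ ^ (2 * m))⁻¹ ^ n) *
        ENNReal.ofReal ((W (τ n (i + 1)) a - W (τ n i) a) ^ (2 * m))) P := fun n i =>
      (((hW.gaussian.aemeasurable _).sub (hW.gaussian.aemeasurable _)).pow_const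
        (2 * m)).ennreal_ofReal.const_mul _
    have hval : ∀ n, ∫⁻ a, ∑ i ∈ Finset.range (2 ^ n), ENNReal.ofReal ((ρ ^ (2 * m))⁻¹ ^ n) *
        ENNReal.ofReal ((W (τ n (i + 1)) a - W (τ n i) a) ^ (2 * m)) ∂P =
        (A * ENNReal.ofReal ((T ^ (2 * H)) ^ m)) * ENNReal.ofReal q ^ n := by
      intro n
      rw [lintegral_finsetSum' _ fun i _ => hmeas n i]
      have : ∀ i ∈ Finset.range (2 ^ n), ∫⁻ a, ENNReal.ofReal ((ρ ^ (2 * m))⁻¹ ^ n) *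
          ENNReal.ofReal ((W (τ n (i + 1)) a - W (τ n i) a) ^ (2 * m)) ∂P =
          ENNReal.ofReal ((ρ ^ (2 * m))⁻¹ ^ n) *
            (A * ENNReal.ofReal ((T * (1 / 2) ^ n) ^ (2 * H)) ^ m) := by
        intro i _
        rw [lintegral_const_mul' _ _ ENNReal.ofReal_ne_top, hA, hτ, hτ]
        congr 5
        rw [← mul_sub, ← sub_div]
        push_cast
        rw [add_sub_cancel_left, abs_of_nonneg (by positivity), one_div, one_div, inv_pow]
      rw [Finset.sum_congr rfl this, Finset.sum_const, Finset.card_range, nsmul_eq_mul]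
      have hT0 := hT.le
      rw [← ENNReal.ofReal_pow (by positivity), ← ENNReal.ofReal_pow hq0, mul_assoc,
        ← ENNReal.ofReal_mul (by positivity), mul_left_comm _ (A : ℝ≥0∞),
        ← ENNReal.ofReal_mul (by positivity), mul_left_comm _ (A : ℝ≥0∞)]
      congr 1
      rw [← ENNReal.ofReal_natCast, ← ENNReal.ofReal_mul (by positivity)]
      congr 1
      have hpow : ((1 / 2 : ℝ) ^ n) ^ (2 * H) = ((1 / 2) ^ (2 * H)) ^ n := by
        rw [← Real.rpow_natCast, ← Real.rpow_natCast, ← Real.rpow_mul (by norm_num),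
          ← Real.rpow_mul (by norm_num), mul_comm]
      rw [hq, Real.mul_rpow hT.le (by positivity), hpow]
      push_cast
      ring
    simp only [S]
    rw [lintegral_tsum fun n => Finset.aemeasurable_fun_sum _ fun i _ => hmeas n i]
    simp only [hval]
    rw [ENNReal.tsum_mul_left, ENNReal.tsum_geometric]
    refine ENNReal.mul_ne_top (ENNReal.mul_ne_top ENNReal.coe_ne_top ENNReal.ofReal_ne_top) ?_
    rw [ENNReal.inv_ne_top]
    exact (tsub_pos_of_lt (by rwa [ENNReal.ofReal_lt_one])).ne'
  have hSmeas : AEMeasurable S P := by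
    refine AEMeasurable.tsum fun n => Finset.aemeasurable_fun_sum _ fun i _ => ?_
    exact (((hW.gaussian.aemeasurable _).sub (hW.gaussian.aemeasurable _)).pow_const
        (2 * m)).ennreal_ofReal.const_mul _
  filter_upwards [ae_lt_top' hSmeas hS, hW.continuous_paths] with a ha hc
  obtain ⟨C, hC, hC'⟩ := holder_of_dyadic (f := fun x => path W a (T * x)) (M := (S a).toReal + 1)
    hγ (by positivity) (by
      have : Continuous fun x : ℝ => path W a (T * x) := by
        unfold path
        exact hc.comp (continuous_real_toNNReal.comp (continuous_const.mul continuous_id))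
      exact this.continuousOn) (by
    intro n i hi
    have h1 : ENNReal.ofReal ((ρ ^ (2 * m))⁻¹ ^ n) *
        ENNReal.ofReal ((W (τ n (i + 1)) a - W (τ n i) a) ^ (2 * m)) ≤ S a :=
      (Finset.single_le_sum (f := fun i => ENNReal.ofReal ((ρ ^ (2 * m))⁻¹ ^ n) *
        ENNReal.ofReal ((W (τ n (i + 1)) a - W (τ n i) a) ^ (2 * m)))
        (fun _ _ => zero_le) (Finset.mem_range.2 hi)).trans
        (ENNReal.le_tsum (f := fun n : ℕ => ∑ i ∈ Finset.range (2 ^ n),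
          ENNReal.ofReal ((ρ ^ (2 * m))⁻¹ ^ n) *
          ENNReal.ofReal ((W (τ n (i + 1)) a - W (τ n i) a) ^ (2 * m))) n)
    rw [← ENNReal.ofReal_mul (by positivity), ← ENNReal.ofReal_toReal ha.ne,
      ENNReal.ofReal_le_ofReal_iff ENNReal.toReal_nonneg, inv_pow, inv_mul_le_iff₀ (by positivity)]
      at h1
    refine le_of_pow_le_pow_left₀ (n := 2 * m) (by omega) (by positivity) ?_
    have h2 : (S a).toReal ≤ ((S a).toReal + 1) ^ (2 * m) := by
      have : (S a).toReal + 1 ≤ ((S a).toReal + 1) ^ (2 * m) :=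
        le_self_pow₀ (by linarith [ENNReal.toReal_nonneg (a := S a)]) (by omega)
      linarith
    rw [pow_mul, sq_abs, ← pow_mul]
    refine (h1.trans (mul_le_mul_of_nonneg_left h2 (by positivity))).trans (le_of_eq ?_)
    rw [mul_pow, ← pow_mul, ← pow_mul, mul_comm n, mul_comm])
  refine ⟨C * (1 / T) ^ γ, by positivity, fun s hs t ht => ?_⟩
  have hmem : ∀ r ∈ Icc 0 T, r / T ∈ Icc (0 : ℝ) 1 := fun r hr =>
    ⟨div_nonneg hr.1 hT.le, (div_le_one hT).2 hr.2⟩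
  have := hC' (s / T) (hmem s hs) (t / T) (hmem t ht)
  rw [mul_div_cancel₀ _ hT.ne', mul_div_cancel₀ _ hT.ne'] at this
  refine this.trans (le_of_eq ?_)
  rw [← sub_div, div_eq_mul_one_div, abs_mul, abs_of_pos (show 0 < 1 / T by positivity),
    Real.mul_rpow (abs_nonneg _) (by positivity)]
  ring

open UnitAddTorus ComplexConjugate

/-! ### Fourier coefficients on the torus -/

instance : IsProbabilityMeasure torusMeasure := by
  unfold torusMeasure; infer_instance

instance : torusMeasure.IsAddLeftInvariant := by
  unfold torusMeasure; infer_instance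

/-- The point `h eᵢ` of the torus. -/
abbrev axis (i : Fin 2) (h : ℝ) : Torus := Pi.single i (h : UnitAddCircle)

lemma coeff_eq_integral (f : Torus → ℝ) (k : Fin 2 → ℤ) :
    coeff f k = ∫ x, mFourier (-k) x * (f x : ℂ) ∂torusMeasure := rfl

lemma integrable_of_continuous {E : Type*} [NormedAddCommGroup E] {f : Torus → E}
    (hf : Continuous f) : Integrable f torusMeasure :=
  hf.integrable_of_hasCompactSupport (HasCompactSupport.of_compactSpace f)

lemma integrable_coeff {f : Torus → ℝ} (hf : Continuous f) (k : Fin 2 → ℤ) :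
    Integrable (fun x => mFourier (-k) x * (f x : ℂ)) torusMeasure :=
  integrable_of_continuous (by fun_prop)

lemma coeff_add {f g : Torus → ℝ} (hf : Continuous f) (hg : Continuous g) (k : Fin 2 → ℤ) :
    coeff (f + g) k = coeff f k + coeff g k := by
  simp only [coeff_eq_integral]
  rw [← integral_add (integrable_coeff hf k) (integrable_coeff hg k)]
  simp [mul_add]

lemma coeff_sub {f g : Torus → ℝ} (hf : Continuous f) (hg : Continuous g) (k : Fin 2 → ℤ) :
    coeff (f - g) k = coeff f k - coeff g k := by
  simp only [coeff_eq_integral]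
  rw [← integral_sub (integrable_coeff hf k) (integrable_coeff hg k)]
  simp [mul_sub]

lemma coeff_smul (c : ℝ) (f : Torus → ℝ) (k : Fin 2 → ℤ) :
    coeff (c • f) k = c * coeff f k := by
  simp only [coeff_eq_integral, ← integral_const_mul]
  congr 1; ext x; simp; ring

lemma coeff_sum {ι : Type*} (S : Finset ι) {f : ι → Torus → ℝ} (hf : ∀ i ∈ S, Continuous (f i))
    (k : Fin 2 → ℤ) : coeff (∑ i ∈ S, f i) k = ∑ i ∈ S, coeff (f i) k := by
  simp only [coeff_eq_integral]
  rw [← integral_finsetSum S fun i hi => integrable_coeff (hf i hi) k]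
  simp [Finset.mul_sum]

lemma coeff_neg_freq (f : Torus → ℝ) (k : Fin 2 → ℤ) : coeff f (-k) = conj (coeff f k) := by
  simp only [coeff_eq_integral, ← integral_conj]
  congr 1; ext x
  simp [mFourier_neg]

lemma norm_mFourier_apply (k : Fin 2 → ℤ) (x : Torus) : ‖mFourier k x‖ = 1 := by
  simp only [mFourier, ContinuousMap.coe_mk, norm_prod, fourier_apply, Circle.norm_coe,
    Finset.prod_const_one]

/-- The coefficients of a continuous function are bounded by its sup norm. -/
lemma norm_coeff_le {f : Torus → ℝ} {M : ℝ} (hM : ∀ x, |f x| ≤ M) (k : Fin 2 → ℤ) :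
    ‖coeff f k‖ ≤ M := by
  rw [coeff_eq_integral]
  refine (norm_integral_le_of_norm_le_const (C := M) (.of_forall fun x => ?_)).trans (by simp)
  rw [norm_mul, norm_mFourier_apply, one_mul, Complex.norm_real]
  exact hM x

/-- A continuous function with summable coefficients is the sum of its Fourier series. -/
lemma hasSum_coeff {f : Torus → ℝ} (hf : Continuous f) (hs : Summable fun k => ‖coeff f k‖)
    (x : Torus) : HasSum (fun k => coeff f k * mFourier k x) (f x : ℂ) := by
  have := hasSum_mFourier_series_apply_of_summable
    (f := ⟨fun x => (f x : ℂ), Complex.continuous_ofReal.comp hf⟩) (Summable.of_norm hs) x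
  simp only [smul_eq_mul] at this
  exact this

/-- Continuous functions with the same Fourier coefficients agree. -/
lemma eq_of_coeff_eq {f g : Torus → ℝ} (hf : Continuous f) (hg : Continuous g)
    (h : ∀ k, coeff f k = coeff g k) : f = g := by
  have h0 : ∀ k, coeff (f - g) k = 0 := fun k => by rw [coeff_sub hf hg, h, sub_self]
  ext x
  have h1 := hasSum_coeff (f := f - g) (hf.sub hg) (by simp [h0, summable_zero]) x
  have h2 := h1.unique (a₂ := 0) (by simp only [h0, zero_mul]; exact hasSum_zero)
  have h3 : (f - g) x = 0 := by exact_mod_cast h2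
  simpa [sub_eq_zero] using h3

/-- The real function with prescribed Fourier coefficients. -/
noncomputable def synth (c : (Fin 2 → ℤ) → ℂ) (x : Torus) : ℝ :=
  (∑' k, c k * mFourier k x).re

lemma norm_mul_mFourier (c : (Fin 2 → ℤ) → ℂ) (k : Fin 2 → ℤ) (x : Torus) :
    ‖c k * mFourier k x‖ = ‖c k‖ := by
  rw [norm_mul, norm_mFourier_apply, mul_one]

lemma summable_mul_mFourier {c : (Fin 2 → ℤ) → ℂ} (hc : Summable fun k => ‖c k‖) (x : Torus) :
    Summable fun k => c k * mFourier k x :=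
  Summable.of_norm (by simpa only [norm_mul_mFourier] using hc)

lemma ofReal_synth {c : (Fin 2 → ℤ) → ℂ} (hsymm : ∀ k, c (-k) = conj (c k)) (x : Torus) :
    (synth c x : ℂ) = ∑' k, c k * mFourier k x := by
  rw [synth, ← Complex.conj_eq_iff_re]
  rw [Complex.conj_tsum, ← (Equiv.neg (Fin 2 → ℤ)).tsum_eq]
  refine tsum_congr fun k => ?_
  simp only [Equiv.neg_apply, map_mul, hsymm, Complex.conj_conj, ← mFourier_neg, neg_neg]

lemma hasSum_synth {c : (Fin 2 → ℤ) → ℂ} (hc : Summable fun k => ‖c k‖)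
    (hsymm : ∀ k, c (-k) = conj (c k)) (x : Torus) :
    HasSum (fun k => c k * mFourier k x) (synth c x : ℂ) := by
  rw [ofReal_synth hsymm]
  exact (summable_mul_mFourier hc x).hasSum

lemma continuous_synth {c : (Fin 2 → ℤ) → ℂ} (hc : Summable fun k => ‖c k‖) :
    Continuous (synth c) := by
  unfold synth
  refine Complex.continuous_re.comp (continuous_tsum (fun k => by fun_prop) hc fun k x => ?_)
  rw [norm_mul_mFourier]

lemma integral_mFourier_mul (k l : Fin 2 → ℤ) :
    ∫ x, mFourier (-k) x * mFourier l x ∂torusMeasure = if l = k then 1 else 0 := by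
  have h := orthonormal_iff_ite.1 (orthonormal_mFourier (d := Fin 2)) k l
  simp only [ContinuousMap.inner_toLp, ← mFourier_neg] at h
  rw [show (if l = k then (1 : ℂ) else 0) = if k = l then 1 else 0 by simp [eq_comm], ← h]
  refine integral_congr_ae (.of_forall fun x => ?_)
  exact mul_comm _ _

/-- `synth c` has the coefficients `c`. -/
lemma coeff_synth {c : (Fin 2 → ℤ) → ℂ} (hc : Summable fun k => ‖c k‖)
    (hsymm : ∀ k, c (-k) = conj (c k)) (k : Fin 2 → ℤ) : coeff (synth c) k = c k := by
  rw [coeff_eq_integral]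
  have h1 : ∀ x, mFourier (-k) x * (synth c x : ℂ) =
      ∑' l, c l * (mFourier (-k) x * mFourier l x) := fun x => by
    rw [ofReal_synth hsymm, ← tsum_mul_left]
    exact tsum_congr fun l => by ring
  simp only [h1]
  have hn : ∀ l x, ‖c l * (mFourier (-k) x * mFourier l x)‖ = ‖c l‖ := fun l x => by
    rw [norm_mul, norm_mul, norm_mFourier_apply, norm_mFourier_apply, mul_one, mul_one]
  rw [← (hasSum_integral_of_summable_integral_norm (μ := torusMeasure)
    (F := fun l x => c l * (mFourier (-k) x * mFourier l x))
    (fun l => integrable_of_continuous (by fun_prop)) (by simp only [hn]; simpa using hc)).tsum_eq]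
  simp only [integral_const_mul, integral_mFourier_mul]
  rw [tsum_eq_single k (by intro l hl; simp [hl])]
  simp

/-! ### Continuously differentiable functions -/

/-- The function `f` is continuous with continuous partial derivatives. -/
structure IsC1 (f : Torus → ℝ) : Prop where
  cont : Continuous f
  cont_pderiv : ∀ i, Continuous (pderiv i f)
  hasDerivAt : ∀ i x, HasDerivAt (fun h : ℝ => f (x + axis i h))
    (pderiv i f x) 0

lemma isC1_of_hasDerivAt {f : Torus → ℝ} (hf : Continuous f) {g : Fin 2 → Torus → ℝ}
    (hg : ∀ i, Continuous (g i)) (h : ∀ i x, HasDerivAt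
      (fun h : ℝ => f (x + axis i h)) (g i x) 0) :
    IsC1 f ∧ ∀ i, pderiv i f = g i := by
  have : ∀ i, pderiv i f = g i := fun i => funext fun x => (h i x).deriv
  exact ⟨⟨hf, fun i => this i ▸ hg i, fun i x => this i ▸ h i x⟩, this⟩

lemma IsC1.mul {f g : Torus → ℝ} (hf : IsC1 f) (hg : IsC1 g) :
    IsC1 (f * g) ∧ ∀ i, pderiv i (f * g) = pderiv i f * g + f * pderiv i g := by
  refine isC1_of_hasDerivAt (hf.cont.mul hg.cont) (fun i =>
    ((hf.cont_pderiv i).mul hg.cont).add (hf.cont.mul (hg.cont_pderiv i))) fun i x => ?_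
  have h0 : x + axis i 0 = x := by simp [axis]
  have := (hf.hasDerivAt i x).mul (hg.hasDerivAt i x)
  rw [h0] at this
  exact this

lemma IsC1.add {f g : Torus → ℝ} (hf : IsC1 f) (hg : IsC1 g) :
    IsC1 (f + g) ∧ ∀ i, pderiv i (f + g) = pderiv i f + pderiv i g :=
  isC1_of_hasDerivAt (hf.cont.add hg.cont) (fun i => (hf.cont_pderiv i).add (hg.cont_pderiv i))
    fun i x => (hf.hasDerivAt i x).add (hg.hasDerivAt i x)

lemma IsC1.sub {f g : Torus → ℝ} (hf : IsC1 f) (hg : IsC1 g) :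
    IsC1 (f - g) ∧ ∀ i, pderiv i (f - g) = pderiv i f - pderiv i g :=
  isC1_of_hasDerivAt (hf.cont.sub hg.cont) (fun i => (hf.cont_pderiv i).sub (hg.cont_pderiv i))
    fun i x => (hf.hasDerivAt i x).sub (hg.hasDerivAt i x)

lemma mFourier_add_single (k : Fin 2 → ℤ) (x : Torus) (i : Fin 2) (h : ℝ) :
    mFourier k (x + axis i h) =
      mFourier k x * Complex.exp (2 * Real.pi * Complex.I * k i * h) := by
  have h1 : ∀ j, fourier (k j) ((x + axis i h) j) =
      fourier (k j) (x j) * (if j = i then Complex.exp (2 * Real.pi * Complex.I * k i * h) else 1) := by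
    intro j
    rw [Pi.add_apply]
    by_cases hj : j = i
    · subst hj
      simp only [Pi.single_eq_same, if_true]
      rw [fourier_apply, smul_add, AddCircle.toCircle_add, Circle.coe_mul, ← fourier_apply,
        ← fourier_apply, fourier_coe_apply]
      simp
    · simp [hj]
  simp only [mFourier, ContinuousMap.coe_mk, h1, Finset.prod_mul_distrib]
  simp

/-- Differentiation multiplies the `k`-th coefficient by `2πi kᵢ`. The coefficients of a translate
`f(· + h eᵢ)` are `exp(2πi kᵢ h) f̂(k)`, and this is differentiated at `h = 0`. -/
lemma IsC1.coeff_pderiv {f : Torus → ℝ} (hf : IsC1 f) (i : Fin 2) (k : Fin 2 → ℤ) :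
    coeff (pderiv i f) k = 2 * Real.pi * Complex.I * k i * coeff f k := by
  obtain ⟨M, hM⟩ : ∃ M, ∀ x, ‖pderiv i f x‖ ≤ M := by
    obtain ⟨M, hM⟩ := isCompact_univ.exists_bound_of_continuousOn (hf.cont_pderiv i).continuousOn
    exact ⟨M, fun x => hM x (mem_univ x)⟩
  have hd : ∀ x (h : ℝ), HasDerivAt (fun h : ℝ => f (x + axis i h))
      (pderiv i f (x + axis i h)) h := by
    intro x h
    have := (hf.hasDerivAt i (x + axis i h))
    rw [← sub_self h] at this
    have h2 := this.comp_sub_const h h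
    refine h2.congr_of_eventuallyEq (.of_forall fun y => ?_)
    simp only [add_assoc, ← Pi.single_add, ← AddCircle.coe_add]
    rw [add_sub_cancel]
  have h1 := (hasDerivAt_integral_of_dominated_loc_of_deriv_le (μ := torusMeasure) (𝕜 := ℝ)
    (F := fun h x => mFourier (-k) x * (f (x + axis i h) : ℂ))
    (F' := fun h x => mFourier (-k) x * (pderiv i f (x + axis i h) : ℂ))
    (x₀ := 0) (s := univ) (bound := fun _ => M) univ_mem
    (.of_forall fun h => (integrable_of_continuous
      (by have := hf.cont; fun_prop)).aestronglyMeasurable)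
    (integrable_of_continuous (by have := hf.cont; fun_prop))
    ((integrable_of_continuous (by have := hf.cont_pderiv i; fun_prop)).aestronglyMeasurable)
    (.of_forall fun x h _ => by
      rw [norm_mul, norm_mFourier_apply, one_mul, Complex.norm_real]; exact hM _)
    (integrable_const _)
    (.of_forall fun x h _ => ((hd x h).ofReal_comp).const_mul _)).2
  have h2 : ∀ h : ℝ, ∫ x, mFourier (-k) x * (f (x + axis i h) : ℂ)
      ∂torusMeasure = Complex.exp (2 * Real.pi * Complex.I * k i * h) * coeff f k := by
    intro h
    have := integral_add_right_eq_self (μ := torusMeasure)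
      (fun x => mFourier (-k) (x - axis i h) * (f x : ℂ))
      (axis i h)
    simp only [add_sub_cancel_right] at this
    rw [this, coeff_eq_integral, ← integral_const_mul]
    congr 1; ext x
    have h3 := mFourier_add_single (-k) x i (-h)
    rw [show x - axis i h = x + axis i (-h) by
      rw [sub_eq_add_neg, ← Pi.single_neg]; simp, h3]
    simp only [Pi.neg_apply, Int.cast_neg, Complex.ofReal_neg, mul_neg, neg_mul, neg_neg]
    ring
  simp only [h2] at h1
  have h4 : HasDerivAt (fun h : ℝ => Complex.exp (2 * Real.pi * Complex.I * k i * h) * coeff f k)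
      (2 * Real.pi * Complex.I * k i * coeff f k) 0 := by
    have h5 : HasDerivAt (fun h : ℝ => (2 * Real.pi * Complex.I * k i * h : ℂ))
        (2 * Real.pi * Complex.I * k i) 0 := by
      simpa using (Complex.ofRealCLM.hasDerivAt (x := (0 : ℝ))).const_mul
        (2 * Real.pi * Complex.I * k i : ℂ)
    have := (h5.cexp).mul_const (coeff f k)
    simpa using this
  have h6 := h1.unique h4
  rw [← h6, coeff_eq_integral]
  simp [axis]

/-- The space of continuous functions whose coefficients are summable against `(1 + |k|²)^s`. -/
def Wiener (s : ℝ) (f : Torus → ℝ) : Prop :=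
  Continuous f ∧ Summable fun k => (1 + freqSq k) ^ s * ‖coeff f k‖

lemma freqSq_nonneg (k : Fin 2 → ℤ) : 0 ≤ freqSq k := by unfold freqSq; positivity

lemma one_le_wt (k : Fin 2 → ℤ) : 1 ≤ 1 + freqSq k := by linarith [freqSq_nonneg k]

lemma wt_pos (k : Fin 2 → ℤ) : 0 < 1 + freqSq k := by linarith [freqSq_nonneg k]

lemma wt_rpow_pos (k : Fin 2 → ℤ) (s : ℝ) : 0 < (1 + freqSq k) ^ s :=
  Real.rpow_pos_of_pos (wt_pos k) s

lemma freqSq_neg (k : Fin 2 → ℤ) : freqSq (-k) = freqSq k := by simp [freqSq]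

lemma abs_freq_le (k : Fin 2 → ℤ) (i : Fin 2) : |(k i : ℝ)| ≤ (1 + freqSq k) ^ (1 / 2 : ℝ) := by
  rw [← Real.sqrt_eq_rpow]
  refine Real.abs_le_sqrt ?_
  unfold freqSq
  fin_cases i
  · simp; nlinarith [sq_nonneg (k 1 : ℝ)]
  · simp; nlinarith [sq_nonneg (k 0 : ℝ)]

lemma Wiener.mono {s s' : ℝ} (h : s ≤ s') {f : Torus → ℝ} (hf : Wiener s' f) : Wiener s f :=
  ⟨hf.1, hf.2.of_nonneg_of_le (fun k => mul_nonneg (wt_rpow_pos k s).le (norm_nonneg _)) fun k =>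
    mul_le_mul_of_nonneg_right (Real.rpow_le_rpow_of_exponent_le (one_le_wt k) h) (norm_nonneg _)⟩

lemma Wiener.summable {s : ℝ} (hs : 0 ≤ s) {f : Torus → ℝ} (hf : Wiener s f) :
    Summable fun k => ‖coeff f k‖ := by
  simpa using (hf.mono hs).2

lemma Wiener.summable_pderiv {f : Torus → ℝ} (hf : Wiener (1 / 2) f) (i : Fin 2) :
    Summable fun k => ‖2 * Real.pi * Complex.I * k i * coeff f k‖ := by
  refine (hf.2.mul_left (2 * Real.pi)).of_nonneg_of_le (fun _ => norm_nonneg _) fun k => ?_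
  have := abs_freq_le k i
  simp only [norm_mul, Complex.norm_I, Complex.norm_real, Complex.norm_ofNat, Complex.norm_intCast,
    mul_one, Real.norm_eq_abs, abs_of_pos Real.pi_pos]
  rw [mul_assoc]
  gcongr

lemma Wiener.isC1 {f : Torus → ℝ} (hf : Wiener (1 / 2) f) : IsC1 f := by
  refine (isC1_of_hasDerivAt hf.1
    (g := fun i => synth fun k => 2 * Real.pi * Complex.I * k i * coeff f k)
    (fun i => continuous_synth (hf.summable_pderiv i)) fun i x => ?_).1
  have hs := hf.summable (by norm_num)
  have key := hasDerivAt_tsum (𝕜 := ℝ) (u := fun k => ‖2 * Real.pi * Complex.I * k i * coeff f k‖)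
    (g := fun k (h : ℝ) => coeff f k * mFourier k (x + axis i h))
    (g' := fun k (h : ℝ) => 2 * Real.pi * Complex.I * k i * coeff f k *
      mFourier k (x + axis i h)) (y₀ := 0) (hf.summable_pderiv i) ?_ ?_
    (summable_mul_mFourier hs _) 0
  · have h1 : ∀ h : ℝ, f (x + axis i h) =
        (∑' k, coeff f k * mFourier k (x + axis i h)).re := fun h => by
      rw [(hasSum_coeff hf.1 hs _).tsum_eq, Complex.ofReal_re]
    simp only [h1, synth]
    have := Complex.reCLM.hasFDerivAt.comp_hasDerivAt (0 : ℝ) key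
    have h0 : x + axis i 0 = x := by simp [axis]
    rw [h0] at this
    exact this
  · intro k h
    simp only [mFourier_add_single]
    have h5 : HasDerivAt (fun h : ℝ => (2 * Real.pi * Complex.I * k i * h : ℂ))
        (2 * Real.pi * Complex.I * k i) h := by
      simpa using (Complex.ofRealCLM.hasDerivAt (x := h)).const_mul
        (2 * Real.pi * Complex.I * k i : ℂ)
    refine (((h5.cexp).const_mul (mFourier k x)).const_mul (coeff f k)).congr_deriv ?_
    ring
  · intro k h
    rw [norm_mul, norm_mFourier_apply, mul_one]

/-! ### Smooth functions -/

/-- The covering map `ℝ² → 𝕋²`. -/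
abbrev cover (y : Fin 2 → ℝ) : Torus := fun i => (y i : UnitAddCircle)

lemma cover_add_single (y : Fin 2 → ℝ) (i : Fin 2) (h : ℝ) :
    cover y + axis i h = cover (y + h • Pi.single i 1) := by
  ext j
  by_cases hj : j = i
  · subst hj; simp [cover]
  · simp [cover, hj]

lemma isOpenQuotientMap_cover : IsOpenQuotientMap cover :=
  IsOpenQuotientMap.piMap (f := fun _ : Fin 2 => ((↑) : ℝ → UnitAddCircle)) fun _ =>
    QuotientAddGroup.isOpenQuotientMap_mk

lemma Smooth.continuous {f : Torus → ℝ} (hf : Smooth f) : Continuous f :=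
  isOpenQuotientMap_cover.isQuotientMap.continuous_iff.2 (ContDiff.continuous hf)

lemma Smooth.pderiv_cover {f : Torus → ℝ} (hf : Smooth f) (i : Fin 2) (y : Fin 2 → ℝ) :
    HasDerivAt (fun h : ℝ => f (cover y + axis i h))
      (fderiv ℝ (fun y => f (cover y)) y (Pi.single i 1)) 0 := by
  have h1 : HasFDerivAt (fun y => f (cover y)) (fderiv ℝ (fun y => f (cover y)) y)
      (y + (0 : ℝ) • Pi.single i 1) := by
    rw [zero_smul, add_zero]
    exact ((ContDiff.differentiable hf (by simp)) y).hasFDerivAt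
  have h2 : HasDerivAt (fun h : ℝ => y + h • (Pi.single i 1 : Fin 2 → ℝ)) (Pi.single i 1) 0 := by
    simpa using ((hasDerivAt_id (0 : ℝ)).smul_const (Pi.single i 1 : Fin 2 → ℝ)).const_add y
  simp only [cover_add_single]
  exact h1.comp_hasDerivAt (0 : ℝ) h2

lemma Smooth.pderiv {f : Torus → ℝ} (hf : Smooth f) (i : Fin 2) : Smooth (pderiv i f) := by
  have h : (fun y : Fin 2 → ℝ => Vorticity.pderiv i f (cover y)) =
      fun y => fderiv ℝ (fun y => f (cover y)) y (Pi.single i 1) :=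
    funext fun y => (hf.pderiv_cover i y).deriv
  unfold Smooth
  change ContDiff ℝ (⊤ : ℕ∞) (fun y : Fin 2 → ℝ => Vorticity.pderiv i f (cover y))
  rw [h]
  exact (ContDiff.fderiv_right hf (m := (⊤ : ℕ∞)) (by simp)).clm_apply contDiff_const

lemma Smooth.isC1 {f : Torus → ℝ} (hf : Smooth f) : IsC1 f := by
  refine ⟨hf.continuous, fun i => (hf.pderiv i).continuous, fun i x => ?_⟩
  obtain ⟨y, rfl⟩ := isOpenQuotientMap_cover.surjective x
  have := hf.pderiv_cover i y
  rwa [← this.deriv] at this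

lemma Smooth.add {f g : Torus → ℝ} (hf : Smooth f) (hg : Smooth g) : Smooth (f + g) :=
  ContDiff.add hf hg

lemma Smooth.sub {f g : Torus → ℝ} (hf : Smooth f) (hg : Smooth g) : Smooth (f - g) :=
  ContDiff.sub hf hg

lemma Smooth.smul {f : Torus → ℝ} (c : ℝ) (hf : Smooth f) : Smooth (c • f) :=
  ContDiff.const_smul c hf

lemma laplacian_eq (f : Torus → ℝ) :
    laplacian f = pderiv 0 (pderiv 0 f) + pderiv 1 (pderiv 1 f) := by
  ext x; simp [laplacian, Fin.sum_univ_two]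

lemma Smooth.laplacian {f : Torus → ℝ} (hf : Smooth f) : Smooth (laplacian f) := by
  rw [laplacian_eq]
  exact ((hf.pderiv 0).pderiv 0).add ((hf.pderiv 1).pderiv 1)

lemma Smooth.coeff_laplacian {f : Torus → ℝ} (hf : Smooth f) (k : Fin 2 → ℤ) :
    coeff (Vorticity.laplacian f) k = -(4 * Real.pi ^ 2 * freqSq k : ℝ) * coeff f k := by
  rw [laplacian_eq, coeff_add ((hf.pderiv 0).pderiv 0).continuous
    ((hf.pderiv 1).pderiv 1).continuous]
  simp only [(hf.pderiv _).isC1.coeff_pderiv, hf.isC1.coeff_pderiv, freqSq]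
  push_cast
  linear_combination (4 * Real.pi ^ 2 * ((k 0 : ℂ) ^ 2 + (k 1 : ℂ) ^ 2) * coeff f k) * Complex.I_sq

/-- The coefficients of a smooth function decay faster than any power of the frequency. -/
lemma Smooth.decay (m : ℕ) : ∀ {f : Torus → ℝ}, Smooth f →
    ∃ C, ∀ k, (1 + freqSq k) ^ m * ‖coeff f k‖ ≤ C := by
  induction m with
  | zero =>
    intro f hf
    obtain ⟨M, hM⟩ := isCompact_univ.exists_bound_of_continuousOn hf.continuous.continuousOn
    exact ⟨M, fun k => by simpa using norm_coeff_le (fun x => hM x (mem_univ x)) k⟩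
  | succ m ih =>
    intro f hf
    obtain ⟨C, hC⟩ := ih (hf.sub (hf.laplacian.smul (1 / (4 * Real.pi ^ 2))))
    refine ⟨C, fun k => le_trans (le_of_eq ?_) (hC k)⟩
    rw [coeff_sub hf.continuous (hf.laplacian.continuous.const_smul _), coeff_smul,
      hf.coeff_laplacian, show coeff f k - ((1 / (4 * Real.pi ^ 2) : ℝ) : ℂ) *
        (-(4 * Real.pi ^ 2 * freqSq k : ℝ) * coeff f k) = ((1 + freqSq k : ℝ) : ℂ) * coeff f k by
        have : (Real.pi : ℂ) ≠ 0 := by exact_mod_cast Real.pi_ne_zero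
        push_cast; field_simp; ring, norm_mul, Complex.norm_real, Real.norm_eq_abs,
      abs_of_pos (wt_pos k)]
    ring

lemma summable_wt_rpow {q : ℝ} (hq : 1 < q) :
    Summable fun k : Fin 2 → ℤ => (1 + freqSq k) ^ (-q) := by
  refine Summable.of_norm_bounded_eventually
    (EisensteinSeries.summable_one_div_norm_rpow (k := 2 * q) (by linarith)) ?_
  filter_upwards [(Set.finite_singleton (0 : Fin 2 → ℤ)).compl_mem_cofinite] with k hk
  have hk0 : 0 < ‖k‖ := norm_pos_iff.2 hk
  rw [Real.norm_eq_abs, abs_of_pos (wt_rpow_pos k _), show -(2 * q) = 2 * -q by ring,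
    Real.rpow_mul hk0.le]
  refine Real.rpow_le_rpow_of_nonpos (by positivity) ?_ (by linarith)
  rw [Real.rpow_two]
  have h : ‖k‖ ≤ √(freqSq k) := by
    refine (pi_norm_le_iff_of_nonneg (Real.sqrt_nonneg _)).2 fun i => ?_
    rw [Int.norm_eq_abs]
    refine Real.abs_le_sqrt ?_
    unfold freqSq
    fin_cases i
    · simp; positivity
    · simp; positivity
  have := Real.sq_sqrt (freqSq_nonneg k)
  nlinarith [norm_nonneg k]

lemma Smooth.wiener {f : Torus → ℝ} (hf : Smooth f) (s : ℝ) : Wiener s f := by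
  refine ⟨hf.continuous, ?_⟩
  obtain ⟨m, hm⟩ := exists_nat_gt (s + 2)
  obtain ⟨C, hC⟩ := hf.decay m
  refine ((summable_wt_rpow one_lt_two).mul_left C).of_nonneg_of_le
    (fun k => mul_nonneg (wt_rpow_pos k s).le (norm_nonneg _)) fun k => ?_
  have h1 : (1 + freqSq k) ^ s ≤ (1 + freqSq k) ^ (-2 : ℝ) * (1 + freqSq k) ^ m := by
    rw [← Real.rpow_natCast, ← Real.rpow_add (wt_pos k)]
    exact Real.rpow_le_rpow_of_exponent_le (one_le_wt k) (by linarith)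
  calc (1 + freqSq k) ^ s * ‖coeff f k‖
      ≤ ((1 + freqSq k) ^ (-2 : ℝ) * (1 + freqSq k) ^ m) * ‖coeff f k‖ := by gcongr
    _ = (1 + freqSq k) ^ (-2 : ℝ) * ((1 + freqSq k) ^ m * ‖coeff f k‖) := by ring
    _ ≤ (1 + freqSq k) ^ (-2 : ℝ) * C :=
        mul_le_mul_of_nonneg_left (hC k) (wt_rpow_pos k _).le
    _ = C * (1 + freqSq k) ^ (-2 : ℝ) := mul_comm _ _

/-! ### Products, and weighted sequence norms -/

lemma coeff_mul {f g : Torus → ℝ} (hf : Wiener 0 f) (hg : Continuous g) (k : Fin 2 → ℤ) :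
    coeff (f * g) k = ∑' l, coeff f l * coeff g (k - l) := by
  have hs := hf.summable le_rfl
  have h1 : ∀ x, mFourier (-k) x * ((f * g) x : ℂ) =
      ∑' l, coeff f l * (mFourier (-(k - l)) x * (g x : ℂ)) := fun x => by
    rw [Pi.mul_apply, Complex.ofReal_mul, ← (hasSum_coeff hf.1 hs x).tsum_eq, ← tsum_mul_right,
      ← tsum_mul_left]
    refine tsum_congr fun l => ?_
    rw [neg_sub, sub_eq_add_neg, mFourier_add]
    ring
  obtain ⟨M, hM⟩ := isCompact_univ.exists_bound_of_continuousOn hg.continuousOn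
  rw [coeff_eq_integral]
  simp only [h1]
  rw [← (hasSum_integral_of_summable_integral_norm (μ := torusMeasure)
    (F := fun l x => coeff f l * (mFourier (-(k - l)) x * (g x : ℂ)))
    (fun l => integrable_of_continuous (by fun_prop)) ?_).tsum_eq]
  · simp only [integral_const_mul]
    rfl
  · have hn : ∀ l x, ‖coeff f l * (mFourier (-(k - l)) x * (g x : ℂ))‖ = ‖coeff f l‖ * ‖g x‖ :=
      fun l x => by rw [norm_mul, norm_mul, norm_mFourier_apply, one_mul, Complex.norm_real]
    simp only [hn, integral_const_mul]
    exact hs.mul_right _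

/-- The squared norm of a sequence of coefficients with weight `(1 + |k|²)^s`. -/
noncomputable def sobSq (s : ℝ) (c : (Fin 2 → ℤ) → ℂ) : ℝ≥0∞ :=
  ∑' k, ENNReal.ofReal ((1 + freqSq k) ^ s) * ‖c k‖ₑ ^ 2

/-- The sum of the moduli of a sequence of coefficients with weight `(1 + |k|²)^s`. -/
noncomputable def wienerNorm (s : ℝ) (c : (Fin 2 → ℤ) → ℂ) : ℝ≥0∞ :=
  ∑' k, ENNReal.ofReal ((1 + freqSq k) ^ s) * ‖c k‖ₑ

lemma sobolevNorm_eq (s : ℝ) (f : Torus → ℝ) :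
    sobolevNorm s f = sobSq s (coeff f) ^ (1 / 2 : ℝ) := rfl

lemma sobSq_eq (s : ℝ) (f : Torus → ℝ) : sobSq s (coeff f) = sobolevNorm s f ^ 2 := by
  rw [sobolevNorm_eq, ← ENNReal.rpow_natCast, ← ENNReal.rpow_mul]
  norm_num

lemma wienerNorm_lt_top_iff {s : ℝ} {c : (Fin 2 → ℤ) → ℂ} :
    wienerNorm s c < ⊤ ↔ Summable fun k => (1 + freqSq k) ^ s * ‖c k‖ := by
  have h : ∀ k, ENNReal.ofReal ((1 + freqSq k) ^ s) * ‖c k‖ₑ =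
      ENNReal.ofReal ((1 + freqSq k) ^ s * ‖c k‖) := fun k => by
    rw [ENNReal.ofReal_mul (wt_rpow_pos k s).le, ofReal_norm]
  unfold wienerNorm
  simp only [h]
  constructor
  · intro hlt
    have := ENNReal.summable_toReal hlt.ne
    refine this.congr fun k => ?_
    rw [ENNReal.toReal_ofReal (mul_nonneg (wt_rpow_pos k s).le (norm_nonneg _))]
  · intro hs
    rw [← ENNReal.ofReal_tsum_of_nonneg
      (fun k => mul_nonneg (wt_rpow_pos k s).le (norm_nonneg _)) hs]
    exact ENNReal.ofReal_lt_top

lemma wienerNorm_zero (c : (Fin 2 → ℤ) → ℂ) : wienerNorm 0 c = ∑' k, ‖c k‖ₑ := by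
  simp [wienerNorm]

lemma mul_le_sq_add_sq (x y : ℝ≥0∞) : x * y ≤ x ^ 2 + y ^ 2 := by
  rcases le_total x y with h | h
  · exact le_add_left (by rw [sq]; gcongr)
  · exact le_add_right (by rw [sq]; gcongr)

lemma add_sq_le_four (x y : ℝ≥0∞) : (x + y) ^ 2 ≤ 4 * x ^ 2 + 4 * y ^ 2 := by
  rcases le_total x y with h | h
  · refine le_add_left ?_
    calc (x + y) ^ 2 ≤ (y + y) ^ 2 := by gcongr
      _ = 4 * y ^ 2 := by ring
  · refine le_add_right ?_
    calc (x + y) ^ 2 ≤ (x + x) ^ 2 := by gcongr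
      _ = 4 * x ^ 2 := by ring

/-- A form of the Cauchy–Schwarz inequality in which convergence is not an issue. -/
lemma tsum_mul_sq_le {ι : Type*} (a b : ι → ℝ≥0∞) :
    (∑' i, a i * b i) ^ 2 ≤ 2 * (∑' i, a i) * ∑' i, a i * b i ^ 2 := by
  calc (∑' i, a i * b i) ^ 2 = ∑' i, ∑' j, a i * a j * (b i * b j) := by
        rw [sq, ← ENNReal.tsum_mul_right]
        refine tsum_congr fun i => ?_
        rw [← ENNReal.tsum_mul_left]
        exact tsum_congr fun j => by ring
    _ ≤ ∑' i, ∑' j, (a j * (a i * b i ^ 2) + a i * (a j * b j ^ 2)) := by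
        refine ENNReal.tsum_le_tsum fun i => ENNReal.tsum_le_tsum fun j => ?_
        calc a i * a j * (b i * b j) ≤ a i * a j * (b i ^ 2 + b j ^ 2) := by
              gcongr; exact mul_le_sq_add_sq _ _
          _ = _ := by ring
    _ = 2 * (∑' i, a i) * ∑' i, a i * b i ^ 2 := by
        simp only [ENNReal.tsum_add, ENNReal.tsum_mul_left, ENNReal.tsum_mul_right]
        ring

/-- Young's inequality for the convolution of an `ℓ¹` and an `ℓ²` sequence. -/
lemma tsum_conv_sq_le {ι : Type*} [AddCommGroup ι] (a b : ι → ℝ≥0∞) :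
    ∑' k, (∑' l, a l * b (k - l)) ^ 2 ≤ 2 * (∑' l, a l) ^ 2 * ∑' l, b l ^ 2 := by
  calc ∑' k, (∑' l, a l * b (k - l)) ^ 2
      ≤ ∑' k, 2 * (∑' l, a l) * ∑' l, a l * b (k - l) ^ 2 :=
        ENNReal.tsum_le_tsum fun k => tsum_mul_sq_le a fun l => b (k - l)
    _ = 2 * (∑' l, a l) * ∑' l, ∑' k, a l * b (k - l) ^ 2 := by
        rw [ENNReal.tsum_mul_left, ENNReal.tsum_comm]
    _ = 2 * (∑' l, a l) * ∑' l, a l * ∑' k, b k ^ 2 := by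
        congr 1
        refine tsum_congr fun l => ?_
        rw [ENNReal.tsum_mul_left, ← (Equiv.subRight l).tsum_eq (fun k => b k ^ 2)]
        rfl
    _ = 2 * (∑' l, a l) ^ 2 * ∑' l, b l ^ 2 := by rw [ENNReal.tsum_mul_right]; ring

lemma enorm_coeff_mul_le {f g : Torus → ℝ} (hf : Wiener 0 f) (hg : Continuous g)
    (k : Fin 2 → ℤ) : ‖coeff (f * g) k‖ₑ ≤ ∑' l, ‖coeff f l‖ₑ * ‖coeff g (k - l)‖ₑ := by
  rw [coeff_mul hf hg]
  refine (enorm_tsum_le_tsum_enorm).trans (le_of_eq ?_)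
  simp only [enorm_mul]

lemma wienerNorm_mul_le {f g : Torus → ℝ} (hf : Wiener 0 f) (hg : Continuous g) :
    wienerNorm 0 (coeff (f * g)) ≤ wienerNorm 0 (coeff f) * wienerNorm 0 (coeff g) := by
  simp only [wienerNorm_zero]
  calc ∑' k, ‖coeff (f * g) k‖ₑ ≤ ∑' k, ∑' l, ‖coeff f l‖ₑ * ‖coeff g (k - l)‖ₑ :=
        ENNReal.tsum_le_tsum fun k => enorm_coeff_mul_le hf hg k
    _ = ∑' l, ‖coeff f l‖ₑ * ∑' k, ‖coeff g k‖ₑ := by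
        rw [ENNReal.tsum_comm]
        refine tsum_congr fun l => ?_
        rw [ENNReal.tsum_mul_left, ← (Equiv.subRight l).tsum_eq (fun k => ‖coeff g k‖ₑ)]
        rfl
    _ = _ := ENNReal.tsum_mul_right

lemma wt_le_two_mul (k l : Fin 2 → ℤ) :
    1 + freqSq (k + l) ≤ 2 * (1 + freqSq k) * (1 + freqSq l) := by
  simp only [freqSq, Pi.add_apply, Int.cast_add]
  nlinarith [sq_nonneg ((k 0 : ℝ) - l 0), sq_nonneg ((k 1 : ℝ) - l 1),
    mul_nonneg (freqSq_nonneg k) (freqSq_nonneg l), sq_nonneg (k 0 : ℝ), sq_nonneg (k 1 : ℝ),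
    sq_nonneg (l 0 : ℝ), sq_nonneg (l 1 : ℝ), mul_nonneg (sq_nonneg (k 0 : ℝ)) (sq_nonneg (l 0 : ℝ)),
    mul_nonneg (sq_nonneg (k 0 : ℝ)) (sq_nonneg (l 1 : ℝ)),
    mul_nonneg (sq_nonneg (k 1 : ℝ)) (sq_nonneg (l 0 : ℝ)),
    mul_nonneg (sq_nonneg (k 1 : ℝ)) (sq_nonneg (l 1 : ℝ))]

/-- **Peetre's inequality**. -/
lemma wt_rpow_le (s : ℝ) (k l : Fin 2 → ℤ) : (1 + freqSq k) ^ s ≤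
    2 ^ |s| * (1 + freqSq l) ^ |s| * (1 + freqSq (k - l)) ^ s := by
  rcases le_total 0 s with hs | hs
  · rw [abs_of_nonneg hs, ← Real.mul_rpow (by norm_num) (wt_pos l).le,
      ← Real.mul_rpow (by have := wt_pos l; positivity) (wt_pos _).le]
    refine Real.rpow_le_rpow (wt_pos k).le ?_ hs
    simpa using wt_le_two_mul l (k - l)
  · rw [abs_of_nonpos hs, ← Real.mul_rpow (by norm_num) (wt_pos l).le]
    have h := wt_le_two_mul k (-l)
    rw [freqSq_neg, ← sub_eq_add_neg] at h
    have hl := wt_pos l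
    have hk := wt_pos k
    have hkl := wt_pos (k - l)
    have h2 : (1 + freqSq (k - l)) ^ (-s) ≤ (2 * (1 + freqSq l)) ^ (-s) * (1 + freqSq k) ^ (-s) := by
      rw [← Real.mul_rpow (by positivity) hk.le]
      exact Real.rpow_le_rpow hkl.le (by linarith) (by linarith)
    rw [Real.rpow_neg hkl.le, Real.rpow_neg hk.le] at h2
    have a1 := wt_rpow_pos k s
    have a2 := wt_rpow_pos (k - l) s
    rw [← div_eq_mul_inv, le_div_iff₀ a1, inv_mul_le_iff₀ a2] at h2
    linarith

/-- Multiplication by a function with sufficiently decaying coefficients is bounded on every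
Sobolev space, of positive or negative order. -/
lemma sobSq_mul_le (s : ℝ) {f g : Torus → ℝ} (hf : Wiener 0 f) (hg : Continuous g) :
    sobSq s (coeff (f * g)) ≤
      ENNReal.ofReal (2 ^ |s / 2|) ^ 2 * (2 * wienerNorm |s / 2| (coeff f) ^ 2) *
        sobSq s (coeff g) := by
  have hsq : ∀ k : Fin 2 → ℤ, ENNReal.ofReal ((1 + freqSq k) ^ s) =
      ENNReal.ofReal ((1 + freqSq k) ^ (s / 2)) ^ 2 := fun k => by
    rw [← ENNReal.ofReal_pow (wt_rpow_pos k _).le, ← Real.rpow_natCast, ← Real.rpow_mul (wt_pos k).le]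
    norm_num
  have key : ∀ k, ENNReal.ofReal ((1 + freqSq k) ^ (s / 2)) * ‖coeff (f * g) k‖ₑ ≤
      ENNReal.ofReal (2 ^ |s / 2|) * ∑' l, (ENNReal.ofReal ((1 + freqSq l) ^ |s / 2|) *
        ‖coeff f l‖ₑ) * (ENNReal.ofReal ((1 + freqSq (k - l)) ^ (s / 2)) * ‖coeff g (k - l)‖ₑ) := by
    intro k
    calc _ ≤ ENNReal.ofReal ((1 + freqSq k) ^ (s / 2)) * ∑' l, ‖coeff f l‖ₑ * ‖coeff g (k - l)‖ₑ := by
          gcongr; exact enorm_coeff_mul_le hf hg k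
      _ ≤ _ := by
          rw [← ENNReal.tsum_mul_left, ← ENNReal.tsum_mul_left]
          refine ENNReal.tsum_le_tsum fun l => ?_
          have h2 : (0 : ℝ) ≤ 2 ^ |s / 2| := by positivity
          have := ENNReal.ofReal_le_ofReal (wt_rpow_le (s / 2) k l)
          rw [ENNReal.ofReal_mul (mul_nonneg h2 (wt_rpow_pos l _).le), ENNReal.ofReal_mul h2] at this
          calc _ ≤ (ENNReal.ofReal (2 ^ |s / 2|) * ENNReal.ofReal ((1 + freqSq l) ^ |s / 2|) *
                ENNReal.ofReal ((1 + freqSq (k - l)) ^ (s / 2))) *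
                  (‖coeff f l‖ₑ * ‖coeff g (k - l)‖ₑ) := by gcongr
            _ = _ := by ring
  unfold sobSq
  simp only [hsq, ← mul_pow]
  calc _ ≤ ∑' k, (ENNReal.ofReal (2 ^ |s / 2|) * ∑' l, (ENNReal.ofReal ((1 + freqSq l) ^ |s / 2|) *
        ‖coeff f l‖ₑ) * (ENNReal.ofReal ((1 + freqSq (k - l)) ^ (s / 2)) *
          ‖coeff g (k - l)‖ₑ)) ^ 2 := by
        exact ENNReal.tsum_le_tsum fun k => pow_le_pow_left₀ zero_le (key k) 2
    _ ≤ ENNReal.ofReal (2 ^ |s / 2|) ^ 2 * (2 * wienerNorm |s / 2| (coeff f) ^ 2 *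
        ∑' k, (ENNReal.ofReal ((1 + freqSq k) ^ (s / 2)) * ‖coeff g k‖ₑ) ^ 2) := by
        simp only [mul_pow _ (tsum _), ENNReal.tsum_mul_left]
        gcongr
        exact tsum_conv_sq_le (fun l => ENNReal.ofReal ((1 + freqSq l) ^ |s / 2|) * ‖coeff f l‖ₑ)
          (fun k => ENNReal.ofReal ((1 + freqSq k) ^ (s / 2)) * ‖coeff g k‖ₑ)
    _ = _ := by rw [← mul_assoc]

lemma sobSq_pderiv_le (s : ℝ) {f : Torus → ℝ} (hf : IsC1 f) (i : Fin 2) :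
    sobSq (s - 1) (coeff (pderiv i f)) ≤ ENNReal.ofReal ((2 * Real.pi) ^ 2) * sobSq s (coeff f) := by
  unfold sobSq
  rw [← ENNReal.tsum_mul_left]
  refine ENNReal.tsum_le_tsum fun k => ?_
  rw [hf.coeff_pderiv, ← ofReal_norm, ← ofReal_norm, ← ENNReal.ofReal_pow (norm_nonneg _),
    ← ENNReal.ofReal_pow (norm_nonneg _), ← ENNReal.ofReal_mul (wt_rpow_pos k _).le,
    ← ENNReal.ofReal_mul (wt_rpow_pos k _).le, ← ENNReal.ofReal_mul (by positivity)]
  refine ENNReal.ofReal_le_ofReal ?_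
  simp only [norm_mul, Complex.norm_I, Complex.norm_real, Complex.norm_ofNat, Complex.norm_intCast,
    mul_one, Real.norm_eq_abs, abs_of_pos Real.pi_pos]
  rw [Real.rpow_sub_one (wt_pos k).ne']
  have h1 : |(k i : ℝ)| ^ 2 ≤ 1 + freqSq k := by
    have := pow_le_pow_left₀ (abs_nonneg _) (abs_freq_le k i) 2
    rwa [← Real.sqrt_eq_rpow, Real.sq_sqrt (wt_pos k).le] at this
  have h2 := wt_pos k
  have h3 := wt_rpow_pos k s
  calc (1 + freqSq k) ^ s / (1 + freqSq k) * (2 * Real.pi * |(k i : ℝ)| * ‖coeff f k‖) ^ 2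
      = (1 + freqSq k) ^ s / (1 + freqSq k) * ((2 * Real.pi) ^ 2 * ‖coeff f k‖ ^ 2) *
        |(k i : ℝ)| ^ 2 := by ring
    _ ≤ (1 + freqSq k) ^ s / (1 + freqSq k) * ((2 * Real.pi) ^ 2 * ‖coeff f k‖ ^ 2) *
        (1 + freqSq k) := by gcongr
    _ = (2 * Real.pi) ^ 2 * ((1 + freqSq k) ^ s * ‖coeff f k‖ ^ 2) := by field_simp

lemma sobSq_add_le (s : ℝ) (c d : (Fin 2 → ℤ) → ℂ) :
    sobSq s (c + d) ≤ 4 * sobSq s c + 4 * sobSq s d := by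
  unfold sobSq
  rw [← ENNReal.tsum_mul_left, ← ENNReal.tsum_mul_left, ← ENNReal.tsum_add]
  refine ENNReal.tsum_le_tsum fun k => ?_
  calc _ ≤ ENNReal.ofReal ((1 + freqSq k) ^ s) * (4 * ‖c k‖ₑ ^ 2 + 4 * ‖d k‖ₑ ^ 2) := by
        gcongr
        refine le_trans ?_ (add_sq_le_four _ _)
        gcongr
        exact enorm_add_le _ _
    _ = _ := by ring

/-! ### The transport term -/

lemma transport_eq (v : Torus → Fin 2 → ℝ) (f : Torus → ℝ) :
    transport v f = (fun x => v x 0) * pderiv 0 f + (fun x => v x 1) * pderiv 1 f := by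
  ext x; simp [transport, Fin.sum_univ_two]

lemma continuous_transport {v : Torus → Fin 2 → ℝ} (hv : ∀ i, Continuous fun x => v x i)
    {f : Torus → ℝ} (hf : IsC1 f) : Continuous (transport v f) := by
  rw [transport_eq]
  exact ((hv 0).mul (hf.cont_pderiv 0)).add ((hv 1).mul (hf.cont_pderiv 1))

lemma transport_sub (v : Torus → Fin 2 → ℝ) {f g : Torus → ℝ} (hf : IsC1 f) (hg : IsC1 g) :
    transport v (f - g) = transport v f - transport v g := by
  simp only [transport_eq, (hf.sub hg).2]; ring

lemma transport_add (v : Torus → Fin 2 → ℝ) {f g : Torus → ℝ} (hf : IsC1 f) (hg : IsC1 g) :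
    transport v (f + g) = transport v f + transport v g := by
  simp only [transport_eq, (hf.add hg).2]; ring

/-- Transport along a smooth field loses one derivative. -/
lemma exists_sobSq_transport_le {v : Torus → Fin 2 → ℝ} (hv : ∀ i, Smooth fun x => v x i) (s : ℝ) :
    ∃ C : ℝ≥0, ∀ f, IsC1 f → sobSq (s - 1) (coeff (transport v f)) ≤ C * sobSq s (coeff f) := by
  let A : Fin 2 → ℝ≥0∞ := fun i => ENNReal.ofReal (2 ^ |(s - 1) / 2|) ^ 2 *
    (2 * wienerNorm |(s - 1) / 2| (coeff fun x => v x i) ^ 2)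
  have hA : ∀ i, A i ≠ ⊤ := fun i => by
    have := (wienerNorm_lt_top_iff.2 ((hv i).wiener |(s - 1) / 2|).2).ne
    exact ENNReal.mul_ne_top (ENNReal.pow_ne_top ENNReal.ofReal_ne_top)
      (ENNReal.mul_ne_top (by norm_num) (ENNReal.pow_ne_top this))
  refine ⟨(4 * (A 0 + A 1) * ENNReal.ofReal ((2 * Real.pi) ^ 2)).toNNReal, fun f hf => ?_⟩
  rw [ENNReal.coe_toNNReal (ENNReal.mul_ne_top (ENNReal.mul_ne_top (by norm_num)
    (ENNReal.add_ne_top.2 ⟨hA 0, hA 1⟩)) ENNReal.ofReal_ne_top)]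
  have h1 : coeff (transport v f) = coeff ((fun x => v x 0) * pderiv 0 f) +
      coeff ((fun x => v x 1) * pderiv 1 f) := by
    ext k
    rw [transport_eq, coeff_add ((hv 0).continuous.mul (hf.cont_pderiv 0))
      ((hv 1).continuous.mul (hf.cont_pderiv 1))]
    rfl
  rw [h1]
  have h2 : ∀ i, sobSq (s - 1) (coeff ((fun x => v x i) * pderiv i f)) ≤
      A i * (ENNReal.ofReal ((2 * Real.pi) ^ 2) * sobSq s (coeff f)) := fun i =>
    (sobSq_mul_le (s - 1) ((hv i).wiener 0) (hf.cont_pderiv i)).trans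
      (by gcongr; exact sobSq_pderiv_le s hf i)
  refine (sobSq_add_le _ _ _).trans ?_
  calc _ ≤ 4 * (A 0 * (ENNReal.ofReal ((2 * Real.pi) ^ 2) * sobSq s (coeff f))) +
        4 * (A 1 * (ENNReal.ofReal ((2 * Real.pi) ^ 2) * sobSq s (coeff f))) := by
        gcongr
        · exact h2 0
        · exact h2 1
    _ = _ := by ring

lemma wienerNorm_pderiv_le {f : Torus → ℝ} (hf : IsC1 f) (i : Fin 2) :
    wienerNorm 0 (coeff (pderiv i f)) ≤
      ENNReal.ofReal (2 * Real.pi) * wienerNorm (1 / 2) (coeff f) := by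
  rw [wienerNorm_zero, wienerNorm, ← ENNReal.tsum_mul_left]
  refine ENNReal.tsum_le_tsum fun k => ?_
  rw [hf.coeff_pderiv, ← ofReal_norm, ← ofReal_norm, ← ENNReal.ofReal_mul (wt_rpow_pos k _).le,
    ← ENNReal.ofReal_mul (by positivity)]
  refine ENNReal.ofReal_le_ofReal ?_
  simp only [norm_mul, Complex.norm_I, Complex.norm_real, Complex.norm_ofNat, Complex.norm_intCast,
    mul_one, Real.norm_eq_abs, abs_of_pos Real.pi_pos]
  have := abs_freq_le k i
  rw [mul_assoc]
  gcongr

lemma wienerNorm_add_le (c d : (Fin 2 → ℤ) → ℂ) :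
    wienerNorm 0 (c + d) ≤ wienerNorm 0 c + wienerNorm 0 d := by
  simp only [wienerNorm_zero, ← ENNReal.tsum_add]
  exact ENNReal.tsum_le_tsum fun k => enorm_add_le _ _

lemma wienerNorm_transport_le {v : Torus → Fin 2 → ℝ} (hv : ∀ i, Wiener 0 fun x => v x i)
    {f : Torus → ℝ} (hf : IsC1 f) :
    wienerNorm 0 (coeff (transport v f)) ≤
      (wienerNorm 0 (coeff fun x => v x 0) + wienerNorm 0 (coeff fun x => v x 1)) *
        (ENNReal.ofReal (2 * Real.pi) * wienerNorm (1 / 2) (coeff f)) := by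
  have h1 : coeff (transport v f) = coeff ((fun x => v x 0) * pderiv 0 f) +
      coeff ((fun x => v x 1) * pderiv 1 f) := by
    ext k
    rw [transport_eq, coeff_add ((hv 0).1.mul (hf.cont_pderiv 0))
      ((hv 1).1.mul (hf.cont_pderiv 1))]
    rfl
  rw [h1, add_mul]
  refine (wienerNorm_add_le _ _).trans (add_le_add ?_ ?_)
  · exact (wienerNorm_mul_le (hv 0) (hf.cont_pderiv 0)).trans
      (by gcongr; exact wienerNorm_pderiv_le hf 0)
  · exact (wienerNorm_mul_le (hv 1) (hf.cont_pderiv 1)).trans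
      (by gcongr; exact wienerNorm_pderiv_le hf 1)

lemma coeff_zero_eq (f : Torus → ℝ) : coeff f 0 = ((∫ x, f x ∂torusMeasure : ℝ) : ℂ) := by
  rw [coeff_eq_integral, ← integral_complex_ofReal]
  simp [mFourier_zero]

lemma IsC1.integral_pderiv {f : Torus → ℝ} (hf : IsC1 f) (i : Fin 2) :
    ∫ x, pderiv i f x ∂torusMeasure = 0 := by
  have := coeff_zero_eq (pderiv i f)
  rw [hf.coeff_pderiv] at this
  simp only [Pi.zero_apply, Int.cast_zero, mul_zero, zero_mul] at this
  exact_mod_cast this.symm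

/-- Integration by parts: transport along a divergence-free field is skew-symmetric. -/
lemma pairing_transport {v : Torus → Fin 2 → ℝ} (hv : ∀ i, IsC1 fun x => v x i)
    (hdiv : DivFree v) {f g : Torus → ℝ} (hf : IsC1 f) (hg : IsC1 g) :
    pairing f (transport v g) = -pairing (transport v f) g := by
  have hfg := hf.mul hg
  have h : ∀ i, IsC1 ((fun x => v x i) * (f * g)) := fun i => ((hv i).mul hfg.1).1
  have h0 : ∫ x, (pderiv 0 ((fun x => v x 0) * (f * g)) x + pderiv 1 ((fun x => v x 1) * (f * g)) x)
      ∂torusMeasure = 0 := by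
    rw [integral_add (integrable_of_continuous ((h 0).cont_pderiv 0))
      (integrable_of_continuous ((h 1).cont_pderiv 1)), (h 0).integral_pderiv,
      (h 1).integral_pderiv, add_zero]
  rw [eq_neg_iff_add_eq_zero, ← h0]
  unfold pairing
  have hvc : ∀ i, Continuous fun x => v x i := fun i => (hv i).cont
  rw [← integral_add (f := fun x => f x * transport v g x) (g := fun x => transport v f x * g x)
    (integrable_of_continuous (hf.cont.mul (continuous_transport hvc hg)))
    (integrable_of_continuous ((continuous_transport hvc hf).mul hg.cont))]
  congr 1
  ext x
  have hd := hdiv x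
  rw [Fin.sum_univ_two] at hd
  rw [((hv 0).mul hfg.1).2, ((hv 1).mul hfg.1).2, hfg.2, hfg.2]
  simp only [transport_eq, Pi.add_apply, Pi.mul_apply]
  linear_combination (-(f x * g x)) * hd

/-! ### The Biot–Savart law -/

/-- The Fourier symbol of the `i`-th component of the Biot–Savart kernel. -/
noncomputable def bsSymbol (i : Fin 2) (k : Fin 2 → ℤ) : ℂ :=
  ![Complex.I * (k 1 : ℂ) / (2 * Real.pi * freqSq k : ℝ),
    -(Complex.I * (k 0 : ℂ)) / (2 * Real.pi * freqSq k : ℝ)] i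

lemma biotSavart_eq (w : Torus → ℝ) (i : Fin 2) :
    (fun x => biotSavart w x i) = synth fun k => bsSymbol i k * coeff w k := by
  ext x
  fin_cases i <;> rfl

lemma norm_bsSymbol_le (i : Fin 2) (k : Fin 2 → ℤ) : ‖bsSymbol i k‖ ≤ 1 := by
  have h : ∀ j : Fin 2, |(k j : ℝ)| / (2 * Real.pi * freqSq k) ≤ 1 := by
    intro j
    have h1 : |(k j : ℝ)| ≤ freqSq k := by
      have h2 : |(k j : ℝ)| ≤ (k j : ℝ) ^ 2 := by
        have : |k j| ≤ k j ^ 2 := by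
          rw [sq, ← Int.natCast_natAbs, ← Int.natAbs_mul_self' (k j)]
          exact_mod_cast Nat.le_mul_self _
        exact_mod_cast this
      refine h2.trans ?_
      unfold freqSq
      fin_cases j
      · simp; positivity
      · simp; positivity
    refine div_le_one_of_le₀ (h1.trans ?_) (by have := freqSq_nonneg k; positivity)
    nlinarith [Real.pi_gt_three, freqSq_nonneg k]
  have h0 : ‖((2 * Real.pi * freqSq k : ℝ) : ℂ)‖ = 2 * Real.pi * freqSq k := by
    rw [Complex.norm_real, Real.norm_eq_abs]
    exact abs_of_nonneg (by have := freqSq_nonneg k; positivity)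
  fin_cases i
  · change ‖Complex.I * (k 1 : ℂ) / (2 * Real.pi * freqSq k : ℝ)‖ ≤ 1
    rw [norm_div, h0, norm_mul, Complex.norm_I, Complex.norm_intCast, one_mul]
    exact h 1
  · change ‖-(Complex.I * (k 0 : ℂ)) / (2 * Real.pi * freqSq k : ℝ)‖ ≤ 1
    rw [norm_div, h0, norm_neg, norm_mul, Complex.norm_I, Complex.norm_intCast, one_mul]
    exact h 0

lemma bsSymbol_symm (w : Torus → ℝ) (i : Fin 2) (k : Fin 2 → ℤ) :
    bsSymbol i (-k) * coeff w (-k) = conj (bsSymbol i k * coeff w k) := by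
  rw [map_mul, coeff_neg_freq]
  congr 1
  fin_cases i <;> simp [bsSymbol, freqSq_neg, map_ofNat]

lemma norm_bs_le (w : Torus → ℝ) (i : Fin 2) (k : Fin 2 → ℤ) :
    ‖bsSymbol i k * coeff w k‖ ≤ ‖coeff w k‖ := by
  rw [norm_mul]
  exact mul_le_of_le_one_left (norm_nonneg _) (norm_bsSymbol_le i k)

lemma Wiener.coeff_biotSavart {w : Torus → ℝ} (hw : Wiener 0 w) (i : Fin 2) (k : Fin 2 → ℤ) :
    coeff (fun x => biotSavart w x i) k = bsSymbol i k * coeff w k := by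
  rw [biotSavart_eq]
  exact coeff_synth ((hw.summable le_rfl).of_nonneg_of_le (fun _ => norm_nonneg _)
    (norm_bs_le w i)) (bsSymbol_symm w i) k

lemma Wiener.biotSavart {s : ℝ} (hs : 0 ≤ s) {w : Torus → ℝ} (hw : Wiener s w) (i : Fin 2) :
    Wiener s fun x => biotSavart w x i := by
  have hw0 := hw.mono hs
  refine ⟨?_, ?_⟩
  · rw [biotSavart_eq]
    exact continuous_synth ((hw.summable hs).of_nonneg_of_le (fun _ => norm_nonneg _)
      (norm_bs_le w i))
  · simp only [hw0.coeff_biotSavart]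
    exact hw.2.of_nonneg_of_le (fun k => mul_nonneg (wt_rpow_pos k s).le (norm_nonneg _))
      fun k => mul_le_mul_of_nonneg_left (norm_bs_le w i k) (wt_rpow_pos k s).le

lemma Wiener.wienerNorm_biotSavart_le {w : Torus → ℝ} (hw : Wiener 0 w) (i : Fin 2) :
    wienerNorm 0 (coeff fun x => Vorticity.biotSavart w x i) ≤ wienerNorm 0 (coeff w) := by
  simp only [wienerNorm_zero, hw.coeff_biotSavart]
  refine ENNReal.tsum_le_tsum fun k => ?_
  rw [← ofReal_norm, ← ofReal_norm]
  exact ENNReal.ofReal_le_ofReal (norm_bs_le w i k)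

/-- The velocity field is divergence-free: `k · û(k) = 0`. -/
lemma Wiener.divFree_biotSavart {w : Torus → ℝ} (hw : Wiener (1 / 2) w) :
    DivFree (Vorticity.biotSavart w) := by
  have hC : ∀ i, IsC1 fun x => Vorticity.biotSavart w x i := fun i =>
    (hw.biotSavart (by norm_num) i).isC1
  have hw0 : Wiener 0 w := hw.mono (by norm_num)
  have h : pderiv 0 (fun y => Vorticity.biotSavart w y 0) +
      pderiv 1 (fun y => Vorticity.biotSavart w y 1) = (fun _ => 0 : Torus → ℝ) := by
    refine eq_of_coeff_eq (((hC 0).cont_pderiv 0).add ((hC 1).cont_pderiv 1)) continuous_const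
      fun k => ?_
    rw [coeff_add ((hC 0).cont_pderiv 0) ((hC 1).cont_pderiv 1), (hC 0).coeff_pderiv,
      (hC 1).coeff_pderiv, hw0.coeff_biotSavart, hw0.coeff_biotSavart]
    have h0 : coeff (fun _ => 0) k = 0 := by simp [coeff_eq_integral]
    rw [h0]
    simp only [bsSymbol, Matrix.cons_val_zero, Matrix.cons_val_one]
    ring
  intro x
  rw [Fin.sum_univ_two]
  exact congrFun h x

lemma Wiener.sub {s : ℝ} {f g : Torus → ℝ} (hf : Wiener s f) (hg : Wiener s g) :
    Wiener s (f - g) := by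
  refine ⟨hf.1.sub hg.1, (hf.2.add hg.2).of_nonneg_of_le
    (fun k => mul_nonneg (wt_rpow_pos k s).le (norm_nonneg _)) fun k => ?_⟩
  rw [coeff_sub hf.1 hg.1, ← mul_add]
  exact mul_le_mul_of_nonneg_left (norm_sub_le _ _) (wt_rpow_pos k s).le

lemma Wiener.biotSavart_sub {f g : Torus → ℝ} (hf : Wiener 0 f) (hg : Wiener 0 g) (i : Fin 2)
    (x : Torus) : Vorticity.biotSavart (f - g) x i =
      Vorticity.biotSavart f x i - Vorticity.biotSavart g x i := by
  have : (fun x => Vorticity.biotSavart (f - g) x i) =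
      (fun x => Vorticity.biotSavart f x i) - fun x => Vorticity.biotSavart g x i := by
    refine eq_of_coeff_eq ((hf.sub hg).biotSavart le_rfl i).1
      ((hf.biotSavart le_rfl i).1.sub (hg.biotSavart le_rfl i).1) fun k => ?_
    rw [coeff_sub (hf.biotSavart le_rfl i).1 (hg.biotSavart le_rfl i).1,
      (hf.sub hg).coeff_biotSavart, hf.coeff_biotSavart, hg.coeff_biotSavart, coeff_sub hf.1 hg.1]
    ring
  exact congrFun this x

lemma Wiener.enorm_apply_le {f : Torus → ℝ} (hf : Wiener 0 f) (x : Torus) :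
    ‖f x‖ₑ ≤ wienerNorm 0 (coeff f) := by
  have h := (hasSum_coeff hf.1 (hf.summable le_rfl) x).tsum_eq
  have h2 : ‖f x‖ₑ = ‖(f x : ℂ)‖ₑ := by rw [← ofReal_norm, ← ofReal_norm, Complex.norm_real]
  rw [h2, ← h, wienerNorm_zero]
  refine enorm_tsum_le_tsum_enorm.trans (le_of_eq (tsum_congr fun k => ?_))
  rw [← ofReal_norm, norm_mul_mFourier, ofReal_norm]

/-! ### The spaces `𝓑_α` for `α > 1` -/

lemma wienerNorm_mono {s s' : ℝ} (h : s ≤ s') (c : (Fin 2 → ℤ) → ℂ) :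
    wienerNorm s c ≤ wienerNorm s' c :=
  ENNReal.tsum_le_tsum fun k => by
    gcongr
    exact one_le_wt k

/-- The Sobolev embedding `𝓑_α ⊆ C¹` for `α > 1`, in terms of Fourier coefficients. -/
lemma exists_wienerNorm_le {α : ℝ} (hα : 1 < α) : ∃ C : ℝ≥0,
    ∀ c : (Fin 2 → ℤ) → ℂ, wienerNorm (1 / 2) c ≤ C * sobSq (2 * α) c ^ (1 / 2 : ℝ) := by
  have hK : wienerNorm (1 - 2 * α) (fun _ => 1) < ⊤ := by
    rw [wienerNorm_lt_top_iff]
    simpa using summable_wt_rpow (q := 2 * α - 1) (by linarith)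
  set K := 2 * wienerNorm (1 - 2 * α) (fun _ => 1) with hKdef
  have hK' : K ≠ ⊤ := ENNReal.mul_ne_top (by norm_num) hK.ne
  refine ⟨(K + 1).toNNReal, fun c => ?_⟩
  rw [ENNReal.coe_toNNReal (by simp [hK'])]
  refine (ENNReal.pow_le_pow_left_iff two_ne_zero).1 ?_
  have h1 : wienerNorm (1 / 2) c ^ 2 ≤ K * sobSq (2 * α) c := by
    have h2 := tsum_mul_sq_le (fun k : Fin 2 → ℤ => ENNReal.ofReal ((1 + freqSq k) ^ (1 - 2 * α)))
      (fun k => ENNReal.ofReal ((1 + freqSq k) ^ (2 * α - 1 / 2)) * ‖c k‖ₑ)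
    convert h2 using 1
    · unfold wienerNorm
      congr 1
      refine tsum_congr fun k => ?_
      rw [← mul_assoc, ← ENNReal.ofReal_mul (wt_rpow_pos k _).le, ← Real.rpow_add (wt_pos k)]
      congr 3; ring
    · rw [hKdef, wienerNorm, sobSq]
      congr 1
      · simp
      · refine tsum_congr fun k => ?_
        rw [mul_pow, ← mul_assoc, ← ENNReal.ofReal_pow (wt_rpow_pos k _).le,
          ← ENNReal.ofReal_mul (wt_rpow_pos k _).le, ← Real.rpow_natCast,
          ← Real.rpow_mul (wt_pos k).le, ← Real.rpow_add (wt_pos k)]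
        congr 3
        push_cast; ring
  rw [mul_pow, ← ENNReal.rpow_natCast (sobSq _ _ ^ (1 / 2 : ℝ)), ← ENNReal.rpow_mul,
    show (1 / 2 : ℝ) * ((2 : ℕ) : ℝ) = 1 by norm_num, ENNReal.rpow_one]
  refine h1.trans ?_
  gcongr
  calc K ≤ K + 1 := le_self_add
    _ = (K + 1) * 1 := (mul_one _).symm
    _ ≤ (K + 1) * (K + 1) := by gcongr; exact le_add_self
    _ = (K + 1) ^ 2 := (sq _).symm

lemma MemB.wiener {α : ℝ} (hα : 1 < α) {f : Torus → ℝ} (hf : MemB α f) : Wiener (1 / 2) f := by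
  obtain ⟨C, hC⟩ := exists_wienerNorm_le hα
  exact ⟨hf.1, wienerNorm_lt_top_iff.1
    ((hC (coeff f)).trans_lt (ENNReal.mul_lt_top ENNReal.coe_lt_top hf.2))⟩

lemma MemC.tendsto_wienerNorm {T α : ℝ} (hα : 1 < α) {y : ℝ → Torus → ℝ} (hy : MemC T α y) {t : ℝ}
    (ht : t ∈ Icc 0 T) :
    Tendsto (fun s => wienerNorm 0 (coeff (y s - y t))) (𝓝[Icc 0 T] t) (𝓝 0) := by
  obtain ⟨C, hC⟩ := exists_wienerNorm_le hα
  have h := ENNReal.Tendsto.const_mul (a := (C : ℝ≥0∞)) (hy.2 t ht) (Or.inr ENNReal.coe_ne_top)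
  rw [mul_zero] at h
  exact tendsto_of_tendsto_of_tendsto_of_le_of_le tendsto_const_nhds h (fun _ => zero_le)
    fun s => (wienerNorm_mono (by norm_num) _).trans (hC _)

/-- A continuous path in `𝓑_α` is bounded. -/
lemma MemC.exists_bound {T α : ℝ} {y : ℝ → Torus → ℝ} (hy : MemC T α y) :
    ∃ M : ℝ≥0, ∀ t ∈ Icc 0 T, normB α (y t) ≤ M := by
  suffices h : ∃ M : ℝ≥0, ∀ t ∈ Icc 0 T, sobSq (2 * α) (coeff (y t)) ≤ M by
    obtain ⟨M, hM⟩ := h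
    refine ⟨M + 1, fun t ht => ?_⟩
    refine (ENNReal.pow_le_pow_left_iff two_ne_zero).1 ?_
    rw [normB, ← sobSq_eq]
    refine (hM t ht).trans ?_
    have : M ≤ (M + 1) ^ 2 := by nlinarith [M.2]
    exact_mod_cast this
  refine isCompact_Icc.induction_on (p := fun S => ∃ M : ℝ≥0, ∀ t ∈ S, sobSq (2 * α) (coeff (y t)) ≤ M)
    ⟨0, by simp⟩ (fun S S' hS ⟨M, hM⟩ => ⟨M, fun t ht => hM t (hS ht)⟩)
    (fun S S' ⟨M, hM⟩ ⟨M', hM'⟩ => ⟨max M M', ?_⟩) fun t ht => ?_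
  · rintro t (h | h)
    · exact (hM t h).trans (by exact_mod_cast le_max_left _ _)
    · exact (hM' t h).trans (by exact_mod_cast le_max_right _ _)
  · have h1 := (hy.2 t ht).eventually (gt_mem_nhds one_pos)
    have hfin : sobSq (2 * α) (coeff (y t)) ≠ ⊤ := by
      rw [sobSq_eq]; exact ENNReal.pow_ne_top (hy.1 t ht).2.ne
    refine ⟨{s | s ∈ Icc 0 T ∧ normB α (y s - y t) < 1}, ?_,
      (4 + 4 * sobSq (2 * α) (coeff (y t))).toNNReal, ?_⟩
    · filter_upwards [h1, self_mem_nhdsWithin] with s h1 h2 using ⟨h2, h1⟩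
    · rintro s ⟨hs, hs1⟩
      rw [ENNReal.coe_toNNReal (ENNReal.add_ne_top.2 ⟨by norm_num,
        ENNReal.mul_ne_top (by norm_num) hfin⟩)]
      have h2 : coeff (y s) = coeff (y s - y t) + coeff (y t) := by
        ext k
        rw [Pi.add_apply, coeff_sub (hy.1 s hs).1 (hy.1 t ht).1, sub_add_cancel]
      rw [h2]
      refine (sobSq_add_le _ _ _).trans ?_
      gcongr
      rw [sobSq_eq]
      calc 4 * sobolevNorm (2 * α) (y s - y t) ^ 2 ≤ 4 * 1 ^ 2 := by gcongr; exact hs1.le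
        _ = 4 := by norm_num

lemma continuousOn_of_enorm_sub {S : Set ℝ} {f : ℝ → ℝ} (h : ∀ t ∈ S,
    Tendsto (fun s => ‖f s - f t‖ₑ) (𝓝[S] t) (𝓝 0)) : ContinuousOn f S := by
  intro t ht
  have := h t ht
  rw [ContinuousWithinAt, tendsto_iff_edist_tendsto_0]
  simpa only [edist_eq_enorm_sub] using this

lemma MemC.continuousOn_apply {T α : ℝ} (hα : 1 < α) {y : ℝ → Torus → ℝ} (hy : MemC T α y)
    (x : Torus) : ContinuousOn (fun t => y t x) (Icc 0 T) := by
  refine continuousOn_of_enorm_sub fun t ht => ?_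
  refine tendsto_of_tendsto_of_tendsto_of_le_of_le' tendsto_const_nhds
    (hy.tendsto_wienerNorm hα ht) (.of_forall fun _ => zero_le) ?_
  filter_upwards [self_mem_nhdsWithin] with s hs
  exact ((((hy.1 s hs).wiener hα).mono (by norm_num)).sub
    (((hy.1 t ht).wiener hα).mono (by norm_num))).enorm_apply_le x

lemma MemC.continuousOn_biotSavart {T α : ℝ} (hα : 1 < α) {y : ℝ → Torus → ℝ} (hy : MemC T α y)
    (x : Torus) (i : Fin 2) : ContinuousOn (fun t => biotSavart (y t) x i) (Icc 0 T) := by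
  refine continuousOn_of_enorm_sub fun t ht => ?_
  refine tendsto_of_tendsto_of_tendsto_of_le_of_le' tendsto_const_nhds
    (hy.tendsto_wienerNorm hα ht) (.of_forall fun _ => zero_le) ?_
  filter_upwards [self_mem_nhdsWithin] with s hs
  have hs0 : Wiener 0 (y s) := ((hy.1 s hs).wiener hα).mono (by norm_num)
  have ht0 : Wiener 0 (y t) := ((hy.1 t ht).wiener hα).mono (by norm_num)
  rw [← hs0.biotSavart_sub ht0]
  exact (((hs0.sub ht0).biotSavart le_rfl i).enorm_apply_le x).trans
    ((hs0.sub ht0).wienerNorm_biotSavart_le i)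

lemma MemC.exists_wiener_bound {T α : ℝ} (hα : 1 < α) {y : ℝ → Torus → ℝ} (hy : MemC T α y) :
    ∃ M : ℝ≥0, ∀ t ∈ Icc 0 T, wienerNorm (1 / 2) (coeff (y t)) ≤ M := by
  obtain ⟨C, hC⟩ := exists_wienerNorm_le hα
  obtain ⟨M, hM⟩ := hy.exists_bound
  refine ⟨C * M, fun t ht => (hC _).trans ?_⟩
  push_cast
  gcongr
  exact hM t ht

lemma abs_le_of_enorm_le {x : ℝ} {M : ℝ≥0} (h : ‖x‖ₑ ≤ M) : |x| ≤ M := by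
  rw [← Real.norm_eq_abs, ← toReal_enorm]
  exact ENNReal.toReal_le_coe_of_le_coe h

/-- The drift of the weak formulation is continuous in time. -/
lemma MemC.continuousOn_drift {T α : ℝ} (hα : 1 < α) {y : ℝ → Torus → ℝ} (hy : MemC T α y)
    {φ ψ : Torus → ℝ} (hφ : IsC1 φ) (hψ : Continuous ψ) :
    ContinuousOn (fun r => pairing (y r) (transport (biotSavart (y r)) φ + ψ)) (Icc 0 T) := by
  obtain ⟨M, hM⟩ := hy.exists_wiener_bound hα
  have hbd : ∀ f : Torus → ℝ, Continuous f → ∃ N : ℝ, 0 ≤ N ∧ ∀ x, |f x| ≤ N := fun f hf => by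
    obtain ⟨N, hN⟩ := isCompact_univ.exists_bound_of_continuousOn hf.continuousOn
    exact ⟨N, (norm_nonneg _).trans (hN 0 (mem_univ 0)), fun x => hN x (mem_univ x)⟩
  obtain ⟨N0, hN0, h0⟩ := hbd _ (hφ.cont_pderiv 0)
  obtain ⟨N1, hN1, h1⟩ := hbd _ (hφ.cont_pderiv 1)
  obtain ⟨N2, hN2, h2⟩ := hbd _ hψ
  have hw : ∀ r ∈ Icc 0 T, Wiener 0 (y r) := fun r hr =>
    ((hy.1 r hr).wiener hα).mono (by norm_num)
  unfold pairing
  refine continuousOn_of_dominated (bound := fun _ => (M : ℝ) * (M * N0 + M * N1 + N2))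
    (fun r hr => ?_) (fun r hr => .of_forall fun x => ?_) (integrable_const _)
    (.of_forall fun x => ?_)
  · exact (integrable_of_continuous ((hw r hr).1.mul ((continuous_transport
      (fun i => ((hw r hr).biotSavart le_rfl i).1) hφ).add hψ))).aestronglyMeasurable
  · have a0 : |y r x| ≤ M := abs_le_of_enorm_le (((hw r hr).enorm_apply_le x).trans
      ((wienerNorm_mono (by norm_num) _).trans (hM r hr)))
    have a1 : ∀ i, |biotSavart (y r) x i| ≤ M := fun i => abs_le_of_enorm_le
      ((((hw r hr).biotSavart le_rfl i).enorm_apply_le x).trans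
      (((hw r hr).wienerNorm_biotSavart_le i).trans
        ((wienerNorm_mono (by norm_num) _).trans (hM r hr))))
    rw [Real.norm_eq_abs, abs_mul, transport_eq]
    simp only [Pi.add_apply, Pi.mul_apply]
    gcongr
    refine (abs_add_le _ _).trans (add_le_add ((abs_add_le _ _).trans (add_le_add ?_ ?_)) (h2 x))
    · rw [abs_mul]; gcongr
      · exact a1 0
      · exact h0 x
    · rw [abs_mul]; gcongr
      · exact a1 1
      · exact h1 x
  · rw [show (fun r => y r x * (transport (biotSavart (y r)) φ + ψ) x) = fun r => y r x *
      (biotSavart (y r) x 0 * pderiv 0 φ x + biotSavart (y r) x 1 * pderiv 1 φ x + ψ x) by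
      ext r; simp [transport_eq]]
    exact (hy.continuousOn_apply hα x).mul ((((hy.continuousOn_biotSavart hα x 0).mul
      continuousOn_const).add ((hy.continuousOn_biotSavart hα x 1).mul
      continuousOn_const)).add continuousOn_const)

lemma MemC.continuousOn_pairing {T α : ℝ} (hα : 1 < α) {y : ℝ → Torus → ℝ} (hy : MemC T α y)
    {ψ : Torus → ℝ} (hψ : Continuous ψ) : ContinuousOn (fun r => pairing (y r) ψ) (Icc 0 T) := by
  have h : IsC1 (0 : Torus → ℝ) := (isC1_of_hasDerivAt (g := fun _ _ => 0) continuous_const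
    (fun _ => continuous_const) fun _ _ => hasDerivAt_const _ _).1
  have h0 : ∀ i, pderiv i (0 : Torus → ℝ) = 0 := fun i => by ext x; simp [pderiv]
  have := hy.continuousOn_drift hα h hψ
  refine this.congr fun r _ => ?_
  simp [transport_eq, h0]

/-! ### Trigonometric test functions and the heat semigroup -/

/-- The real trigonometric function `x ↦ Re (z exp(2πi k·x))`. -/
noncomputable def trig (k : Fin 2 → ℤ) (z : ℂ) (x : Torus) : ℝ := (z * mFourier k x).re

lemma smooth_trig (k : Fin 2 → ℤ) (z : ℂ) : Smooth (trig k z) := by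
  have h : (fun y : Fin 2 → ℝ => trig k z fun i => (y i : UnitAddCircle)) = fun y =>
      (z * (Complex.exp (2 * Real.pi * Complex.I * k 0 * y 0) *
        Complex.exp (2 * Real.pi * Complex.I * k 1 * y 1))).re := by
    ext y
    simp only [trig, mFourier, ContinuousMap.coe_mk, Fin.prod_univ_two, fourier_coe_apply]
    simp
  unfold Smooth
  rw [h]
  have h1 : ∀ i : Fin 2, ContDiff ℝ (⊤ : ℕ∞) fun y : Fin 2 → ℝ => ((y i : ℝ) : ℂ) := fun i =>
    Complex.ofRealCLM.contDiff.comp (contDiff_apply ℝ ℝ i)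
  exact Complex.reCLM.contDiff.comp (contDiff_const.mul
    (((contDiff_const.mul (h1 0)).cexp).mul ((contDiff_const.mul (h1 1)).cexp)))

lemma pderiv_trig (k : Fin 2 → ℤ) (z : ℂ) (i : Fin 2) :
    pderiv i (trig k z) = trig k (2 * Real.pi * Complex.I * k i * z) := by
  ext x
  refine HasDerivAt.deriv ?_
  have h5 : HasDerivAt (fun h : ℝ => (2 * Real.pi * Complex.I * k i * h : ℂ))
      (2 * Real.pi * Complex.I * k i) 0 := by
    simpa using (Complex.ofRealCLM.hasDerivAt (x := (0 : ℝ))).const_mul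
      (2 * Real.pi * Complex.I * k i : ℂ)
  have h6 := ((h5.cexp).const_mul (mFourier k x)).const_mul z
  have h7 := Complex.reCLM.hasFDerivAt.comp_hasDerivAt (0 : ℝ) h6
  simp only [trig]
  have h8 : (fun h : ℝ => (z * mFourier k (x + axis i h)).re) = (Complex.reCLM ∘ fun h : ℝ =>
      z * (mFourier k x * Complex.exp (2 * Real.pi * Complex.I * k i * h))) := by
    ext h; simp only [mFourier_add_single, Function.comp_apply, Complex.reCLM_apply]
  rw [h8]
  refine h7.congr_deriv ?_
  simp only [Complex.ofReal_zero, mul_zero, Complex.exp_zero, one_mul, Complex.reCLM_apply]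
  congr 1; ring

lemma trig_smul (k : Fin 2 → ℤ) (c : ℝ) (z : ℂ) : trig k (c * z) = c • trig k z := by
  ext x; simp [trig, mul_assoc]

/-- The eigenvalue of `-Δ` at the frequency `k`. -/
noncomputable def eigenvalue (k : Fin 2 → ℤ) : ℝ := 4 * Real.pi ^ 2 * freqSq k

lemma eigenvalue_nonneg (k : Fin 2 → ℤ) : 0 ≤ eigenvalue k := by
  have := freqSq_nonneg k
  unfold eigenvalue; positivity

lemma laplacian_trig (k : Fin 2 → ℤ) (z : ℂ) :
    laplacian (trig k z) = (-eigenvalue k) • trig k z := by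
  rw [laplacian_eq]
  simp only [pderiv_trig]
  rw [← trig_smul]
  ext x
  simp only [trig, Pi.add_apply, ← Complex.add_re, eigenvalue, freqSq]
  congr 1
  push_cast
  linear_combination (4 * Real.pi ^ 2 * ((k 0 : ℂ) ^ 2 + (k 1 : ℂ) ^ 2) * z * mFourier k x) *
    Complex.I_sq

lemma pairing_trig {f : Torus → ℝ} (hf : Continuous f) (k : Fin 2 → ℤ) (z : ℂ) :
    pairing f (trig k z) = (z * conj (coeff f k)).re := by
  rw [← coeff_neg_freq, coeff_eq_integral, ← integral_const_mul, ← Complex.reCLM_apply,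
    ← ContinuousLinearMap.integral_comp_comm _ ((integrable_coeff hf (-k)).const_mul z)]
  refine integral_congr_ae (.of_forall fun x => ?_)
  simp only [trig, Complex.reCLM_apply, neg_neg, ← mul_assoc]
  rw [Complex.re_mul_ofReal, mul_comm]

/-- Continuous functions with the same pairings against trigonometric functions agree. -/
lemma eq_of_pairing_trig_eq {f g : Torus → ℝ} (hf : Continuous f) (hg : Continuous g)
    (h : ∀ k, ∀ z ∈ ({1, Complex.I} : Set ℂ), pairing f (trig k z) = pairing g (trig k z)) :
    f = g := by
  refine eq_of_coeff_eq hf hg fun k => ?_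
  have h1 := h k 1 (by simp)
  have h2 := h k Complex.I (by simp)
  rw [pairing_trig hf, pairing_trig hg] at h1 h2
  simp at h1 h2
  exact Complex.ext h1 h2

lemma norm_heat_le {t : ℝ} (ht : 0 ≤ t) (f : Torus → ℝ) (k : Fin 2 → ℤ) :
    ‖(Real.exp (-(eigenvalue k * t)) : ℂ) * coeff f k‖ ≤ ‖coeff f k‖ := by
  rw [norm_mul, Complex.norm_real, Real.norm_eq_abs, abs_of_pos (Real.exp_pos _)]
  refine mul_le_of_le_one_left (norm_nonneg _) (Real.exp_le_one_iff.2 ?_)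
  have := mul_nonneg (eigenvalue_nonneg k) ht
  linarith

lemma heat_symm (t : ℝ) (f : Torus → ℝ) (k : Fin 2 → ℤ) :
    (Real.exp (-(eigenvalue (-k) * t)) : ℂ) * coeff f (-k) =
      conj ((Real.exp (-(eigenvalue k * t)) : ℂ) * coeff f k) := by
  rw [map_mul, coeff_neg_freq, Complex.conj_ofReal, eigenvalue, eigenvalue, freqSq_neg]

lemma summable_heat {t : ℝ} (ht : 0 ≤ t) {f : Torus → ℝ} (hs : Summable fun k => ‖coeff f k‖) :
    Summable fun k => ‖(Real.exp (-(eigenvalue k * t)) : ℂ) * coeff f k‖ :=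
  hs.of_nonneg_of_le (fun _ => norm_nonneg _) (norm_heat_le ht f)

lemma continuous_heat {t : ℝ} (ht : 0 ≤ t) {f : Torus → ℝ} (hs : Summable fun k => ‖coeff f k‖) :
    Continuous (heat t f) := continuous_synth (summable_heat ht hs)

lemma coeff_heat {t : ℝ} (ht : 0 ≤ t) {f : Torus → ℝ} (hs : Summable fun k => ‖coeff f k‖)
    (k : Fin 2 → ℤ) : coeff (heat t f) k = (Real.exp (-(eigenvalue k * t)) : ℂ) * coeff f k :=
  coeff_synth (summable_heat ht hs) (heat_symm t f) k

lemma pairing_heat_trig {t : ℝ} (ht : 0 ≤ t) {f : Torus → ℝ} (hf : Continuous f)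
    (hs : Summable fun k => ‖coeff f k‖) (k : Fin 2 → ℤ) (z : ℂ) :
    pairing (heat t f) (trig k z) = Real.exp (-(eigenvalue k * t)) * pairing f (trig k z) := by
  rw [pairing_trig (continuous_heat ht hs), pairing_trig hf, coeff_heat ht hs, map_mul,
    Complex.conj_ofReal, mul_left_comm, Complex.re_ofReal_mul]

/-- Every transport term `v · ∇f` occurring in the equation has an absolutely convergent Fourier
series. -/
lemma summable_coeff_transport {v : Torus → Fin 2 → ℝ} (hv : ∀ i, Wiener 0 fun x => v x i)
    {f : Torus → ℝ} (hf : Wiener (1 / 2) f) : Summable fun k => ‖coeff (transport v f) k‖ := by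
  have h : wienerNorm 0 (coeff (transport v f)) < ⊤ := by
    refine (wienerNorm_transport_le hv hf.isC1).trans_lt ?_
    refine ENNReal.mul_lt_top (ENNReal.add_lt_top.2 ⟨?_, ?_⟩) (ENNReal.mul_lt_top
      ENNReal.ofReal_lt_top (wienerNorm_lt_top_iff.2 hf.2))
    · exact wienerNorm_lt_top_iff.2 (hv 0).2
    · exact wienerNorm_lt_top_iff.2 (hv 1).2
  simpa using wienerNorm_lt_top_iff.1 h

/-! ### Variation of constants for Young integral equations -/

/-- The classical Young setting: two Hölder functions whose exponents add up to more than one. -/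
lemma youngControl_of_holder {E : Type*} [NormedAddCommGroup E] {F : ℝ → E} {g : ℝ → ℝ}
    {A B γ T : ℝ} (hγ : 1 / 2 < γ) (hA : 0 ≤ A) (hB : 0 ≤ B)
    (hF : ∀ s ∈ Icc 0 T, ∀ t ∈ Icc 0 T, ‖F t - F s‖ ≤ A * |t - s| ^ γ)
    (hg : ∀ s ∈ Icc 0 T, ∀ t ∈ Icc 0 T, |g t - g s| ≤ B * |t - s| ^ γ) :
    YoungControl F g id (A * B) (2 * γ) T := by
  refine ⟨monotone_id.monotoneOn _, by linarith, mul_nonneg hA hB, fun s m v hs hsm hmv hv => ?_⟩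
  have hγ0 : 0 ≤ γ := by linarith
  have h1 := hF s ⟨hs, by linarith⟩ m ⟨by linarith, by linarith⟩
  have h2 := hg m ⟨by linarith, by linarith⟩ v ⟨by linarith, by linarith⟩
  rw [abs_of_nonneg (by linarith)] at h1
  rw [abs_of_nonneg (show 0 ≤ v - m by linarith)] at h2
  have h3 : (m - s) ^ γ ≤ (v - s) ^ γ := Real.rpow_le_rpow (by linarith) (by linarith) hγ0
  have h4 : (v - m) ^ γ ≤ (v - s) ^ γ := Real.rpow_le_rpow (by linarith) (by linarith) hγ0
  have h5 : (0 : ℝ) ≤ (v - s) ^ γ := Real.rpow_nonneg (by linarith) _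
  calc ‖F m - F s‖ * |g v - g m| ≤ (A * (v - s) ^ γ) * (B * (v - s) ^ γ) := by
        refine mul_le_mul (h1.trans ?_) (h2.trans ?_) (abs_nonneg _) (by positivity) <;> gcongr
    _ = A * B * (id v - id s) ^ (2 * γ) := by
        rw [two_mul, id, id, Real.rpow_add_of_nonneg (by linarith) hγ0 hγ0]; ring

/-- Integration by parts for the product of a smooth function and a Young integrand: with
`Y = ∫ F dg`, one has `∫₀ᵗ ψ F dg = ψ(t) Y(t) - ∫₀ᵗ ψ' Y dr`. -/
lemma hasYoungIntegral_mul_smooth {F g Y ψ ψ' : ℝ → ℝ} {t C θ : ℝ} (ht : 0 ≤ t) (hθ : 1 < θ)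
    (hC : 0 ≤ C) (hψ : ∀ r, HasDerivAt ψ (ψ' r) r) (hψ' : Continuous ψ')
    (hY : ContinuousOn Y (Icc 0 t)) (hY0 : Y 0 = 0)
    (hloc : ∀ s v, 0 ≤ s → s ≤ v → v ≤ t → |Y v - Y s - (g v - g s) * F s| ≤ C * (v - s) ^ θ) :
    HasYoungIntegral enorm (fun r => ψ r * F r) g t (ψ t * Y t - ∫ r in (0 : ℝ)..t, ψ' r * Y r) := by
  have hψc : Continuous ψ := continuous_iff_continuousAt.2 fun r => (hψ r).continuousAt
  obtain ⟨M, hM⟩ := isCompact_Icc (a := (0 : ℝ)) (b := t) |>.exists_bound_of_continuousOn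
    hψc.continuousOn
  obtain ⟨M', hM'⟩ := isCompact_Icc (a := (0 : ℝ)) (b := t) |>.exists_bound_of_continuousOn
    hψ'.continuousOn
  have hM0 : 0 ≤ M := (norm_nonneg _).trans (hM 0 ⟨le_rfl, ht⟩)
  have hM'0 : 0 ≤ M' := (norm_nonneg _).trans (hM' 0 ⟨le_rfl, ht⟩)
  refine hasYoungIntegral_of_norm_lt fun ε hε => ?_
  -- The two error terms are `M C δ^(θ-1) t` and `M' η t`.
  obtain ⟨η, hη, hηε⟩ : ∃ η : ℝ, 0 < η ∧ M' * η * t < ε / 2 := by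
    refine ⟨ε / 2 / (M' * t + 1), by positivity, ?_⟩
    have : 0 < M' * t + 1 := by positivity
    rw [mul_div_assoc', mul_comm, mul_div_assoc', div_lt_iff₀ this]
    nlinarith
  obtain ⟨δ₁, hδ₁, hδ₁ε⟩ : ∃ δ : ℝ, 0 < δ ∧ M * C * δ ^ (θ - 1) * t < ε / 2 := by
    have hc : Tendsto (fun δ : ℝ => M * C * δ ^ (θ - 1) * t) (𝓝[>] 0)
        (𝓝 (M * C * (0 : ℝ) ^ (θ - 1) * t)) := by
      refine Tendsto.mono_left ?_ nhdsWithin_le_nhds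
      exact ((Real.continuousAt_rpow_const 0 (θ - 1) (Or.inr (by linarith))).tendsto.const_mul
        _).mul_const _
    rw [Real.zero_rpow (by linarith), mul_zero, zero_mul] at hc
    obtain ⟨δ, h1, h2⟩ := ((hc.eventually (gt_mem_nhds (half_pos hε))).and
      self_mem_nhdsWithin).exists
    exact ⟨δ, h2, h1⟩
  obtain ⟨δ₂, hδ₂, hδ₂'⟩ := Metric.uniformContinuousOn_iff.1
    (isCompact_Icc.uniformContinuousOn_of_continuous hY) η hη
  refine ⟨min δ₁ δ₂, lt_min hδ₁ hδ₂, fun n p hp hp0 hpn hmesh => ?_⟩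
  have hmem : ∀ j ≤ n, p j ∈ Icc 0 t := fun j hj => ⟨hp0 ▸ hp (Nat.zero_le j), hpn ▸ hp hj⟩
  have hsub : ∀ i < n, uIcc (p i) (p (i + 1)) ⊆ Icc 0 t := fun i hi => by
    rw [uIcc_of_le (hp (Nat.le_succ i))]
    exact Icc_subset_Icc (hmem i hi.le).1 (hmem _ hi).2
  have hint : ∀ i < n, IntervalIntegrable (fun r => ψ' r * Y r) volume (p i) (p (i + 1)) :=
    fun i hi => ((hψ'.continuousOn).mul (hY.mono (hsub i hi))).intervalIntegrable
  have hsumint : ∫ r in (0 : ℝ)..t, ψ' r * Y r =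
      ∑ i ∈ Finset.range n, ∫ r in p i..p (i + 1), ψ' r * Y r := by
    rw [intervalIntegral.sum_integral_adjacent_intervals hint, hp0, hpn]
  have htele : ψ t * Y t = ∑ i ∈ Finset.range n, (ψ (p (i + 1)) * Y (p (i + 1)) -
      ψ (p i) * Y (p i)) := by
    rw [Finset.sum_range_sub (fun i => ψ (p i) * Y (p i)), hpn, hp0, hY0, mul_zero, sub_zero]
  have htime : t = ∑ i ∈ Finset.range n, (p (i + 1) - p i) := by
    rw [Finset.sum_range_sub p, hpn, hp0, sub_zero]
  have hterm : ∀ i ∈ Finset.range n, ‖(g (p (i + 1)) - g (p i)) • (ψ (p i) * F (p i)) -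
      ((ψ (p (i + 1)) * Y (p (i + 1)) - ψ (p i) * Y (p i)) -
        ∫ r in p i..p (i + 1), ψ' r * Y r)‖ ≤
      (M * C * δ₁ ^ (θ - 1) + M' * η) * (p (i + 1) - p i) := by
    intro i hi
    have hi' := Finset.mem_range.1 hi
    have hd0 : 0 ≤ p (i + 1) - p i := sub_nonneg.2 (hp (Nat.le_succ i))
    have hd1 : p (i + 1) - p i < δ₁ := (hmesh i hi').trans_le (min_le_left _ _)
    have hd2 : p (i + 1) - p i < δ₂ := (hmesh i hi').trans_le (min_le_right _ _)
    have e1 : |ψ (p i) * (Y (p (i + 1)) - Y (p i) - (g (p (i + 1)) - g (p i)) * F (p i))| ≤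
        M * C * δ₁ ^ (θ - 1) * (p (i + 1) - p i) := by
      rw [abs_mul]
      have a1 := hM _ (hmem i hi'.le)
      have a2 := hloc _ _ (hmem i hi'.le).1 (hp (Nat.le_succ i)) (hmem _ hi').2
      have a3 : (p (i + 1) - p i) ^ θ ≤ δ₁ ^ (θ - 1) * (p (i + 1) - p i) := by
        rw [show θ = (θ - 1) + 1 by ring, Real.rpow_add_of_nonneg hd0 (by linarith) (by norm_num),
          Real.rpow_one]
        have : (p (i + 1) - p i) ^ (θ - 1) ≤ δ₁ ^ (θ - 1) :=
          Real.rpow_le_rpow hd0 hd1.le (by linarith)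
        simpa using mul_le_mul_of_nonneg_right this hd0
      calc _ ≤ M * (C * (δ₁ ^ (θ - 1) * (p (i + 1) - p i))) :=
            mul_le_mul a1 (a2.trans (mul_le_mul_of_nonneg_left a3 hC)) (abs_nonneg _) hM0
        _ = _ := by ring
    have e2 : |∫ r in p i..p (i + 1), ψ' r * (Y (p (i + 1)) - Y r)| ≤
        M' * η * (p (i + 1) - p i) := by
      have := intervalIntegral.norm_integral_le_of_norm_le_const (a := p i) (b := p (i + 1))
        (f := fun r => ψ' r * (Y (p (i + 1)) - Y r)) (C := M' * η) (fun r hr => by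
          rw [uIoc_of_le (hp (Nat.le_succ i))] at hr
          have hr0 : r ∈ Icc 0 t := ⟨(hmem i hi'.le).1.trans hr.1.le, hr.2.trans (hmem _ hi').2⟩
          rw [norm_mul]
          refine mul_le_mul (hM' r hr0) ?_ (norm_nonneg _) hM'0
          have := hδ₂' _ (hmem _ hi') r hr0 (by
            rw [Real.dist_eq, abs_of_nonneg (by linarith [hr.2])]; linarith [hr.1])
          exact this.le)
      rwa [abs_of_nonneg hd0] at this
    have e3 : ∫ r in p i..p (i + 1), ψ' r * (Y (p (i + 1)) - Y r) =
        (ψ (p (i + 1)) - ψ (p i)) * Y (p (i + 1)) - ∫ r in p i..p (i + 1), ψ' r * Y r := by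
      simp only [mul_sub]
      rw [intervalIntegral.integral_sub (f := fun r => ψ' r * Y (p (i + 1)))
        ((hψ'.mul continuous_const).intervalIntegrable _ _)
        (hint i hi'), intervalIntegral.integral_mul_const,
        intervalIntegral.integral_eq_sub_of_hasDerivAt (fun r _ => hψ r)
          (hψ'.intervalIntegrable _ _)]
    rw [Real.norm_eq_abs, smul_eq_mul, show (g (p (i + 1)) - g (p i)) * (ψ (p i) * F (p i)) -
      ((ψ (p (i + 1)) * Y (p (i + 1)) - ψ (p i) * Y (p i)) - ∫ r in p i..p (i + 1), ψ' r * Y r) =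
      -(ψ (p i) * (Y (p (i + 1)) - Y (p i) - (g (p (i + 1)) - g (p i)) * F (p i))) -
        ∫ r in p i..p (i + 1), ψ' r * (Y (p (i + 1)) - Y r) by rw [e3]; ring]
    refine (abs_sub _ _).trans ?_
    rw [abs_neg, add_mul]
    exact add_le_add e1 e2
  rw [rsSum, ← Finset.range_eq_Ico, htele, hsumint, ← Finset.sum_sub_distrib,
    ← Finset.sum_sub_distrib]
  refine ((norm_sum_le _ _).trans (Finset.sum_le_sum hterm)).trans_lt ?_
  rw [← Finset.mul_sum, ← htime, add_mul]
  linarith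

lemma variation_of_constants_aux {c b Y : ℝ → ℝ} {T lam c₀ : ℝ} (hc : Continuous c)
    (hb : Continuous b) (hY : Continuous Y) :
    (∀ t ∈ Icc 0 T, c t = c₀ + (∫ r in (0 : ℝ)..t, (b r - lam * c r)) + Y t) ↔
    ∀ t ∈ Icc 0 T, c t = Real.exp (-(lam * t)) * c₀ +
      (∫ r in (0 : ℝ)..t, Real.exp (-(lam * (t - r))) * b r) +
      (Y t - ∫ r in (0 : ℝ)..t, lam * Real.exp (-(lam * (t - r))) * Y r) := by
  have hexp : ∀ r : ℝ, HasDerivAt (fun r => Real.exp (lam * r)) (Real.exp (lam * r) * lam) r :=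
    fun r => by simpa using ((hasDerivAt_id r).const_mul lam).exp
  -- the second equation, solved for the integral with integrating factor
  have hB : ∀ t, Real.exp (-(lam * t)) * c₀ +
      (∫ r in (0 : ℝ)..t, Real.exp (-(lam * (t - r))) * b r) +
      (Y t - ∫ r in (0 : ℝ)..t, lam * Real.exp (-(lam * (t - r))) * Y r) =
      Real.exp (-(lam * t)) * (c₀ + ∫ r in (0 : ℝ)..t, Real.exp (lam * r) * (b r - lam * Y r)) +
        Y t := by
    intro t
    have e : ∀ r, Real.exp (-(lam * (t - r))) = Real.exp (-(lam * t)) * Real.exp (lam * r) :=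
      fun r => by rw [← Real.exp_add]; congr 1; ring
    have h1 : ∫ r in (0 : ℝ)..t, Real.exp (lam * r) * (b r - lam * Y r) =
        (∫ r in (0 : ℝ)..t, Real.exp (lam * r) * b r) -
          ∫ r in (0 : ℝ)..t, Real.exp (lam * r) * (lam * Y r) := by
      rw [← intervalIntegral.integral_sub (Continuous.intervalIntegrable (by fun_prop) _ _)
        (Continuous.intervalIntegrable (by fun_prop) _ _)]
      simp only [mul_sub]
    rw [h1, mul_add, mul_sub, ← intervalIntegral.integral_const_mul,
      ← intervalIntegral.integral_const_mul]
    simp only [e]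
    have h2 : ∀ r, lam * (Real.exp (-(lam * t)) * Real.exp (lam * r)) * Y r =
        Real.exp (-(lam * t)) * (Real.exp (lam * r) * (lam * Y r)) := fun r => by ring
    simp only [h2, mul_assoc]
    ring
  simp only [hB]
  constructor
  · intro h t ht
    set z : ℝ → ℝ := fun t => c₀ + ∫ r in (0 : ℝ)..t, (b r - lam * c r) with hz
    have hzd : ∀ r, HasDerivAt z (b r - lam * c r) r := fun r =>
      (intervalIntegral.integral_hasDerivAt_right (Continuous.intervalIntegrable (by fun_prop) _ _)
        (Continuous.stronglyMeasurableAtFilter (by fun_prop) _ _)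
        (Continuous.continuousAt (by fun_prop))).const_add c₀
    have hzc : Continuous z := continuous_iff_continuousAt.2 fun r => (hzd r).continuousAt
    have h1 := intervalIntegral.integral_eq_sub_of_hasDerivAt (a := 0) (b := t)
      (fun r _ => (hexp r).mul (hzd r)) (Continuous.intervalIntegrable (by fun_prop) _ _)
    have h2 : ∫ r in (0 : ℝ)..t, (Real.exp (lam * r) * lam * z r + Real.exp (lam * r) *
        (b r - lam * c r)) = ∫ r in (0 : ℝ)..t, Real.exp (lam * r) * (b r - lam * Y r) := by
      refine intervalIntegral.integral_congr fun r hr => ?_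
      rw [uIcc_of_le ht.1] at hr
      have := h r ⟨hr.1, hr.2.trans ht.2⟩
      simp only [hz]
      rw [this]; ring
    rw [h2] at h1
    have hz0 : z 0 = c₀ := by simp [hz]
    have hzt : c t = z t + Y t := h t ht
    rw [h1, hzt]
    simp only [Pi.mul_apply, hz0, mul_zero, Real.exp_zero, one_mul, add_sub_cancel]
    rw [← mul_assoc, ← Real.exp_add, neg_add_cancel, Real.exp_zero, one_mul]
  · intro h t ht
    set z : ℝ → ℝ := fun t => Real.exp (-(lam * t)) *
      (c₀ + ∫ r in (0 : ℝ)..t, Real.exp (lam * r) * (b r - lam * Y r)) with hz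
    have hzd : ∀ r, HasDerivAt z (-(lam * z r) + (b r - lam * Y r)) r := fun r => by
      have e1 : HasDerivAt (fun r => Real.exp (-(lam * r))) (Real.exp (-(lam * r)) * -lam) r := by
        simpa using ((hasDerivAt_id r).const_mul lam).neg.exp
      have e2 : HasDerivAt (fun t => c₀ + ∫ r in (0 : ℝ)..t, Real.exp (lam * r) * (b r - lam * Y r))
          (Real.exp (lam * r) * (b r - lam * Y r)) r :=
        (intervalIntegral.integral_hasDerivAt_right
          (Continuous.intervalIntegrable (by fun_prop) _ _)
          (Continuous.stronglyMeasurableAtFilter (by fun_prop) _ _)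
          (Continuous.continuousAt (by fun_prop))).const_add c₀
      refine (e1.mul e2).congr_deriv ?_
      rw [← mul_assoc (Real.exp (-(lam * r))) (Real.exp (lam * r)), ← Real.exp_add, neg_add_cancel,
        Real.exp_zero]
      simp only [hz]; ring
    have hzc : Continuous z := continuous_iff_continuousAt.2 fun r => (hzd r).continuousAt
    have h1 := intervalIntegral.integral_eq_sub_of_hasDerivAt (a := 0) (b := t)
      (fun r _ => hzd r) (Continuous.intervalIntegrable (by fun_prop) _ _)
    have h2 : ∫ r in (0 : ℝ)..t, (-(lam * z r) + (b r - lam * Y r)) =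
        ∫ r in (0 : ℝ)..t, (b r - lam * c r) := by
      refine intervalIntegral.integral_congr fun r hr => ?_
      rw [uIcc_of_le ht.1] at hr
      have : c r = z r + Y r := h r ⟨hr.1, hr.2.trans ht.2⟩
      simp only [this]; ring
    rw [h2] at h1
    have hz0 : z 0 = c₀ := by simp [hz]
    have hzt : c t = z t + Y t := h t ht
    rw [h1, hz0, hzt]
    ring

/-- Variation of constants for `dc = (b - λ c) dt + dY` with a merely continuous forcing `Y`. -/
lemma variation_of_constants {c b Y : ℝ → ℝ} {T lam c₀ : ℝ} (hT : 0 ≤ T)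
    (hc : ContinuousOn c (Icc 0 T)) (hb : ContinuousOn b (Icc 0 T))
    (hY : ContinuousOn Y (Icc 0 T)) :
    (∀ t ∈ Icc 0 T, c t = c₀ + (∫ r in (0 : ℝ)..t, (b r - lam * c r)) + Y t) ↔
    ∀ t ∈ Icc 0 T, c t = Real.exp (-(lam * t)) * c₀ +
      (∫ r in (0 : ℝ)..t, Real.exp (-(lam * (t - r))) * b r) +
      (Y t - ∫ r in (0 : ℝ)..t, lam * Real.exp (-(lam * (t - r))) * Y r) := by
  -- extend the three functions continuously to the real line
  let κ : ℝ → ℝ := fun r => max 0 (min T r)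
  have hκ : Continuous κ := by fun_prop
  have hκm : ∀ r, κ r ∈ Icc 0 T := fun r => ⟨le_max_left _ _, max_le hT (min_le_left _ _)⟩
  have hκe : ∀ r ∈ Icc 0 T, κ r = r := fun r hr => by
    simp only [κ]; rw [min_eq_right hr.2, max_eq_right hr.1]
  have key := variation_of_constants_aux (c := c ∘ κ) (b := b ∘ κ) (Y := Y ∘ κ) (T := T)
    (lam := lam) (c₀ := c₀) (hc.comp_continuous hκ hκm) (hb.comp_continuous hκ hκm)
    (hY.comp_continuous hκ hκm)
  have hint : ∀ (G G' : ℝ → ℝ), (∀ r ∈ Icc 0 T, G r = G' r) → ∀ t ∈ Icc 0 T,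
      ∫ r in (0 : ℝ)..t, G r = ∫ r in (0 : ℝ)..t, G' r := fun G G' h t ht =>
    intervalIntegral.integral_congr fun r hr => by
      rw [uIcc_of_le ht.1] at hr
      exact h r ⟨hr.1, hr.2.trans ht.2⟩
  have hL : ∀ t ∈ Icc 0 T, ∫ r in (0 : ℝ)..t, ((b ∘ κ) r - lam * (c ∘ κ) r) =
      ∫ r in (0 : ℝ)..t, (b r - lam * c r) := hint _ _ fun r hr => by
    simp only [Function.comp_apply, hκe r hr]
  have hR1 : ∀ t ∈ Icc 0 T, ∫ r in (0 : ℝ)..t, Real.exp (-(lam * (t - r))) * (b ∘ κ) r =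
      ∫ r in (0 : ℝ)..t, Real.exp (-(lam * (t - r))) * b r := fun t ht =>
    hint _ _ (fun r hr => by simp only [Function.comp_apply, hκe r hr]) t ht
  have hR2 : ∀ t ∈ Icc 0 T, ∫ r in (0 : ℝ)..t, lam * Real.exp (-(lam * (t - r))) * (Y ∘ κ) r =
      ∫ r in (0 : ℝ)..t, lam * Real.exp (-(lam * (t - r))) * Y r := fun t ht =>
    hint _ _ (fun r hr => by simp only [Function.comp_apply, hκe r hr]) t ht
  constructor
  · intro h t ht
    have := key.1 (fun s hs => by
      rw [hL s hs]; simp only [Function.comp_apply, hκe s hs]; exact h s hs) t ht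
    rw [hR1 t ht, hR2 t ht] at this
    simpa only [Function.comp_apply, hκe t ht] using this
  · intro h t ht
    have := key.2 (fun s hs => by
      rw [hR1 s hs, hR2 s hs]; simp only [Function.comp_apply, hκe s hs]; exact h s hs) t ht
    rw [hL t ht] at this
    simpa only [Function.comp_apply, hκe t ht] using this

/-! ### Smoothing estimates for the heat semigroup -/

lemma rpow_mul_exp_neg_le {x q : ℝ} (hx : 0 ≤ x) (hq0 : 0 ≤ q) (hq : q ≤ 3) :
    x ^ q * Real.exp (-x) ≤ 7 := by
  have h1 : x ^ q ≤ 7 * Real.exp x := by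
    rcases le_total x 1 with h | h
    · have := Real.rpow_le_one hx h hq0
      linarith [Real.one_le_exp hx]
    · have h2 : x ^ q ≤ x ^ 3 := by
        rw [← Real.rpow_natCast]
        exact Real.rpow_le_rpow_of_exponent_le h (by exact_mod_cast hq)
      have h3 := Real.pow_div_factorial_le_exp x hx 3
      norm_num [Nat.factorial] at h3
      linarith [Real.exp_pos x]
  rw [Real.exp_neg, ← div_eq_mul_inv, div_le_iff₀ (Real.exp_pos x)]
  exact h1

/-- The gain of `q` powers of `1 + |k|²` costs `τ^{-q}`. -/
lemma wt_rpow_mul_exp_le {T τ q : ℝ} (hτ : 0 < τ) (hτT : τ ≤ T) (hq0 : 0 ≤ q) (hq : q ≤ 3)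
    (k : Fin 2 → ℤ) :
    (1 + freqSq k) ^ q * Real.exp (-(eigenvalue k * τ)) ^ 2 ≤ 7 * Real.exp T * τ ^ (-q) := by
  have hw := wt_pos k
  have h1 : Real.exp (-(eigenvalue k * τ)) ^ 2 ≤ Real.exp T * Real.exp (-((1 + freqSq k) * τ)) := by
    rw [← Real.exp_nat_mul, ← Real.exp_add]
    refine Real.exp_le_exp.2 ?_
    have h2 : freqSq k ≤ eigenvalue k := by
      unfold eigenvalue
      have : 1 ≤ 4 * Real.pi ^ 2 := by nlinarith [Real.pi_gt_three]
      nlinarith [freqSq_nonneg k]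
    have h3 : freqSq k * τ ≤ eigenvalue k * τ := by gcongr
    have h4 : 0 ≤ eigenvalue k * τ := mul_nonneg (eigenvalue_nonneg k) hτ.le
    push_cast
    linarith
  calc (1 + freqSq k) ^ q * Real.exp (-(eigenvalue k * τ)) ^ 2
      ≤ (1 + freqSq k) ^ q * (Real.exp T * Real.exp (-((1 + freqSq k) * τ))) := by gcongr
    _ = Real.exp T * τ ^ (-q) * (((1 + freqSq k) * τ) ^ q * Real.exp (-((1 + freqSq k) * τ))) := by
        rw [Real.mul_rpow hw.le hτ.le, Real.rpow_neg hτ.le]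
        have := (Real.rpow_pos_of_pos hτ q).ne'
        field_simp
    _ ≤ Real.exp T * τ ^ (-q) * 7 := by
        gcongr
        exact rpow_mul_exp_neg_le (by positivity) hq0 hq
    _ = 7 * Real.exp T * τ ^ (-q) := by ring

lemma sobSq_le_of_le {s s₁ s₂ A B : ℝ} {c c₁ c₂ : (Fin 2 → ℤ) → ℂ} (hA : 0 ≤ A) (hB : 0 ≤ B)
    (h : ∀ k, (1 + freqSq k) ^ s * ‖c k‖ ^ 2 ≤ A * ((1 + freqSq k) ^ s₁ * ‖c₁ k‖ ^ 2) +
      B * ((1 + freqSq k) ^ s₂ * ‖c₂ k‖ ^ 2)) :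
    sobSq s c ≤ ENNReal.ofReal A * sobSq s₁ c₁ + ENNReal.ofReal B * sobSq s₂ c₂ := by
  unfold sobSq
  rw [← ENNReal.tsum_mul_left, ← ENNReal.tsum_mul_left, ← ENNReal.tsum_add]
  refine ENNReal.tsum_le_tsum fun k => ?_
  have e : ∀ (s : ℝ) (c : (Fin 2 → ℤ) → ℂ), ENNReal.ofReal ((1 + freqSq k) ^ s) * ‖c k‖ₑ ^ 2 =
      ENNReal.ofReal ((1 + freqSq k) ^ s * ‖c k‖ ^ 2) := fun s c => by
    rw [ENNReal.ofReal_mul (wt_rpow_pos k s).le, ENNReal.ofReal_pow (norm_nonneg _), ofReal_norm]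
  have h0 : ∀ (s : ℝ) (c : (Fin 2 → ℤ) → ℂ), 0 ≤ (1 + freqSq k) ^ s * ‖c k‖ ^ 2 := fun s c =>
    mul_nonneg (wt_rpow_pos k s).le (sq_nonneg _)
  rw [e, e, e, ← ENNReal.ofReal_mul hA, ← ENNReal.ofReal_mul hB,
    ← ENNReal.ofReal_add (mul_nonneg hA (h0 _ _)) (mul_nonneg hB (h0 _ _))]
  exact ENNReal.ofReal_le_ofReal (h k)

lemma norm_add_sq_le_two (x y : ℂ) : ‖x + y‖ ^ 2 ≤ 2 * ‖x‖ ^ 2 + 2 * ‖y‖ ^ 2 := by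
  have h := norm_add_le x y
  have h2 : ‖x + y‖ ^ 2 ≤ (‖x‖ + ‖y‖) ^ 2 := pow_le_pow_left₀ (norm_nonneg _) h 2
  nlinarith [sq_nonneg (‖x‖ - ‖y‖)]

/-- The heat semigroup regularises by half a unit: `‖S_τ f‖_{𝓑_α} ≲ τ^{-1/2} ‖f‖_{𝓑_{α-1/2}}`. -/
lemma sobSq_heat_le {T τ α : ℝ} (hτ : 0 < τ) (hτT : τ ≤ T) (c : (Fin 2 → ℤ) → ℂ) :
    sobSq (2 * α) (fun k => (Real.exp (-(eigenvalue k * τ)) : ℂ) * c k) ≤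
      ENNReal.ofReal (7 * Real.exp T * τ ^ (-1 : ℝ)) * sobSq (2 * α - 1) c := by
  have := sobSq_le_of_le (s := 2 * α) (s₁ := 2 * α - 1) (s₂ := 0) (A := 7 * Real.exp T * τ ^ (-1 : ℝ))
    (B := 0) (c := fun k => (Real.exp (-(eigenvalue k * τ)) : ℂ) * c k) (c₁ := c) (c₂ := 0)
    (by positivity) le_rfl fun k => ?_
  · simpa using this
  · have h := wt_rpow_mul_exp_le hτ hτT zero_le_one (by norm_num) k
    rw [Real.rpow_one] at h
    rw [zero_mul, add_zero, norm_mul, mul_pow, Complex.norm_real, Real.norm_eq_abs,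
      abs_of_pos (Real.exp_pos _)]
    have h2 := wt_rpow_pos k (2 * α - 1)
    calc (1 + freqSq k) ^ (2 * α) * (Real.exp (-(eigenvalue k * τ)) ^ 2 * ‖c k‖ ^ 2)
        = ((1 + freqSq k) * Real.exp (-(eigenvalue k * τ)) ^ 2) *
          ((1 + freqSq k) ^ (2 * α - 1) * ‖c k‖ ^ 2) := by
          rw [Real.rpow_sub_one (wt_pos k).ne']
          have := (wt_pos k).ne'
          field_simp
      _ ≤ _ := by gcongr

/-- Time regularity of `r ↦ S_{t-r} a_r`, where `a` is bounded in `𝓑_{α-1/2}` and `γ`-Hölder in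
`𝓑_{α-1/2-γ}`. The bound is stated for `τ = t - m` and `d = m - s`. -/
lemma sobSq_heat_sub_le {T τ d α γ : ℝ} (hτ : 0 < τ) (hτT : τ ≤ T) (hd : 0 ≤ d) (hγ0 : 0 ≤ γ)
    (hγ : γ ≤ 1) (a b : (Fin 2 → ℤ) → ℂ) :
    sobSq (2 * α) (fun k => (Real.exp (-(eigenvalue k * (τ + d))) : ℂ) * a k -
        (Real.exp (-(eigenvalue k * τ)) : ℂ) * b k) ≤
      ENNReal.ofReal (2 * (4 * Real.pi ^ 2) ^ (2 * γ) * (7 * Real.exp T) * τ ^ (-(1 + 2 * γ)) *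
        d ^ (2 * γ)) * sobSq (2 * α - 1) a +
      ENNReal.ofReal (2 * (7 * Real.exp T) * τ ^ (-(1 + 2 * γ))) *
        sobSq (2 * α - 1 - 2 * γ) (fun k => a k - b k) := by
  refine sobSq_le_of_le (by positivity) (by positivity) fun k => ?_
  set E := Real.exp (-(eigenvalue k * τ)) with hE
  set D := Real.exp (-(eigenvalue k * d)) with hD
  have hsplit : (Real.exp (-(eigenvalue k * (τ + d))) : ℂ) * a k - (E : ℂ) * b k =
      (E : ℂ) * (((D - 1 : ℝ) : ℂ) * a k + (a k - b k)) := by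
    rw [mul_add, neg_add, Real.exp_add, ← hE, ← hD]
    push_cast; ring
  have hEpos : 0 < E := Real.exp_pos _
  have hw := wt_pos k
  have hL := eigenvalue_nonneg k
  have hLd : 0 ≤ eigenvalue k * d := mul_nonneg hL hd
  have hD1 : (D - 1) ^ 2 ≤ (4 * Real.pi ^ 2) ^ (2 * γ) * (1 + freqSq k) ^ (2 * γ) * d ^ (2 * γ) := by
    have h1 : |D - 1| ≤ (eigenvalue k * d) ^ γ := by
      have hDle : D ≤ 1 := Real.exp_le_one_iff.2 (by linarith)
      have hDge : 1 - eigenvalue k * d ≤ D := by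
        have := Real.add_one_le_exp (-(eigenvalue k * d)); linarith
      have hDpos : 0 < D := Real.exp_pos _
      rw [abs_sub_comm, abs_of_nonneg (by linarith)]
      rcases le_total (eigenvalue k * d) 1 with h | h
      · calc 1 - D ≤ (eigenvalue k * d) ^ (1 : ℝ) := by rw [Real.rpow_one]; linarith
          _ ≤ (eigenvalue k * d) ^ γ := by
            rcases hLd.eq_or_lt with h0 | h0
            · rw [← h0, Real.rpow_one]; positivity
            · exact Real.rpow_le_rpow_of_exponent_ge h0 h hγ
      · have := Real.one_le_rpow h hγ0
        linarith
    have h2 : (eigenvalue k * d) ^ γ ≤ ((4 * Real.pi ^ 2 * (1 + freqSq k)) * d) ^ γ := by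
      refine Real.rpow_le_rpow hLd ?_ hγ0
      unfold eigenvalue
      gcongr
      linarith
    have h3 : ∀ x : ℝ, 0 ≤ x → x ^ (2 * γ) = (x ^ γ) ^ 2 := fun x hx => by
      rw [mul_comm, Real.rpow_mul hx, Real.rpow_two]
    rw [← sq_abs, ← Real.mul_rpow (by positivity) hw.le, ← Real.mul_rpow (by positivity) hd,
      h3 _ (by positivity)]
    exact pow_le_pow_left₀ (abs_nonneg _) (h1.trans h2) 2
  have hsm := wt_rpow_mul_exp_le (q := 1 + 2 * γ) hτ hτT (by linarith) (by linarith) k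
  rw [← hE] at hsm
  rw [hsplit, norm_mul, mul_pow, Complex.norm_real, Real.norm_eq_abs, abs_of_pos hEpos]
  have h4 := norm_add_sq_le_two (((D - 1 : ℝ) : ℂ) * a k) (a k - b k)
  rw [norm_mul, mul_pow, Complex.norm_real, Real.norm_eq_abs, sq_abs] at h4
  have e1 : (1 + freqSq k) ^ (2 * α) = (1 + freqSq k) ^ (1 + 2 * γ) *
      (1 + freqSq k) ^ (2 * α - 1 - 2 * γ) := by
    rw [← Real.rpow_add hw]; congr 1; ring
  have e2 : (1 + freqSq k) ^ (2 * α - 1) = (1 + freqSq k) ^ (2 * γ) *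
      (1 + freqSq k) ^ (2 * α - 1 - 2 * γ) := by
    rw [← Real.rpow_add hw]; congr 1; ring
  set V := (1 + freqSq k) ^ (2 * α - 1 - 2 * γ) with hV
  have hV0 : 0 < V := wt_rpow_pos k _
  have hG0 := wt_rpow_pos k (2 * γ)
  calc (1 + freqSq k) ^ (2 * α) * (E ^ 2 * ‖((D - 1 : ℝ) : ℂ) * a k + (a k - b k)‖ ^ 2)
      = ((1 + freqSq k) ^ (1 + 2 * γ) * E ^ 2) *
        (V * ‖((D - 1 : ℝ) : ℂ) * a k + (a k - b k)‖ ^ 2) := by rw [e1]; ring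
    _ ≤ (7 * Real.exp T * τ ^ (-(1 + 2 * γ))) *
        (V * (2 * (((4 * Real.pi ^ 2) ^ (2 * γ) * (1 + freqSq k) ^ (2 * γ) * d ^ (2 * γ)) *
          ‖a k‖ ^ 2) + 2 * ‖a k - b k‖ ^ 2)) := by
        refine mul_le_mul hsm ?_ (by positivity) (by positivity)
        refine mul_le_mul_of_nonneg_left (h4.trans ?_) hV0.le
        have := mul_le_mul_of_nonneg_right hD1 (sq_nonneg ‖a k‖)
        linarith
    _ = _ := by rw [e2]; ring

/-! ### The singular control -/

lemma one_sub_rpow_ge {β z : ℝ} (hβ0 : 0 ≤ β) (hβ1 : β ≤ 1) (hz : z ≤ 1) :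
    β * z ≤ 1 - (1 - z) ^ β := by
  have := rpow_one_add_le_one_add_mul_self (s := -z) (by linarith) hβ0 hβ1
  rw [← sub_eq_add_neg] at this
  linarith

lemma rpow_one_add_sub_ge {β y : ℝ} (hβ0 : 0 ≤ β) (hβ1 : β ≤ 1) (hy : 0 ≤ y) :
    β / 2 * min 1 y ≤ (1 + y) ^ β - 1 := by
  have hy1 : 0 < 1 + y := by linarith
  have h1 := one_sub_rpow_ge (z := y / (1 + y)) hβ0 hβ1 (by rw [div_le_one hy1]; linarith)
  have h2 : 1 - y / (1 + y) = (1 + y)⁻¹ := by field_simp; ring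
  rw [h2, Real.inv_rpow hy1.le] at h1
  have h3 : 1 ≤ (1 + y) ^ β := Real.one_le_rpow (by linarith) hβ0
  have h4 : min 1 y / 2 ≤ y / (1 + y) := by
    rw [div_le_div_iff₀ two_pos hy1]
    rcases le_total 1 y with h | h
    · rw [min_eq_left h]; linarith
    · rw [min_eq_right h]; nlinarith
  have h5 : 0 < (1 + y) ^ β := by linarith
  have h6 : β * (y / (1 + y)) * (1 + y) ^ β ≤ (1 + y) ^ β - 1 := by
    have := mul_le_mul_of_nonneg_right h1 h5.le
    rwa [sub_mul, one_mul, inv_mul_cancel₀ h5.ne'] at this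
  have h7 : 0 ≤ β * (y / (1 + y)) := by positivity
  nlinarith

/-- The control `∫ₛᵛ (t-r)^{β-1} dr`, with `2γβ = γ - 1/2`, dominates the singular product of
increments. -/
lemma singular_control {s m v t γ β : ℝ} (hγ : 1 / 2 < γ) (hβ0 : 0 < β) (hβ1 : β ≤ 1)
    (hβ : 2 * γ * β = γ - 1 / 2) (hsm : s ≤ m) (hmv : m ≤ v) (hvt : v ≤ t) (hmt : m < t) :
    (t - m) ^ (-(1 / 2) : ℝ) * min 1 ((m - s) / (t - m)) ^ γ * (v - m) ^ γ ≤
      (β / 2) ^ (-(2 * γ)) * ((t - s) ^ β - (t - v) ^ β) ^ (2 * γ) := by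
  set τ := t - m with hτ
  have hτ0 : 0 < τ := by linarith
  have hγ0 : 0 < γ := by linarith
  set y := (m - s) / τ with hy
  set z := (v - m) / τ with hz
  have hy0 : 0 ≤ y := div_nonneg (by linarith) hτ0.le
  have hz0 : 0 ≤ z := div_nonneg (by linarith) hτ0.le
  have hz1 : z ≤ 1 := by rw [hz, div_le_one hτ0]; linarith
  set p := min 1 y with hp
  have hp0 : 0 ≤ p := le_min zero_le_one hy0
  have e1 : (t - s) ^ β = τ ^ β * (1 + y) ^ β := by
    rw [← Real.mul_rpow hτ0.le (by linarith)]
    congr 1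
    rw [hy]; field_simp; ring
  have e2 : (t - v) ^ β = τ ^ β * (1 - z) ^ β := by
    rw [← Real.mul_rpow hτ0.le (by linarith)]
    congr 1
    rw [hz]; field_simp; ring
  have h1 := rpow_one_add_sub_ge hβ0.le hβ1 hy0
  have h2 := one_sub_rpow_ge hβ0.le hβ1 hz1
  have hτβ : 0 < τ ^ β := Real.rpow_pos_of_pos hτ0 _
  have h3 : τ ^ β * (β / 2 * (p + z)) ≤ (t - s) ^ β - (t - v) ^ β := by
    rw [e1, e2, ← mul_sub]
    refine mul_le_mul_of_nonneg_left ?_ hτβ.le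
    nlinarith
  have h4 : p ^ γ * z ^ γ ≤ (p + z) ^ (2 * γ) := by
    rw [Real.rpow_mul (by positivity), Real.rpow_two, ← Real.mul_rpow hp0 hz0]
    refine Real.rpow_le_rpow (by positivity) ?_ hγ0.le
    nlinarith
  have e3 : (v - m) ^ γ = τ ^ γ * z ^ γ := by
    rw [← Real.mul_rpow hτ0.le hz0]
    congr 1
    rw [hz]; field_simp
  have e4 : τ ^ (-(1 / 2) : ℝ) * τ ^ γ = (τ ^ β) ^ (2 * γ) := by
    rw [← Real.rpow_add hτ0, ← Real.rpow_mul hτ0.le]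
    congr 1; linarith
  calc τ ^ (-(1 / 2) : ℝ) * p ^ γ * (v - m) ^ γ = (τ ^ β) ^ (2 * γ) * (p ^ γ * z ^ γ) := by
        rw [e3, ← e4]; ring
    _ ≤ (τ ^ β) ^ (2 * γ) * (p + z) ^ (2 * γ) := by gcongr
    _ = (β / 2) ^ (-(2 * γ)) * (τ ^ β * (β / 2 * (p + z))) ^ (2 * γ) := by
        rw [Real.mul_rpow hτβ.le (by positivity), Real.mul_rpow (by positivity) (by positivity),
          Real.rpow_neg (by positivity)]
        have : ((β / 2) ^ (2 * γ)) ≠ 0 := (Real.rpow_pos_of_pos (by positivity) _).ne'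
        field_simp
    _ ≤ _ := by
        refine mul_le_mul_of_nonneg_left ?_ (by positivity)
        exact Real.rpow_le_rpow (by positivity) h3 (by linarith)

/-! ### The space of coefficients as a Hilbert space -/

/-- The weighted sequence `k ↦ (1 + |k|²)^{s/2} c k`. -/
noncomputable def weighted (s : ℝ) (c : (Fin 2 → ℤ) → ℂ) (k : Fin 2 → ℤ) : ℂ :=
  ((1 + freqSq k) ^ (s / 2) : ℝ) * c k

lemma ofReal_norm_weighted_sq (s : ℝ) (c : (Fin 2 → ℤ) → ℂ) (k : Fin 2 → ℤ) :
    ENNReal.ofReal (‖weighted s c k‖ ^ 2) = ENNReal.ofReal ((1 + freqSq k) ^ s) * ‖c k‖ₑ ^ 2 := by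
  rw [weighted, norm_mul, mul_pow, Complex.norm_real, Real.norm_eq_abs, sq_abs, ← Real.rpow_natCast,
    ← Real.rpow_mul (wt_pos k).le, ENNReal.ofReal_mul (wt_rpow_pos k _).le,
    ENNReal.ofReal_pow (norm_nonneg _), ofReal_norm]
  norm_num

lemma memlp_weighted {s : ℝ} {c : (Fin 2 → ℤ) → ℂ} (h : sobSq s c < ⊤) :
    Memℓp (weighted s c) 2 := by
  rw [memℓp_gen_iff (by norm_num)]
  have h1 : sobSq s c = ∑' k, ENNReal.ofReal (‖weighted s c k‖ ^ 2) :=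
    tsum_congr fun k => (ofReal_norm_weighted_sq s c k).symm
  rw [h1] at h
  have := ENNReal.summable_toReal h.ne
  simpa [ENNReal.toReal_ofReal, sq_nonneg] using this

open Classical in
/-- The isometric embedding of the sequences of finite `H^s` norm into `ℓ²`, extended by zero. -/
noncomputable def toLp (s : ℝ) (c : (Fin 2 → ℤ) → ℂ) : lp (fun _ : Fin 2 → ℤ => ℂ) 2 :=
  if h : sobSq s c < ⊤ then ⟨weighted s c, memlp_weighted h⟩ else 0

lemma toLp_apply {s : ℝ} {c : (Fin 2 → ℤ) → ℂ} (h : sobSq s c < ⊤) (k : Fin 2 → ℤ) :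
    toLp s c k = weighted s c k := by
  rw [toLp, dif_pos h]

lemma sobSq_eq_of_weighted {s : ℝ} {c : (Fin 2 → ℤ) → ℂ} {v : lp (fun _ : Fin 2 → ℤ => ℂ) 2}
    (h : ∀ k, v k = weighted s c k) : sobSq s c = ENNReal.ofReal (‖v‖ ^ 2) := by
  have h1 := lp.hasSum_norm (p := 2) (by norm_num) v
  norm_num at h1
  rw [← h1.tsum_eq, ENNReal.ofReal_tsum_of_nonneg (fun k => sq_nonneg _) h1.summable]
  exact tsum_congr fun k => by rw [h, ofReal_norm_weighted_sq]

/-! ### Existence of the stochastic convolution -/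

lemma sobSq_neg (s : ℝ) (c : (Fin 2 → ℤ) → ℂ) : sobSq s (-c) = sobSq s c := by
  simp [sobSq]

/-- The coefficients of `S_τ f`, where `f` has the coefficients `c`. -/
noncomputable def heatCoeff (τ : ℝ) (c : (Fin 2 → ℤ) → ℂ) (k : Fin 2 → ℤ) : ℂ :=
  (Real.exp (-(eigenvalue k * τ)) : ℂ) * c k

/-- The increments of `r ↦ S_{t-r} a_r` between times `t - τ - d` and `t - τ`, for all ratios
`d / τ`. -/
lemma exists_sobSq_heatCoeff_sub_le {T α γ : ℝ} (hγ0 : 0 ≤ γ) (hγ : γ ≤ 1) (M : ℝ≥0) :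
    ∃ K : ℝ, 0 ≤ K ∧ ∀ (τ d : ℝ) (a b : (Fin 2 → ℤ) → ℂ), 0 < τ → 0 ≤ d → τ + d ≤ T →
      sobSq (2 * α - 1) a ≤ M → sobSq (2 * α - 1) b ≤ M →
      sobSq (2 * α - 1 - 2 * γ) (fun k => a k - b k) ≤ M * ENNReal.ofReal (d ^ (2 * γ)) →
      sobSq (2 * α) (fun k => heatCoeff (τ + d) a k - heatCoeff τ b k) ≤
        ENNReal.ofReal (K * (τ ^ (-1 : ℝ) * min 1 (d / τ) ^ (2 * γ))) := by
  set c₀ := 7 * Real.exp T with hc₀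
  set c₁ := 2 * (4 * Real.pi ^ 2) ^ (2 * γ) * c₀ with hc₁
  have hc₀' : 0 ≤ c₀ := by positivity
  have hc₁' : 0 ≤ c₁ := by positivity
  refine ⟨(c₁ + 2 * c₀) * M + 8 * c₀ * M, by positivity, fun τ d a b hτ hd hT ha hb hab => ?_⟩
  have hM : (M : ℝ≥0∞) = ENNReal.ofReal M := by simp
  rw [hM] at ha hb hab
  -- For `d ≤ τ` the time regularity is used; otherwise each of the two terms is small enough.
  rcases le_or_gt d τ with h | h
  · rw [min_eq_right ((div_le_one hτ).2 h)]
    have e : τ ^ (-(1 + 2 * γ)) * d ^ (2 * γ) = τ ^ (-1 : ℝ) * (d / τ) ^ (2 * γ) := by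
      rw [Real.div_rpow hd hτ.le, neg_add, Real.rpow_add hτ, Real.rpow_neg hτ.le (2 * γ)]
      ring
    refine (sobSq_heat_sub_le hτ (show τ ≤ T by linarith) hd hγ0 hγ a b).trans ?_
    refine (add_le_add (mul_le_mul_right ha _) (mul_le_mul_right hab _)).trans ?_
    rw [← ENNReal.ofReal_mul (by positivity), ← ENNReal.ofReal_mul (by positivity),
      ← ENNReal.ofReal_mul (by positivity), ← ENNReal.ofReal_add (by positivity) (by positivity)]
    refine ENNReal.ofReal_le_ofReal ?_
    have h0 : 0 ≤ 8 * c₀ * M * (τ ^ (-1 : ℝ) * (d / τ) ^ (2 * γ)) := by positivity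
    rw [← e] at h0 ⊢
    rw [← hc₀, ← hc₁]
    linarith
  · have h1 : min 1 (d / τ) = 1 := min_eq_left ((one_le_div hτ).2 h.le)
    rw [h1, Real.one_rpow, mul_one]
    have hsub : (fun k => heatCoeff (τ + d) a k - heatCoeff τ b k) =
        heatCoeff (τ + d) a + -heatCoeff τ b := by ext k; simp [sub_eq_add_neg]
    rw [hsub]
    have e1 : sobSq (2 * α) (heatCoeff (τ + d) a) ≤ ENNReal.ofReal (c₀ * τ ^ (-1 : ℝ) * M) := by
      refine (sobSq_heat_le (by linarith) hT a).trans ((mul_le_mul_right ha _).trans ?_)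
      rw [← ENNReal.ofReal_mul (by positivity)]
      refine ENNReal.ofReal_le_ofReal ?_
      have : (τ + d) ^ (-1 : ℝ) ≤ τ ^ (-1 : ℝ) :=
        Real.rpow_le_rpow_of_nonpos hτ (by linarith) (by norm_num)
      gcongr
    have e2 : sobSq (2 * α) (heatCoeff τ b) ≤ ENNReal.ofReal (c₀ * τ ^ (-1 : ℝ) * M) := by
      refine (sobSq_heat_le hτ (show τ ≤ T by linarith) b).trans ((mul_le_mul_right hb _).trans ?_)
      rw [← ENNReal.ofReal_mul (by positivity)]
    refine (sobSq_add_le _ _ _).trans ?_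
    rw [sobSq_neg]
    refine (add_le_add (mul_le_mul_right e1 _) (mul_le_mul_right e2 _)).trans ?_
    have h4 : (4 : ℝ≥0∞) = ENNReal.ofReal 4 := by norm_num
    rw [h4, ← ENNReal.ofReal_mul (by norm_num), ← ENNReal.ofReal_add (by positivity) (by positivity)]
    refine ENNReal.ofReal_le_ofReal ?_
    have h0 : 0 ≤ (c₁ + 2 * c₀) * M * τ ^ (-1 : ℝ) := by positivity
    linarith

open Classical in
/-- The path `r ↦ S_{t-r} a_r` in `𝓑_α`, with the value at `r = t` replaced by zero. -/
noncomputable def convPath (α t : ℝ) (a : ℝ → (Fin 2 → ℤ) → ℂ) (r : ℝ) :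
    lp (fun _ : Fin 2 → ℤ => ℂ) 2 :=
  if r < t then toLp (2 * α) (heatCoeff (t - r) (a r)) else 0

lemma sobSq_heatCoeff_lt_top {α τ : ℝ} (hτ : 0 < τ) {a : (Fin 2 → ℤ) → ℂ}
    (ha : sobSq (2 * α - 1) a < ⊤) : sobSq (2 * α) (heatCoeff τ a) < ⊤ :=
  (sobSq_heat_le hτ le_rfl a).trans_lt (ENNReal.mul_lt_top ENNReal.ofReal_lt_top ha)

/-- The integrand of the stochastic convolution is singular at the endpoint `t`; Young's condition
still holds, with the control `r ↦ -(t - r)^β`. -/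
lemma exists_youngControl_convPath {T α γ B t : ℝ} (hγ : 1 / 2 < γ) (hγ1 : γ ≤ 1) {M : ℝ≥0}
    {a : ℝ → (Fin 2 → ℤ) → ℂ} {g : ℝ → ℝ} (hB : 0 ≤ B) (htT : t ≤ T)
    (ha : ∀ r ∈ Icc 0 T, sobSq (2 * α - 1) (a r) ≤ M)
    (hab : ∀ r ∈ Icc 0 T, ∀ s ∈ Icc 0 T, sobSq (2 * α - 1 - 2 * γ) (fun k => a r k - a s k) ≤
      M * ENNReal.ofReal (|r - s| ^ (2 * γ)))
    (hg : ∀ r ∈ Icc 0 T, ∀ s ∈ Icc 0 T, |g r - g s| ≤ B * |r - s| ^ γ) :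
    ∃ C β : ℝ, 0 < β ∧
      YoungControl (convPath α t a) g (fun r => -(t - r) ^ β) C (2 * γ) t := by
  obtain ⟨K, hK, hKle⟩ := exists_sobSq_heatCoeff_sub_le (T := T) (α := α) (by linarith) hγ1 M
  -- `β` makes the exponents match: `2γβ - γ = -1/2`, the order of the singularity at `t`.
  set β := (γ - 1 / 2) / (2 * γ) with hβdef
  have hβ0 : 0 < β := div_pos (by linarith) (by linarith)
  have hβ1 : β ≤ 1 := by rw [hβdef, div_le_one (by linarith)]; linarith
  have hβ : 2 * γ * β = γ - 1 / 2 := by rw [hβdef]; field_simp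
  refine ⟨√K * B * (β / 2) ^ (-(2 * γ)), β, hβ0, ⟨fun r hr s hs hrs => ?_, by linarith,
    by positivity, fun s m v hs hsm hmv hvt => ?_⟩⟩
  · exact neg_le_neg (Real.rpow_le_rpow (by linarith [hs.2]) (by linarith) hβ0.le)
  have hΦ : 0 ≤ -(t - v) ^ β - -(t - s) ^ β := by
    have : (t - v) ^ β ≤ (t - s) ^ β := Real.rpow_le_rpow (by linarith) (by linarith) hβ0.le
    linarith
  -- At `m = t` the product vanishes because `v = m`, so the value of the path there is irrelevant.
  rcases (hmv.trans hvt).eq_or_lt with hm | hm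
  · have hvm : v = m := by linarith
    rw [hvm, sub_self, abs_zero, mul_zero, ← hvm]
    exact mul_nonneg (by positivity) (Real.rpow_nonneg hΦ _)
  have hst : s < t := by linarith
  have hsT : s ∈ Icc 0 T := ⟨hs, by linarith⟩
  have hmT : m ∈ Icc 0 T := ⟨by linarith, by linarith⟩
  have hvT : v ∈ Icc 0 T := ⟨by linarith, by linarith⟩
  have hfin : ∀ r ∈ Icc 0 T, r < t → sobSq (2 * α) (heatCoeff (t - r) (a r)) < ⊤ := fun r hr hrt =>
    sobSq_heatCoeff_lt_top (by linarith) ((ha r hr).trans_lt ENNReal.coe_lt_top)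
  have hτ : 0 < t - m := by linarith
  have h1 := hKle (t - m) (m - s) (a s) (a m) hτ (by linarith) (by linarith) (ha s hsT) (ha m hmT)
    (by have := hab s hsT m hmT
        rwa [abs_sub_comm, abs_of_nonneg (by linarith)] at this)
  rw [sub_add_sub_cancel, sobSq_eq_of_weighted (v := convPath α t a s - convPath α t a m)
    fun k => by
      rw [lp.coeFn_sub, Pi.sub_apply, convPath, if_pos hst, convPath, if_pos hm,
        toLp_apply (hfin s hsT hst), toLp_apply (hfin m hmT hm), weighted, weighted, weighted]
      ring] at h1
  rw [ENNReal.ofReal_le_ofReal_iff (by positivity)] at h1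
  set q := min 1 ((m - s) / (t - m)) with hq
  have hq0 : 0 ≤ q := le_min zero_le_one (div_nonneg (by linarith) hτ.le)
  have h2 : ‖convPath α t a m - convPath α t a s‖ ≤ √K * ((t - m) ^ (-(1 / 2) : ℝ) * q ^ γ) := by
    rw [norm_sub_rev]
    refine le_of_sq_le_sq ?_ (by positivity)
    refine h1.trans (le_of_eq ?_)
    rw [mul_pow, mul_pow, Real.sq_sqrt hK, ← Real.rpow_natCast, ← Real.rpow_natCast,
      ← Real.rpow_mul hτ.le, ← Real.rpow_mul hq0, mul_comm γ]
    norm_num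
  have h3 := hg v hvT m hmT
  rw [abs_of_nonneg (by linarith : 0 ≤ v - m)] at h3
  have h4 := singular_control hγ hβ0 hβ1 hβ hsm hmv hvt hm
  calc ‖convPath α t a m - convPath α t a s‖ * |g v - g m|
      ≤ (√K * ((t - m) ^ (-(1 / 2) : ℝ) * q ^ γ)) * (B * (v - m) ^ γ) := by gcongr
    _ = √K * B * ((t - m) ^ (-(1 / 2) : ℝ) * q ^ γ * (v - m) ^ γ) := by ring
    _ ≤ √K * B * ((β / 2) ^ (-(2 * γ)) * ((t - s) ^ β - (t - v) ^ β) ^ (2 * γ)) := by gcongr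
    _ = _ := by
      rw [show -(t - v) ^ β - -(t - s) ^ β = (t - s) ^ β - (t - v) ^ β by ring]; ring

lemma HasYoungIntegral.clm_apply {E G : Type*} [NormedAddCommGroup E] [NormedSpace ℝ E]
    [NormedAddCommGroup G] [NormedSpace ℝ G] (L : E →L[ℝ] G) {F : ℝ → E} {g : ℝ → ℝ} {t : ℝ}
    {I : E} (hF : HasYoungIntegral (enorm : E → ℝ≥0∞) F g t I) :
    HasYoungIntegral (enorm : G → ℝ≥0∞) (fun r => L (F r)) g t (L I) := by
  refine hasYoungIntegral_of_norm_lt fun ε hε => ?_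
  obtain ⟨δ, hδ, h1⟩ := hF.exists_norm_lt (show 0 < ε / (‖L‖ + 1) by positivity)
  refine ⟨δ, hδ, fun n p hp hp0 hpn hm => ?_⟩
  have e : rsSum (fun r => L (F r)) g p 0 n - L I = L (rsSum F g p 0 n - I) := by
    simp [rsSum, map_sum, map_sub, map_smul]
  rw [e]
  calc ‖L (rsSum F g p 0 n - I)‖ ≤ ‖L‖ * ‖rsSum F g p 0 n - I‖ := L.le_opNorm _
    _ ≤ (‖L‖ + 1) * ‖rsSum F g p 0 n - I‖ := by gcongr; linarith
    _ < ε := by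
      have := h1 n p hp hp0 hpn hm
      rwa [lt_div_iff₀ (by positivity), mul_comm] at this

lemma continuous_sum {ι : Type*} {S : Finset ι} {f : ι → Torus → ℝ}
    (hf : ∀ i ∈ S, Continuous (f i)) : Continuous (∑ i ∈ S, f i) :=
  Finset.sum_induction _ Continuous (fun _ _ => Continuous.add) continuous_zero hf

lemma MemC.transport_regularity {T α : ℝ} (hα : 1 < α) {y : ℝ → Torus → ℝ} (hy : MemC T α y)
    {ξ : Torus → Fin 2 → ℝ} (hξ : ∀ i, Smooth fun x => ξ x i) {r : ℝ} (hr : r ∈ Icc 0 T) :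
    Continuous (transport ξ (y r)) ∧ Summable fun k => ‖coeff (transport ξ (y r)) k‖ :=
  ⟨continuous_transport (fun i => (hξ i).continuous) ((hy.1 r hr).wiener hα).isC1,
    summable_coeff_transport (fun i => (hξ i).wiener 0) ((hy.1 r hr).wiener hα)⟩

/-- Along a path in `V^T`, the noise coefficient `ξ · ∇y` is bounded in `H^{2α-1}` and `γ`-Hölder in
`H^{2α-1-2γ}`. -/
lemma MemV.exists_transport_bound {T α γ : ℝ} (hα : 1 < α) {y : ℝ → Torus → ℝ}
    (hy : MemV T α γ y) {ξ : Torus → Fin 2 → ℝ} (hξ : ∀ i, Smooth fun x => ξ x i) :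
    ∃ M : ℝ≥0, (∀ r ∈ Icc 0 T, sobSq (2 * α - 1) (coeff (transport ξ (y r))) ≤ M) ∧
      ∀ r ∈ Icc 0 T, ∀ s ∈ Icc 0 T, sobSq (2 * α - 1 - 2 * γ)
        (fun k => coeff (transport ξ (y r)) k - coeff (transport ξ (y s)) k) ≤
          M * ENNReal.ofReal (|r - s| ^ (2 * γ)) := by
  obtain ⟨C₁, hC₁⟩ := exists_sobSq_transport_le hξ (2 * α)
  obtain ⟨C₂, hC₂⟩ := exists_sobSq_transport_le hξ (2 * (α - γ))
  obtain ⟨N, hN⟩ := hy.1.exists_bound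
  obtain ⟨L, hL⟩ := hy.2
  have hC1 : ∀ r ∈ Icc 0 T, IsC1 (y r) := fun r hr => ((hy.1.1 r hr).wiener hα).isC1
  refine ⟨max (C₁ * N ^ 2) (C₂ * L ^ 2), fun r hr => ?_, fun r hr s hs => ?_⟩
  · refine (hC₁ _ (hC1 r hr)).trans ?_
    rw [sobSq_eq]
    calc C₁ * sobolevNorm (2 * α) (y r) ^ 2 ≤ C₁ * (N : ℝ≥0∞) ^ 2 := by gcongr; exact hN r hr
      _ ≤ _ := by exact_mod_cast le_max_left _ _
  · have e : (fun k => coeff (transport ξ (y r)) k - coeff (transport ξ (y s)) k) =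
        coeff (transport ξ (y r - y s)) := by
      ext k
      rw [transport_sub ξ (hC1 r hr) (hC1 s hs),
        coeff_sub (hy.1.transport_regularity hα hξ hr).1 (hy.1.transport_regularity hα hξ hs).1]
    rw [e, show 2 * α - 1 - 2 * γ = 2 * (α - γ) - 1 by ring]
    refine (hC₂ _ ((hC1 r hr).sub (hC1 s hs)).1).trans ?_
    rw [sobSq_eq, mul_comm 2 γ, Real.rpow_mul (abs_nonneg _), Real.rpow_two,
      ENNReal.ofReal_pow (Real.rpow_nonneg (abs_nonneg _) _)]
    calc C₂ * sobolevNorm (2 * (α - γ)) (y r - y s) ^ 2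
        ≤ C₂ * (L * ENNReal.ofReal (|r - s| ^ γ)) ^ 2 := by gcongr; exact hL s hs r hr
      _ = (C₂ * L ^ 2 : ℝ≥0) * ENNReal.ofReal (|r - s| ^ γ) ^ 2 := by push_cast; ring
      _ ≤ _ := by gcongr; exact le_max_right _ _

/-- The stochastic convolution `∫₀ᵗ S_{t-r}(ξ·∇y_r) dg_r` exists in `𝓑_α`. -/
theorem MemV.exists_convolution {T α γ B : ℝ} (hα : 1 < α) (hγ : 1 / 2 < γ) (hγ1 : γ ≤ 1)
    {y : ℝ → Torus → ℝ} (hy : MemV T α γ y) {ξ : Torus → Fin 2 → ℝ}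
    (hξ : ∀ i, Smooth fun x => ξ x i) {g : ℝ → ℝ} (hB : 0 ≤ B)
    (hg : ∀ r ∈ Icc 0 T, ∀ s ∈ Icc 0 T, |g r - g s| ≤ B * |r - s| ^ γ) {t : ℝ}
    (ht : t ∈ Icc 0 T) :
    ∃ J, MemB α J ∧ HasYoungIntegral (normB α) (fun r => heat (t - r) (transport ξ (y r))) g t J := by
  obtain ⟨M, hM, hM'⟩ := hy.exists_transport_bound hα hξ
  set a : ℝ → (Fin 2 → ℤ) → ℂ := fun r => coeff (transport ξ (y r)) with ha
  obtain ⟨C, β, hβ, hctrl⟩ := exists_youngControl_convPath (t := t) hγ hγ1 hB ht.2 hM hM' hg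
  obtain ⟨Jv, hJv⟩ := hctrl.exists_integral ht.1
    (((continuous_const.sub continuous_id).rpow_const fun _ => Or.inr hβ.le).neg.continuousOn)
  have happ : ∀ r ∈ Icc 0 T, r < t → ∀ k, convPath α t a r k =
      weighted (2 * α) (heatCoeff (t - r) (a r)) k := fun r hr hrt k => by
    rw [convPath, if_pos hrt, toLp_apply (sobSq_heatCoeff_lt_top (by linarith)
      ((hM r hr).trans_lt ENNReal.coe_lt_top))]
  have hval : ∀ k, HasYoungIntegral (enorm : ℂ → ℝ≥0∞) (fun r => convPath α t a r k) g t (Jv k) :=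
    fun k => hJv.clm_apply (lp.evalCLM ℝ (fun _ : Fin 2 → ℤ => ℂ) 2 k)
  -- The limit has conjugation-symmetric coefficients, because the integrand has.
  have hconj : ∀ k, Jv (-k) = conj (Jv k) := fun k => by
    have h1 := (hval k).clm_apply Complex.conjCLE.toContinuousLinearMap
    refine (hval (-k)).unique ht.1 (h1.congr fun r hr => ?_)
    rcases hr.2.eq_or_lt with h | h
    · subst h; simp [convPath]
    · have hrT : r ∈ Icc 0 T := ⟨hr.1, hr.2.trans ht.2⟩
      rw [happ r hrT h, happ r hrT h]
      change conj (weighted (2 * α) (heatCoeff (t - r) (a r)) k) = _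
      simp only [weighted, heatCoeff, ha, eigenvalue, freqSq_neg, coeff_neg_freq, map_mul,
        Complex.conj_ofReal]
  set c : (Fin 2 → ℤ) → ℂ := fun k => (((1 + freqSq k) ^ (2 * α / 2))⁻¹ : ℝ) * Jv k with hc
  have hcv : ∀ k, Jv k = weighted (2 * α) c k := fun k => by
    rw [weighted, hc, ← mul_assoc, ← Complex.ofReal_mul, mul_inv_cancel₀ (wt_rpow_pos k _).ne',
      Complex.ofReal_one, one_mul]
  have hfin : sobSq (2 * α) c < ⊤ := by
    rw [sobSq_eq_of_weighted hcv]; exact ENNReal.ofReal_lt_top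
  have hsymm : ∀ k, c (-k) = conj (c k) := fun k => by
    simp only [hc, hconj, freqSq_neg, map_mul, Complex.conj_ofReal]
  have hsum : Summable fun k => ‖c k‖ := by
    obtain ⟨K, hK⟩ := exists_wienerNorm_le hα
    have : wienerNorm 0 c < ⊤ := (wienerNorm_mono (by norm_num) c).trans_lt ((hK c).trans_lt
      (ENNReal.mul_lt_top ENNReal.coe_lt_top (ENNReal.rpow_lt_top_of_nonneg (by norm_num) hfin.ne)))
    simpa using wienerNorm_lt_top_iff.1 this
  have hcoeff : coeff (synth c) = c := funext fun k => coeff_synth hsum hsymm k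
  refine ⟨synth c, ⟨continuous_synth hsum, ?_⟩, fun ε hε => ?_⟩
  · rw [normB, sobolevNorm_eq, hcoeff]
    exact ENNReal.rpow_lt_top_of_nonneg (by norm_num) hfin.ne
  obtain ⟨δ, hδ, h⟩ := hJv ε hε
  refine ⟨δ, hδ, fun n p hp hp0 hpn hm => ?_⟩
  have hpt : ∀ i < n, p i ∈ Icc 0 T ∧ p i ≤ t := fun i hi => by
    have h1 : p i ≤ t := hpn ▸ hp hi.le
    exact ⟨⟨hp0 ▸ hp (Nat.zero_le i), h1.trans ht.2⟩, h1⟩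
  have hcont : ∀ i ∈ Finset.range n,
      Continuous ((g (p (i + 1)) - g (p i)) • heat (t - p i) (transport ξ (y (p i)))) := fun i hi => by
    have h1 := hpt i (Finset.mem_range.1 hi)
    exact (continuous_heat (by linarith) (hy.1.transport_regularity hα hξ h1.1).2).const_smul _
  have key : ∀ k, (∑ i ∈ Finset.range n, (g (p (i + 1)) - g (p i)) • convPath α t a (p i) - Jv) k =
      weighted (2 * α) (coeff (∑ i ∈ Finset.range n,
        (g (p (i + 1)) - g (p i)) • heat (t - p i) (transport ξ (y (p i))) - synth c)) k := by
    intro k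
    rw [lp.coeFn_sub, Pi.sub_apply, lp.coeFn_sum, Finset.sum_apply, hcv, weighted, weighted,
      coeff_sub (continuous_sum hcont) (continuous_synth hsum), coeff_sum _ hcont, hcoeff,
      mul_sub, Finset.mul_sum]
    congr 1
    refine Finset.sum_congr rfl fun i hi => ?_
    have h1 := hpt i (Finset.mem_range.1 hi)
    rw [coeff_smul, coeff_heat (by linarith) (hy.1.transport_regularity hα hξ h1.1).2, lp.coeFn_smul,
      Pi.smul_apply]
    rcases h1.2.eq_or_lt with h2 | h2
    · -- At the endpoint the integrand need not be in `𝓑_α`, but the increment of `g` vanishes.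
      have h3 : p (i + 1) = t := le_antisymm (hpn ▸ hp (Finset.mem_range.1 hi))
        (h2 ▸ hp (Nat.le_succ i))
      simp [h2, h3]
    · rw [happ _ h1.1 h2, weighted, heatCoeff, Complex.real_smul]
      ring
  rw [normB, sobolevNorm_eq, sobSq_eq_of_weighted key, ENNReal.ofReal_pow (norm_nonneg _),
    ofReal_norm, ← ENNReal.rpow_natCast, ← ENNReal.rpow_mul]
  have := h n p hp hp0 hpn hm
  norm_num
  exact this

/-! ### Fourier modes of the stochastic convolution -/

lemma enorm_coeff_le_normB {α : ℝ} (hα : 0 ≤ α) (f : Torus → ℝ) (k : Fin 2 → ℤ) :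
    ‖coeff f k‖ₑ ≤ normB α f := by
  refine (ENNReal.pow_le_pow_left_iff two_ne_zero).1 ?_
  rw [normB, ← sobSq_eq]
  calc ‖coeff f k‖ₑ ^ 2 = 1 * ‖coeff f k‖ₑ ^ 2 := (one_mul _).symm
    _ ≤ ENNReal.ofReal ((1 + freqSq k) ^ (2 * α)) * ‖coeff f k‖ₑ ^ 2 := by
        gcongr
        rw [ENNReal.one_le_ofReal]
        exact Real.one_le_rpow (one_le_wt k) (by linarith)
    _ ≤ _ := ENNReal.le_tsum (f := fun k => ENNReal.ofReal ((1 + freqSq k) ^ (2 * α)) *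
        ‖coeff f k‖ₑ ^ 2) k

/-- The Young integral of paths of functions, in the norm of `𝓑_α`, commutes with the pairing
against a Fourier mode. -/
lemma HasYoungIntegral.pairing_trig {α t : ℝ} (hα : 0 ≤ α) {F : ℝ → Torus → ℝ} {g : ℝ → ℝ}
    {J : Torus → ℝ} (hF : ∀ r ∈ Icc 0 t, Continuous (F r)) (hJc : Continuous J)
    (hJ : HasYoungIntegral (normB α) F g t J) (k : Fin 2 → ℤ) (z : ℂ) :
    HasYoungIntegral (enorm : ℝ → ℝ≥0∞) (fun r => pairing (F r) (trig k z)) g t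
      (pairing J (trig k z)) := by
  have hc : HasYoungIntegral (enorm : ℂ → ℝ≥0∞) (fun r => coeff (F r) k) g t (coeff J k) := by
    intro ε hε
    obtain ⟨δ, hδ, h⟩ := hJ ε hε
    refine ⟨δ, hδ, fun n p hp hp0 hpn hm => lt_of_le_of_lt ?_ (h n p hp hp0 hpn hm)⟩
    have hcont : ∀ i ∈ Finset.range n, Continuous ((g (p (i + 1)) - g (p i)) • F (p i)) :=
      fun i hi => (hF _ ⟨hp0 ▸ hp (Nat.zero_le i),
        hpn ▸ hp (Finset.mem_range.1 hi).le⟩).const_smul _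
    have e : ∑ i ∈ Finset.range n, (g (p (i + 1)) - g (p i)) • coeff (F (p i)) k - coeff J k =
        coeff (∑ i ∈ Finset.range n, (g (p (i + 1)) - g (p i)) • F (p i) - J) k := by
      rw [coeff_sub (continuous_sum hcont) hJc, coeff_sum _ hcont]
      simp only [coeff_smul, Complex.real_smul]
    rw [e]
    exact enorm_coeff_le_normB hα _ k
  have h2 := hc.clm_apply (Complex.reCLM ∘L ((ContinuousLinearMap.mul ℝ ℂ z) ∘L
    Complex.conjCLE.toContinuousLinearMap))
  rw [Vorticity.pairing_trig hJc]
  refine HasYoungIntegral.congr h2 fun r hr => ?_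
  rw [Vorticity.pairing_trig (hF r hr)]
  rfl

/-! ### The drift convolution -/

/-- The nonlinearity `u · ∇w`, with `u = K ∗ w`. -/
noncomputable def advection (w : Torus → ℝ) : Torus → ℝ := transport (biotSavart w) w

lemma coeff_eq_pairing {f : Torus → ℝ} (hf : Continuous f) (k : Fin 2 → ℤ) :
    coeff f k = pairing f (trig k 1) + pairing f (trig k Complex.I) * Complex.I := by
  rw [pairing_trig hf, pairing_trig hf]
  apply Complex.ext <;> simp

lemma Wiener.advection_regularity {w : Torus → ℝ} (hw : Wiener (1 / 2) w) :
    Continuous (advection w) ∧ Summable fun k => ‖coeff (advection w) k‖ := by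
  have h : ∀ i, Wiener 0 fun x => Vorticity.biotSavart w x i := fun i =>
    (hw.mono (by norm_num)).biotSavart le_rfl i
  exact ⟨continuous_transport (v := Vorticity.biotSavart w) (fun i => (h i).1) hw.isC1, summable_coeff_transport h hw⟩

lemma MemC.exists_wienerNorm_advection_le {T α : ℝ} (hα : 1 < α) {y : ℝ → Torus → ℝ}
    (hy : MemC T α y) : ∃ M : ℝ≥0, ∀ r ∈ Icc 0 T, wienerNorm 0 (coeff (advection (y r))) ≤ M := by
  obtain ⟨M, hM⟩ := hy.exists_wiener_bound hα
  refine ⟨(M + M) * ((2 * Real.pi).toNNReal * M), fun r hr => ?_⟩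
  have hw := (hy.1 r hr).wiener hα
  have hw0 : Wiener 0 (y r) := hw.mono (by norm_num)
  have hu : ∀ i, wienerNorm 0 (coeff fun x => biotSavart (y r) x i) ≤ M := fun i =>
    (hw0.wienerNorm_biotSavart_le i).trans ((wienerNorm_mono (by norm_num) _).trans (hM r hr))
  refine (wienerNorm_transport_le (fun i => hw0.biotSavart le_rfl i) hw.isC1).trans ?_
  push_cast
  gcongr
  · exact hu 0
  · exact hu 1
  · exact le_rfl
  · exact hM r hr

/-- The velocity is divergence free, so the advection can be moved onto the test function. -/
lemma Wiener.pairing_advection {w : Torus → ℝ} (hw : Wiener (1 / 2) w) {φ : Torus → ℝ}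
    (hφ : IsC1 φ) : pairing w (transport (Vorticity.biotSavart w) φ) = -pairing (advection w) φ :=
  pairing_transport (fun i => (hw.biotSavart (by norm_num) i).isC1) hw.divFree_biotSavart hw.isC1 hφ

lemma MemC.continuousOn_pairing_advection {T α : ℝ} (hα : 1 < α) {y : ℝ → Torus → ℝ}
    (hy : MemC T α y) {φ : Torus → ℝ} (hφ : IsC1 φ) :
    ContinuousOn (fun r => pairing (advection (y r)) φ) (Icc 0 T) := by
  refine ((hy.continuousOn_drift hα hφ (ψ := 0) continuous_const).neg).congr fun r hr => ?_
  simp only [Pi.neg_apply, add_zero]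
  rw [((hy.1 r hr).wiener hα).pairing_advection hφ, neg_neg]

lemma MemC.continuousOn_coeff_advection {T α : ℝ} (hα : 1 < α) {y : ℝ → Torus → ℝ}
    (hy : MemC T α y) (k : Fin 2 → ℤ) :
    ContinuousOn (fun r => coeff (advection (y r)) k) (Icc 0 T) := by
  have h : ∀ z, ContinuousOn (fun r => (pairing (advection (y r)) (trig k z) : ℂ)) (Icc 0 T) :=
    fun z => Complex.continuous_ofReal.comp_continuousOn
      (hy.continuousOn_pairing_advection hα (smooth_trig k z).isC1)
  refine ((h 1).add ((h Complex.I).mul (continuousOn_const (c := Complex.I)))).congr fun r hr => ?_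
  exact coeff_eq_pairing ((hy.1 r hr).wiener hα).advection_regularity.1 k

/-- The drift convolution `D = ∫₀ᵗ S_{t-r}(u_r·∇y_r) dr` exists pointwise, is continuous, and may be
computed mode by mode. -/
theorem MemC.drift_convolution {T α : ℝ} (hα : 1 < α) {y : ℝ → Torus → ℝ} (hy : MemC T α y)
    {t : ℝ} (ht : t ∈ Icc 0 T) :
    (∀ x, IntervalIntegrable (fun r => heat (t - r) (advection (y r)) x) volume 0 t) ∧
    Continuous (fun x => ∫ r in (0 : ℝ)..t, heat (t - r) (advection (y r)) x) ∧
    ∀ k z, pairing (fun x => ∫ r in (0 : ℝ)..t, heat (t - r) (advection (y r)) x) (trig k z) =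
      ∫ r in (0 : ℝ)..t, Real.exp (-(eigenvalue k * (t - r))) *
        pairing (advection (y r)) (trig k z) := by
  obtain ⟨M, hM⟩ := hy.exists_wienerNorm_advection_le hα
  set μ : Measure ℝ := volume.restrict (Ioc 0 t) with hμ
  set G : (Fin 2 → ℤ) → ℝ → ℂ := fun k r =>
    (Real.exp (-(eigenvalue k * (t - r))) : ℂ) * coeff (advection (y r)) k with hG
  have hsub : ∀ r ∈ Icc 0 t, r ∈ Icc 0 T := fun r hr => ⟨hr.1, hr.2.trans ht.2⟩
  have hreg : ∀ r ∈ Icc 0 t, Continuous (advection (y r)) ∧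
      Summable fun k => ‖coeff (advection (y r)) k‖ := fun r hr =>
    ((hy.1 r (hsub r hr)).wiener hα).advection_regularity
  have hGcont : ∀ k, ContinuousOn (G k) (Icc 0 t) := fun k =>
    (by fun_prop : Continuous fun r : ℝ => (Real.exp (-(eigenvalue k * (t - r))) : ℂ)).continuousOn.mul
      ((hy.continuousOn_coeff_advection hα k).mono hsub)
  have hGmeas : ∀ k, AEStronglyMeasurable (G k) μ := fun k =>
    ((hGcont k).mono Ioc_subset_Icc_self).aestronglyMeasurable measurableSet_Ioc
  have hGint : ∀ k, Integrable (G k) μ := fun k =>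
    ((hGcont k).integrableOn_Icc (μ := volume)).mono_set Ioc_subset_Icc_self
  have hGle : ∀ r ∈ Icc 0 t, ∑' k, ‖G k r‖ₑ ≤ M := fun r hr => by
    refine le_trans (ENNReal.tsum_le_tsum fun k => ?_)
      ((wienerNorm_zero _).symm.trans_le (hM r (hsub r hr)))
    rw [← ofReal_norm, ← ofReal_norm]
    exact ENNReal.ofReal_le_ofReal (norm_heat_le (sub_nonneg.2 hr.2) _ k)
  have hae : ∀ᵐ r ∂μ, r ∈ Icc 0 t :=
    (ae_restrict_mem measurableSet_Ioc).mono fun r hr => Ioc_subset_Icc_self hr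
  have htot : ∑' k, ∫⁻ r, ‖G k r‖ₑ ∂μ < ⊤ := by
    rw [← lintegral_tsum fun k => (hGmeas k).enorm]
    calc ∫⁻ r, ∑' k, ‖G k r‖ₑ ∂μ ≤ ∫⁻ _, M ∂μ := lintegral_mono_ae (hae.mono hGle)
      _ < ⊤ := by
        rw [lintegral_const]
        exact ENNReal.mul_lt_top ENNReal.coe_lt_top (measure_lt_top _ _)
  set d : (Fin 2 → ℤ) → ℂ := fun k => ∫ r, G k r ∂μ with hd
  have hdsum : Summable fun k => ‖d k‖ := by
    have h1 : ∑' k, ‖d k‖ₑ < ⊤ :=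
      (ENNReal.tsum_le_tsum fun k => enorm_integral_le_lintegral_enorm _).trans_lt htot
    rw [← wienerNorm_zero] at h1
    simpa using wienerNorm_lt_top_iff.1 h1
  have hdsymm : ∀ k, d (-k) = conj (d k) := fun k => by
    rw [hd, ← integral_conj]
    exact integral_congr_ae (.of_forall fun r => heat_symm (t - r) _ k)
  have hGx : ∀ x k r, ‖G k r * mFourier k x‖ₑ = ‖G k r‖ₑ := fun x k r => by
    rw [← ofReal_norm, norm_mul, norm_mFourier_apply, mul_one, ofReal_norm]
  have hGxmeas : ∀ x k, AEStronglyMeasurable (fun r => G k r * mFourier k x) μ := fun x k =>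
    (hGmeas k).mul_const _
  have hsum : ∀ r ∈ Icc 0 t, ∀ x, HasSum (fun k => G k r * mFourier k x)
      (heat (t - r) (advection (y r)) x : ℂ) := fun r hr x =>
    hasSum_synth (summable_heat (sub_nonneg.2 hr.2) (hreg r hr).2) (heat_symm _ _) x
  have hint : ∀ x, Integrable (fun r => (heat (t - r) (advection (y r)) x : ℂ)) μ := fun x => by
    -- measurability in time as a limit of partial Fourier sums
    refine ⟨aestronglyMeasurable_of_tendsto_ae (u := atTop)
      (f := fun (S : Finset (Fin 2 → ℤ)) r => ∑ k ∈ S, G k r * mFourier k x) (fun S => ?_) ?_, ?_⟩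
    · exact Finset.aestronglyMeasurable_fun_sum S fun k _ => hGxmeas x k
    · exact hae.mono fun r hr => hsum r hr x
    · refine HasFiniteIntegral.of_bounded (C := M) (hae.mono fun r hr => ?_)
      rw [← (hsum r hr x).tsum_eq, ← toReal_enorm]
      refine ENNReal.toReal_le_coe_of_le_coe (le_trans ?_ (hGle r hr))
      simp only [← hGx x]
      exact enorm_tsum_le_tsum_enorm
  have hD : (fun x => ∫ r in (0 : ℝ)..t, heat (t - r) (advection (y r)) x) = synth d := by
    ext x
    rw [intervalIntegral.integral_of_le ht.1]
    have h1 : ((∫ r, heat (t - r) (advection (y r)) x ∂μ : ℝ) : ℂ) =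
        ∑' k, d k * mFourier k x := by
      rw [← integral_complex_ofReal, integral_congr_ae (hae.mono fun r hr => (hsum r hr x).tsum_eq.symm),
        integral_tsum (hGxmeas x) (by simp only [hGx]; exact htot.ne)]
      exact tsum_congr fun k => integral_mul_const _ _
    rw [synth, ← h1, Complex.ofReal_re]
  refine ⟨fun x => ?_, hD ▸ continuous_synth hdsum, fun k z => ?_⟩
  · rw [intervalIntegrable_iff_integrableOn_Ioc_of_le ht.1]
    have h1 := (hint x).re
    simp only [RCLike.re_to_complex, Complex.ofReal_re] at h1
    exact h1
  · rw [hD, pairing_trig (continuous_synth hdsum), coeff_synth hdsum hdsymm, hd, ← integral_conj,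
      ← integral_const_mul, ← Complex.reCLM_apply, ← ContinuousLinearMap.integral_comp_comm,
      intervalIntegral.integral_of_le ht.1]
    · refine integral_congr_ae (hae.mono fun r hr => ?_)
      simp only [hG, Complex.reCLM_apply]
      rw [pairing_trig (hreg r hr).1, map_mul, Complex.conj_ofReal, mul_left_comm,
        Complex.re_ofReal_mul]
    · exact (Complex.conjLIE.toContinuousLinearEquiv.toContinuousLinearMap.integrable_comp
        (hGint k)).const_mul z

/-! ### Scalar Young integrals as functions of the upper limit -/

lemma HasYoungIntegral.zero {F g : ℝ → ℝ} : HasYoungIntegral (enorm : ℝ → ℝ≥0∞) F g 0 0 := by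
  refine hasYoungIntegral_of_norm_lt fun ε hε => ⟨1, one_pos, fun n p hp hp0 hpn _ => ?_⟩
  have h : ∀ i ≤ n, p i = 0 := fun i hi =>
    le_antisymm (hpn ▸ hp hi) (hp0 ▸ hp (Nat.zero_le i))
  have : rsSum F g p 0 n = 0 := Finset.sum_eq_zero fun i hi => by
    rw [Finset.mem_Ico] at hi
    rw [h i hi.2.le, h (i + 1) hi.2, sub_self, zero_smul]
  rw [this, sub_zero, norm_zero]
  exact hε

lemma continuousOn_of_holder {Y : ℝ → ℝ} {K γ T : ℝ} (hγ : 0 < γ)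
    (h : ∀ s v, 0 ≤ s → s ≤ v → v ≤ T → |Y v - Y s| ≤ K * (v - s) ^ γ) :
    ContinuousOn Y (Icc 0 T) := by
  have h' : ∀ s ∈ Icc 0 T, ∀ v ∈ Icc 0 T, |Y v - Y s| ≤ K * |v - s| ^ γ := fun s hs v hv => by
    rcases le_total s v with hsv | hsv
    · rw [abs_of_nonneg (sub_nonneg.2 hsv)]
      exact h s v hs.1 hsv hv.2
    · rw [abs_sub_comm, abs_sub_comm v, abs_of_nonneg (sub_nonneg.2 hsv)]
      exact h v s hv.1 hsv hs.2
  intro s hs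
  have h0 : Tendsto (fun v => K * |v - s| ^ γ) (𝓝[Icc 0 T] s) (𝓝 0) := by
    have : Continuous fun v => K * |v - s| ^ γ :=
      continuous_const.mul (((continuous_id.sub continuous_const).abs).rpow_const fun _ =>
        Or.inr hγ.le)
    have h1 := this.tendsto s
    simp only [sub_self, abs_zero, Real.zero_rpow hγ.ne', mul_zero] at h1
    exact h1.mono_left nhdsWithin_le_nhds
  rw [ContinuousWithinAt, tendsto_iff_dist_tendsto_zero]
  refine squeeze_zero' (.of_forall fun _ => dist_nonneg) ?_ h0
  filter_upwards [self_mem_nhdsWithin] with v hv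
  exact h' s hs v hv

/-- The Young integral `Y = ∫ F dg` of Hölder functions, with its local expansion. -/
lemma exists_young_primitive {F g : ℝ → ℝ} {A B γ T : ℝ} (hT : 0 ≤ T) (hγ : 1 / 2 < γ) (hA : 0 ≤ A)
    (hB : 0 ≤ B) (hF : ∀ s ∈ Icc 0 T, ∀ t ∈ Icc 0 T, ‖F t - F s‖ ≤ A * |t - s| ^ γ)
    (hg : ∀ s ∈ Icc 0 T, ∀ t ∈ Icc 0 T, |g t - g s| ≤ B * |t - s| ^ γ) :
    ∃ Y : ℝ → ℝ, (∀ t ∈ Icc 0 T, HasYoungIntegral (enorm : ℝ → ℝ≥0∞) F g t (Y t)) ∧ Y 0 = 0 ∧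
      ContinuousOn Y (Icc 0 T) ∧ ∀ s v, 0 ≤ s → s ≤ v → v ≤ T →
        |Y v - Y s - (g v - g s) * F s| ≤ youngConst (2 * γ) * (A * B) * (v - s) ^ (2 * γ) := by
  have hctrl := youngControl_of_holder hγ hA hB hF hg
  have hex : ∀ t ∈ Icc 0 T, ∃ J, HasYoungIntegral (enorm : ℝ → ℝ≥0∞) F g t J := fun t ht =>
    (youngControl_of_holder hγ hA hB
      (fun s hs v hv => hF s ⟨hs.1, hs.2.trans ht.2⟩ v ⟨hv.1, hv.2.trans ht.2⟩)
      (fun s hs v hv => hg s ⟨hs.1, hs.2.trans ht.2⟩ v ⟨hv.1, hv.2.trans ht.2⟩)).exists_integral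
      ht.1 continuousOn_id
  choose! Y hY using hex
  have hloc : ∀ s v, 0 ≤ s → s ≤ v → v ≤ T →
      |Y v - Y s - (g v - g s) * F s| ≤ youngConst (2 * γ) * (A * B) * (v - s) ^ (2 * γ) :=
    fun s v hs hsv hv => hctrl.norm_integral_sub_le hs hsv hv (hY s ⟨hs, hsv.trans hv⟩)
      (hY v ⟨hs.trans hsv, hv⟩)
  have hK := (youngConst_pos hctrl.one_lt).le
  refine ⟨Y, hY, (hY 0 ⟨le_rfl, hT⟩).unique le_rfl HasYoungIntegral.zero, ?_, hloc⟩
  refine continuousOn_of_holder (γ := γ) (K := youngConst (2 * γ) * (A * B) * T ^ γ +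
    B * (|F 0| + A * T ^ γ)) (by linarith) fun s v hs hsv hv => ?_
  have hγ0 : 0 ≤ γ := by linarith
  have h1 := hloc s v hs hsv hv
  have h2 := hg s ⟨hs, hsv.trans hv⟩ v ⟨hs.trans hsv, hv⟩
  have h3 := hF 0 ⟨le_rfl, hT⟩ s ⟨hs, hsv.trans hv⟩
  rw [sub_zero, abs_of_nonneg hs, Real.norm_eq_abs] at h3
  rw [abs_of_nonneg (sub_nonneg.2 hsv)] at h2
  have h4 : s ^ γ ≤ T ^ γ := Real.rpow_le_rpow hs (hsv.trans hv) hγ0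
  have h5 : |F s| ≤ |F 0| + A * T ^ γ := by
    have := abs_sub_abs_le_abs_sub (F s) (F 0)
    have := mul_le_mul_of_nonneg_left h4 hA
    linarith
  have h6 : (v - s) ^ (2 * γ) ≤ T ^ γ * (v - s) ^ γ := by
    rw [two_mul, Real.rpow_add_of_nonneg (sub_nonneg.2 hsv) hγ0 hγ0]
    gcongr
    linarith
  have h7 := abs_sub_abs_le_abs_sub (Y v - Y s) ((g v - g s) * F s)
  have h8 : |(g v - g s) * F s| ≤ B * (v - s) ^ γ * (|F 0| + A * T ^ γ) := by
    rw [abs_mul]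
    have : 0 ≤ (v - s) ^ γ := Real.rpow_nonneg (sub_nonneg.2 hsv) _
    gcongr
  have h9 := mul_le_mul_of_nonneg_left h6 (mul_nonneg hK (mul_nonneg hA hB))
  linarith

/-! ### Bounds for the terms of the weak formulation -/

lemma pairing_sub_left {f f' g : Torus → ℝ} (hf : Continuous f) (hf' : Continuous f')
    (hg : Continuous g) : pairing (f - f') g = pairing f g - pairing f' g := by
  refine Eq.trans ?_ (integral_sub (integrable_of_continuous (hf.mul hg))
    (integrable_of_continuous (hf'.mul hg)))
  simp [pairing, sub_mul]

lemma pairing_add_right {f g g' : Torus → ℝ} (hf : Continuous f) (hg : Continuous g)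
    (hg' : Continuous g') : pairing f (g + g') = pairing f g + pairing f g' := by
  refine Eq.trans ?_ (integral_add (integrable_of_continuous (hf.mul hg))
    (integrable_of_continuous (hf.mul hg')))
  simp [pairing, mul_add]

lemma pairing_smul_right (c : ℝ) (f g : Torus → ℝ) : pairing f (c • g) = c * pairing f g := by
  simp only [pairing, ← integral_const_mul, Pi.smul_apply, smul_eq_mul, mul_left_comm]

/-- The duality between the Wiener algebra and bounded coefficients, the latter being controlled by
any norm of `𝓑_β` with `β ≥ 0`. -/
lemma enorm_pairing_le {β : ℝ} (hβ : 0 ≤ β) {f ψ : Torus → ℝ} (hf : Continuous f)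
    (hψ : Wiener 0 ψ) : ‖pairing f ψ‖ₑ ≤ wienerNorm 0 (coeff ψ) * normB β f := by
  have h : ‖pairing f ψ‖ₑ = ‖coeff (ψ * f) 0‖ₑ := by
    rw [coeff_zero_eq, ← ofReal_norm, ← ofReal_norm, Complex.norm_real]
    simp only [pairing, Pi.mul_apply, mul_comm]
  rw [h, wienerNorm_zero, ← ENNReal.tsum_mul_right]
  refine (enorm_coeff_mul_le hψ hf 0).trans (ENNReal.tsum_le_tsum fun l => ?_)
  gcongr
  exact enorm_coeff_le_normB hβ f _

/-- The integrand of the noise term of the weak formulation is Hölder continuous in time. -/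
lemma MemV.exists_holder_pairing {T α γ : ℝ} (hα : 1 < α) (hγ1 : γ ≤ 1) {y : ℝ → Torus → ℝ}
    (hy : MemV T α γ y) : ∃ L : ℝ≥0, ∀ ψ, Wiener 0 ψ → ∀ s ∈ Icc 0 T, ∀ t ∈ Icc 0 T,
      ‖pairing (y t) ψ - pairing (y s) ψ‖ ≤
        L * (wienerNorm 0 (coeff ψ)).toReal * |t - s| ^ γ := by
  obtain ⟨L, hL⟩ := hy.2
  refine ⟨L, fun ψ hψ s hs t ht => ?_⟩
  have hfin : wienerNorm 0 (coeff ψ) ≠ ⊤ := (wienerNorm_lt_top_iff.2 hψ.2).ne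
  have e := pairing_sub_left (hy.1.1 t ht).1 (hy.1.1 s hs).1 hψ.1
  have h := (enorm_pairing_le (β := α - γ) (by linarith) ((hy.1.1 t ht).1.sub (hy.1.1 s hs).1)
    hψ).trans (mul_le_mul_right (hL s hs t ht) _)
  rw [← e, ← toReal_enorm]
  refine (ENNReal.toReal_mono (ENNReal.mul_ne_top hfin
    (ENNReal.mul_ne_top ENNReal.coe_ne_top ENNReal.ofReal_ne_top)) h).trans (le_of_eq ?_)
  rw [ENNReal.toReal_mul, ENNReal.toReal_mul, ENNReal.coe_toReal,
    ENNReal.toReal_ofReal (Real.rpow_nonneg (abs_nonneg _) _)]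
  ring

lemma wiener_transport {v : Torus → Fin 2 → ℝ} (hv : ∀ i, Wiener 0 fun x => v x i)
    {f : Torus → ℝ} (hf : Wiener (1 / 2) f) : Wiener 0 (transport v f) :=
  ⟨continuous_transport (fun i => (hv i).1) hf.isC1, by
    simpa using summable_coeff_transport hv hf⟩

/-- The Young integral in the weak formulation exists for every smooth test function, depends
continuously on time, and is controlled by the first-order Wiener norm of the test function. -/
lemma MemV.exists_weak_young {T α γ B : ℝ} (hT : 0 ≤ T) (hα : 1 < α) (hγ : 1 / 2 < γ) (hγ1 : γ ≤ 1)
    {y : ℝ → Torus → ℝ} (hy : MemV T α γ y) {ξ : Torus → Fin 2 → ℝ}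
    (hξ : ∀ i, Smooth fun x => ξ x i) {g : ℝ → ℝ} (hB : 0 ≤ B)
    (hg : ∀ s ∈ Icc 0 T, ∀ t ∈ Icc 0 T, |g t - g s| ≤ B * |t - s| ^ γ) :
    ∃ (C : ℝ≥0) (Y : (Torus → ℝ) → ℝ → ℝ), ∀ φ, Smooth φ →
      (∀ t ∈ Icc 0 T, HasYoungIntegral (enorm : ℝ → ℝ≥0∞)
        (fun r => pairing (y r) (transport ξ φ)) g t (Y φ t)) ∧
      Y φ 0 = 0 ∧ ContinuousOn (Y φ) (Icc 0 T) ∧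
      (∃ K, 0 ≤ K ∧ ∀ s v, 0 ≤ s → s ≤ v → v ≤ T →
        |Y φ v - Y φ s - (g v - g s) * pairing (y s) (transport ξ φ)| ≤ K * (v - s) ^ (2 * γ)) ∧
      ∀ t ∈ Icc 0 T, ‖Y φ t‖ₑ ≤ C * wienerNorm 1 (coeff φ) := by
  obtain ⟨L, hL⟩ := hy.exists_holder_pairing hα hγ1
  obtain ⟨N, hN⟩ := hy.1.exists_bound
  have hξw : ∀ i, Wiener 0 fun x => ξ x i := fun i => (hξ i).wiener 0
  have hw : ∀ φ, Smooth φ → Wiener 0 (transport ξ φ) := fun φ hφ =>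
    wiener_transport hξw (hφ.wiener _)
  have key : ∀ φ, Smooth φ → _ := fun φ hφ => exists_young_primitive
    (F := fun r => pairing (y r) (transport ξ φ)) hT hγ (by positivity) hB (hL _ (hw φ hφ)) hg
  choose! Y hY hY0 hYc hYloc using key
  have hK := (youngConst_pos (show 1 < 2 * γ by linarith)).le
  set D : ℝ := B * T ^ γ * N + youngConst (2 * γ) * (L * B) * T ^ (2 * γ) with hD
  have hD0 : 0 ≤ D := by positivity
  set X : ℝ≥0∞ := wienerNorm 0 (coeff fun x => ξ x 0) + wienerNorm 0 (coeff fun x => ξ x 1) with hX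
  have hXfin : X ≠ ⊤ := ENNReal.add_ne_top.2 ⟨(wienerNorm_lt_top_iff.2 (hξw 0).2).ne,
    (wienerNorm_lt_top_iff.2 (hξw 1).2).ne⟩
  refine ⟨D.toNNReal * (X.toNNReal * (2 * Real.pi).toNNReal), Y, fun φ hφ => ⟨hY φ hφ, hY0 φ hφ,
    hYc φ hφ, ⟨_, ?_, hYloc φ hφ⟩, fun t ht => ?_⟩⟩
  · positivity
  have h1 := hYloc φ hφ 0 t le_rfl ht.1 ht.2
  have h2 := hg 0 ⟨le_rfl, hT⟩ t ht
  rw [hY0 φ hφ, sub_zero, sub_zero] at h1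
  rw [sub_zero, abs_of_nonneg ht.1] at h2
  set w := (wienerNorm 0 (coeff (transport ξ φ))).toReal with hwdef
  have hwfin : wienerNorm 0 (coeff (transport ξ φ)) ≠ ⊤ := (wienerNorm_lt_top_iff.2 (hw φ hφ).2).ne
  have h3 : |pairing (y 0) (transport ξ φ)| ≤ w * N := by
    have h := (enorm_pairing_le (β := α) (by linarith) (hy.1.1 0 ⟨le_rfl, hT⟩).1 (hw φ hφ)).trans
      (mul_le_mul_right (hN 0 ⟨le_rfl, hT⟩) _)
    rw [← Real.norm_eq_abs, ← toReal_enorm]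
    refine (ENNReal.toReal_mono (ENNReal.mul_ne_top hwfin ENNReal.coe_ne_top) h).trans
      (le_of_eq ?_)
    rw [ENNReal.toReal_mul, ENNReal.coe_toReal]
  have ht1 : t ^ γ ≤ T ^ γ := Real.rpow_le_rpow ht.1 ht.2 (by linarith)
  have ht2 : t ^ (2 * γ) ≤ T ^ (2 * γ) := Real.rpow_le_rpow ht.1 ht.2 (by linarith)
  have hw0 : 0 ≤ w := ENNReal.toReal_nonneg
  have h4 : |Y φ t| ≤ D * w := by
    have h5 := abs_sub_abs_le_abs_sub (Y φ t) ((g t - g 0) * pairing (y 0) (transport ξ φ))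
    have h6 : |(g t - g 0) * pairing (y 0) (transport ξ φ)| ≤ B * T ^ γ * (w * N) := by
      rw [abs_mul]
      exact mul_le_mul (h2.trans (by gcongr)) h3 (abs_nonneg _) (by positivity)
    have h7 : youngConst (2 * γ) * (L * w * B) * t ^ (2 * γ) ≤
        youngConst (2 * γ) * (L * w * B) * T ^ (2 * γ) := by gcongr
    rw [hD]
    linarith
  have h5 : wienerNorm 0 (coeff (transport ξ φ)) ≤
      X * (ENNReal.ofReal (2 * Real.pi) * wienerNorm 1 (coeff φ)) :=
    (wienerNorm_transport_le hξw hφ.isC1).trans (by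
      gcongr
      exact wienerNorm_mono (by norm_num) _)
  calc ‖Y φ t‖ₑ = ENNReal.ofReal |Y φ t| := by rw [← ofReal_norm, Real.norm_eq_abs]
    _ ≤ ENNReal.ofReal (D * w) := ENNReal.ofReal_le_ofReal h4
    _ = ENNReal.ofReal D * wienerNorm 0 (coeff (transport ξ φ)) := by
      rw [ENNReal.ofReal_mul hD0, hwdef, ENNReal.ofReal_toReal hwfin]
    _ ≤ ENNReal.ofReal D * (X * (ENNReal.ofReal (2 * Real.pi) * wienerNorm 1 (coeff φ))) := by
      gcongr
    _ = _ := by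
      push_cast
      rw [ENNReal.coe_toNNReal hXfin]
      simp only [ENNReal.ofReal, mul_assoc]

/-! ### From trigonometric to smooth test functions -/

lemma sum_trig_apply (S : Finset (Fin 2 → ℤ)) (c : (Fin 2 → ℤ) → ℂ) (x : Torus) :
    (∑ k ∈ S, trig k (c k)) x = (∑ k ∈ S, c k * mFourier k x).re := by
  rw [Finset.sum_apply, Complex.re_sum]
  rfl

lemma smooth_zero : Smooth (0 : Torus → ℝ) := contDiff_const

lemma smooth_sum_trig (S : Finset (Fin 2 → ℤ)) (c : (Fin 2 → ℤ) → ℂ) :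
    Smooth (∑ k ∈ S, trig k (c k)) :=
  Finset.sum_induction _ Smooth (fun _ _ => Smooth.add) smooth_zero fun k _ => smooth_trig k (c k)

/-- The Fourier coefficients of the remainder of a Fourier series, for a set of frequencies that is
symmetric, so that the remainder is a real function with the expected coefficients. -/
lemma coeff_sub_sum_trig {φ : Torus → ℝ} (hφ : Smooth φ) {S : Finset (Fin 2 → ℤ)}
    (hS : ∀ k, -k ∈ S ↔ k ∈ S) :
    coeff (φ - ∑ k ∈ S, trig k (coeff φ k)) = fun k => if k ∈ S then 0 else coeff φ k := by
  classical
  set d : (Fin 2 → ℤ) → ℂ := fun k => if k ∈ S then 0 else coeff φ k with hd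
  have hs : Summable fun k => ‖coeff φ k‖ := (hφ.wiener 0).summable le_rfl
  have hds : Summable fun k => ‖d k‖ := hs.of_nonneg_of_le (fun _ => norm_nonneg _) fun k => by
    simp only [hd]; split_ifs <;> simp
  have hsymm : ∀ k, d (-k) = conj (d k) := fun k => by
    simp only [hd, hS]
    split_ifs
    · simp
    · exact coeff_neg_freq φ k
  have e : φ - ∑ k ∈ S, trig k (coeff φ k) = synth d := by
    ext x
    have h1 := hasSum_coeff hφ.continuous hs x
    have h2 : HasSum (fun k => if k ∈ S then coeff φ k * mFourier k x else 0)
        (∑ k ∈ S, coeff φ k * mFourier k x) := by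
      have : HasSum (fun k => if k ∈ S then coeff φ k * mFourier k x else 0)
          (∑ k ∈ S, if k ∈ S then coeff φ k * mFourier k x else 0) :=
        hasSum_sum_of_ne_finset_zero fun k hk => if_neg hk
      rwa [Finset.sum_congr rfl fun k hk => if_pos hk] at this
    have h3 : (fun k => d k * mFourier k x) = fun k => coeff φ k * mFourier k x -
        if k ∈ S then coeff φ k * mFourier k x else 0 := by
      ext k; simp only [hd]; split_ifs <;> simp
    have h4 := congrArg Complex.re ((h3 ▸ hasSum_synth hds hsymm x).unique (h1.sub h2))
    simp only [Complex.ofReal_re, Complex.sub_re] at h4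
    rw [Pi.sub_apply, sum_trig_apply, h4]
  rw [e]
  exact funext fun k => coeff_synth hds hsymm k

/-- An additive functional on smooth functions that is bounded by a Wiener norm and vanishes on
trigonometric functions vanishes. -/
lemma eq_zero_of_trig {R : (Torus → ℝ) → ℝ} {C : ℝ≥0} {s : ℝ}
    (hadd : ∀ f g, Smooth f → Smooth g → R (f + g) = R f + R g)
    (hle : ∀ f, Smooth f → ‖R f‖ₑ ≤ C * wienerNorm s (coeff f))
    (h0 : ∀ k z, R (trig k z) = 0) {φ : Torus → ℝ} (hφ : Smooth φ) : R φ = 0 := by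
  classical
  have hR0 : R 0 = 0 := by
    have := hadd 0 0 smooth_zero smooth_zero
    rw [add_zero] at this
    linarith
  have hsum : ∀ S : Finset (Fin 2 → ℤ), R (∑ k ∈ S, trig k (coeff φ k)) = 0 := fun S =>
    (Finset.sum_induction (fun k => trig k (coeff φ k)) (fun f => Smooth f ∧ R f = 0)
      (fun f g hf hg => ⟨hf.1.add hg.1, by rw [hadd f g hf.1 hg.1, hf.2, hg.2, add_zero]⟩)
      ⟨smooth_zero, hR0⟩ fun k _ => ⟨smooth_trig k _, h0 k _⟩).2
  set w : (Fin 2 → ℤ) → ℝ≥0∞ := fun k => ENNReal.ofReal ((1 + freqSq k) ^ s) * ‖coeff φ k‖ₑ with hw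
  have htail : Tendsto (fun S : Finset (Fin 2 → ℤ) => C * ∑' k : { k // k ∉ S }, w k) atTop
      (𝓝 0) := by
    have h1 := ENNReal.tendsto_tsum_compl_atTop_zero
      (f := w) (wienerNorm_lt_top_iff.2 (hφ.wiener s).2).ne
    have := ENNReal.Tendsto.const_mul (a := (C : ℝ≥0∞)) h1 (Or.inr ENNReal.coe_ne_top)
    rwa [mul_zero] at this
  rw [← enorm_eq_zero, ← nonpos_iff_eq_zero]
  refine ge_of_tendsto_of_frequently htail ?_
  refine (frequently_atTop.2 fun S₀ => ?_)
  -- Symmetric sets of frequencies are cofinal.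
  refine ⟨S₀ ∪ S₀.image (-·), Finset.subset_union_left, ?_⟩
  set S := S₀ ∪ S₀.image (-·) with hSdef
  have hS : ∀ k, -k ∈ S ↔ k ∈ S := fun k => by
    simp only [hSdef, Finset.mem_union, Finset.mem_image]
    constructor
    · rintro (h | ⟨l, h, hl⟩)
      · exact Or.inr ⟨-k, h, neg_neg k⟩
      · exact Or.inl (neg_injective hl ▸ h)
    · rintro (h | ⟨l, h, hl⟩)
      · exact Or.inr ⟨k, h, rfl⟩
      · exact Or.inl (by rw [← hl, neg_neg]; exact h)
  have hsm := smooth_sum_trig S (coeff φ)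
  have e : R φ = R (φ - ∑ k ∈ S, trig k (coeff φ k)) := by
    conv_lhs => rw [← sub_add_cancel φ (∑ k ∈ S, trig k (coeff φ k))]
    rw [hadd _ _ (hφ.sub hsm) hsm, hsum, add_zero]
  rw [e]
  refine (hle _ (hφ.sub hsm)).trans ?_
  gcongr
  rw [coeff_sub_sum_trig hφ hS, wienerNorm]
  refine le_of_eq (Eq.trans ?_ (tsum_subtype {k | k ∉ S} w).symm)
  refine tsum_congr fun k => ?_
  by_cases hk : k ∈ S <;> simp [hk, hw, indicator]

/-! ### The equation along a single path -/

/-- The hypotheses on one realisation: `y` is the solution path, `y₀` the initial condition, `ξ` the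
noise coefficient and `g` the driving path, which is `γ`-Hölder continuous. -/
structure PathData (T α γ B : ℝ) (y : ℝ → Torus → ℝ) (y₀ : Torus → ℝ) (ξ : Torus → Fin 2 → ℝ)
    (g : ℝ → ℝ) : Prop where
  T_pos : 0 < T
  one_lt : 1 < α
  half_lt : 1 / 2 < γ
  le_one : γ ≤ 1
  memV : MemV T α γ y
  init : MemB α y₀
  smooth : ∀ i, Smooth fun x => ξ x i
  divFree : DivFree ξ
  nonneg : 0 ≤ B
  holder : ∀ s ∈ Icc 0 T, ∀ t ∈ Icc 0 T, |g t - g s| ≤ B * |t - s| ^ γ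

/-- `Y φ t = ∫₀ᵗ ⟨y_r, ξ·∇φ⟩ dg_r` for all smooth `φ` and all `t ∈ [0,T]`, with the
local expansion of the integral and a bound by the first-order Wiener norm of `φ`. -/
structure IsNoiseIntegral (T γ : ℝ) (y : ℝ → Torus → ℝ) (ξ : Torus → Fin 2 → ℝ) (g : ℝ → ℝ)
    (C : ℝ≥0) (Y : (Torus → ℝ) → ℝ → ℝ) : Prop where
  integral : ∀ φ, Smooth φ → ∀ t ∈ Icc 0 T, HasYoungIntegral (enorm : ℝ → ℝ≥0∞)
    (fun r => pairing (y r) (transport ξ φ)) g t (Y φ t)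
  zero : ∀ φ, Smooth φ → Y φ 0 = 0
  continuousOn : ∀ φ, Smooth φ → ContinuousOn (Y φ) (Icc 0 T)
  local_bound : ∀ φ, Smooth φ → ∃ K, 0 ≤ K ∧ ∀ s v, 0 ≤ s → s ≤ v → v ≤ T →
    |Y φ v - Y φ s - (g v - g s) * pairing (y s) (transport ξ φ)| ≤ K * (v - s) ^ (2 * γ)
  bound : ∀ φ, Smooth φ → ∀ t ∈ Icc 0 T, ‖Y φ t‖ₑ ≤ C * wienerNorm 1 (coeff φ)

/-- The drift `⟨y_r, u_r·∇φ + Δφ⟩` of the weak formulation. -/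
noncomputable def weakDrift (φ w : Torus → ℝ) : ℝ :=
  pairing w (transport (biotSavart w) φ + laplacian φ)

section

variable {T α γ B : ℝ} {y : ℝ → Torus → ℝ} {y₀ : Torus → ℝ} {ξ : Torus → Fin 2 → ℝ} {g : ℝ → ℝ}
  {C : ℝ≥0} {Y : (Torus → ℝ) → ℝ → ℝ}

lemma PathData.exists_noiseIntegral (h : PathData T α γ B y y₀ ξ g) :
    ∃ C Y, IsNoiseIntegral T γ y ξ g C Y := by
  obtain ⟨C, Y, hY⟩ := h.memV.exists_weak_young h.T_pos.le h.one_lt h.half_lt h.le_one h.smooth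
    h.nonneg h.holder
  exact ⟨C, Y, fun φ hφ => (hY φ hφ).1, fun φ hφ => (hY φ hφ).2.1, fun φ hφ => (hY φ hφ).2.2.1,
    fun φ hφ => (hY φ hφ).2.2.2.1, fun φ hφ => (hY φ hφ).2.2.2.2⟩

lemma PathData.memC (h : PathData T α γ B y y₀ ξ g) : MemC T α y := h.memV.1

lemma PathData.wiener (h : PathData T α γ B y y₀ ξ g) {r : ℝ} (hr : r ∈ Icc 0 T) :
    Wiener (1 / 2) (y r) := (h.memC.1 r hr).wiener h.one_lt

lemma PathData.continuousOn_weakDrift (h : PathData T α γ B y y₀ ξ g) {φ : Torus → ℝ}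
    (hφ : Smooth φ) : ContinuousOn (fun r => weakDrift φ (y r)) (Icc 0 T) :=
  h.memC.continuousOn_drift h.one_lt hφ.isC1 hφ.laplacian.continuous

lemma PathData.intervalIntegrable_weakDrift (h : PathData T α γ B y y₀ ξ g) {φ : Torus → ℝ}
    (hφ : Smooth φ) {t : ℝ} (ht : t ∈ Icc 0 T) :
    IntervalIntegrable (fun r => weakDrift φ (y r)) volume 0 t := by
  refine ((h.continuousOn_weakDrift hφ).mono ?_).intervalIntegrable
  rw [uIcc_of_le ht.1]
  exact Icc_subset_Icc_right ht.2

lemma Wiener.continuous_transport_biotSavart {w : Torus → ℝ} (hw : Wiener (1 / 2) w)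
    {φ : Torus → ℝ} (hφ : IsC1 φ) : Continuous (transport (Vorticity.biotSavart w) φ) :=
  continuous_transport (fun i => (hw.biotSavart (by norm_num) i).1) hφ

lemma laplacian_add {φ ψ : Torus → ℝ} (hφ : Smooth φ) (hψ : Smooth ψ) :
    laplacian (φ + ψ) = laplacian φ + laplacian ψ := by
  have h : ∀ {f g : Torus → ℝ}, Smooth f → Smooth g → ∀ i, pderiv i (f + g) = pderiv i f + pderiv i g :=
    fun hf hg => (hf.isC1.add hg.isC1).2
  simp only [laplacian_eq, h hφ hψ, h (hφ.pderiv _) (hψ.pderiv _)]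
  ring

lemma Wiener.weakDrift_add {w : Torus → ℝ} (hw : Wiener (1 / 2) w) {φ ψ : Torus → ℝ}
    (hφ : Smooth φ) (hψ : Smooth ψ) : weakDrift (φ + ψ) w = weakDrift φ w + weakDrift ψ w := by
  unfold Vorticity.weakDrift
  rw [laplacian_add hφ hψ, transport_add _ hφ.isC1 hψ.isC1, ← pairing_add_right hw.1
    ((hw.continuous_transport_biotSavart hφ.isC1).add hφ.laplacian.continuous)
    ((hw.continuous_transport_biotSavart hψ.isC1).add hψ.laplacian.continuous)]
  congr 1
  ring

lemma wienerNorm_laplacian_le {φ : Torus → ℝ} (hφ : Smooth φ) :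
    wienerNorm 0 (coeff (laplacian φ)) ≤ ENNReal.ofReal (4 * Real.pi ^ 2) * wienerNorm 1 (coeff φ) := by
  rw [wienerNorm_zero, wienerNorm, ← ENNReal.tsum_mul_left]
  refine ENNReal.tsum_le_tsum fun k => ?_
  rw [hφ.coeff_laplacian, enorm_mul, ← mul_assoc, ← ENNReal.ofReal_mul (by positivity), Real.rpow_one,
    ← Complex.ofReal_neg, ← ofReal_norm, Complex.norm_real, Real.norm_eq_abs, abs_neg,
    abs_of_nonneg (by have := freqSq_nonneg k; positivity)]
  gcongr
  linarith

/-- The drift of the weak formulation is bounded by the first-order Wiener norm of the test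
function, uniformly in time. -/
lemma PathData.exists_weakDrift_le (h : PathData T α γ B y y₀ ξ g) : ∃ D : ℝ≥0, ∀ φ, Smooth φ →
    ∀ r ∈ Icc 0 T, ‖weakDrift φ (y r)‖ₑ ≤ D * wienerNorm 1 (coeff φ) := by
  obtain ⟨N, hN⟩ := h.memC.exists_bound
  obtain ⟨M, hM⟩ := h.memC.exists_wiener_bound h.one_lt
  refine ⟨((M + M) * (2 * Real.pi).toNNReal + (4 * Real.pi ^ 2).toNNReal) * N, fun φ hφ r hr => ?_⟩
  have hw := h.wiener hr
  have hw0 : Wiener 0 (y r) := hw.mono (by norm_num)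
  have hu : ∀ i, Wiener 0 fun x => biotSavart (y r) x i := fun i => hw0.biotSavart le_rfl i
  have hub : ∀ i, wienerNorm 0 (coeff fun x => biotSavart (y r) x i) ≤ M := fun i =>
    (hw0.wienerNorm_biotSavart_le i).trans ((wienerNorm_mono (by norm_num) _).trans (hM r hr))
  have htr := wiener_transport hu (hφ.wiener (1 / 2))
  have hlap := hφ.laplacian.wiener 0
  have hcoeff : coeff (transport (biotSavart (y r)) φ + laplacian φ) =
      coeff (transport (biotSavart (y r)) φ) + coeff (laplacian φ) :=
    funext fun k => coeff_add htr.1 hlap.1 k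
  have hsum : wienerNorm 0 (coeff (transport (biotSavart (y r)) φ + laplacian φ)) ≤
      ((M + M) * ENNReal.ofReal (2 * Real.pi) + ENNReal.ofReal (4 * Real.pi ^ 2)) *
        wienerNorm 1 (coeff φ) := by
    rw [hcoeff, add_mul]
    refine (wienerNorm_add_le _ _).trans (add_le_add ?_ (wienerNorm_laplacian_le hφ))
    rw [mul_assoc]
    refine (wienerNorm_transport_le hu hφ.isC1).trans ?_
    gcongr
    · exact hub 0
    · exact hub 1
    · exact wienerNorm_mono (by norm_num) _
  have hW : Wiener 0 (transport (biotSavart (y r)) φ + laplacian φ) :=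
    ⟨htr.1.add hlap.1, wienerNorm_lt_top_iff.1 (hsum.trans_lt (ENNReal.mul_lt_top (by finiteness)
      (wienerNorm_lt_top_iff.2 (hφ.wiener 1).2)))⟩
  calc ‖weakDrift φ (y r)‖ₑ ≤ wienerNorm 0 (coeff (transport (biotSavart (y r)) φ + laplacian φ)) *
        normB α (y r) := enorm_pairing_le (by linarith [h.one_lt]) hw.1 hW
    _ ≤ (((M + M) * ENNReal.ofReal (2 * Real.pi) + ENNReal.ofReal (4 * Real.pi ^ 2)) *
        wienerNorm 1 (coeff φ)) * N := by gcongr; exact hN r hr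
    _ = _ := by
      push_cast
      simp only [ENNReal.ofReal]
      ring

/-- The weak formulation at time `t` holds for all smooth test functions once it holds for the
trigonometric ones. -/
lemma PathData.weak_of_trig (h : PathData T α γ B y y₀ ξ g) (hY : IsNoiseIntegral T γ y ξ g C Y)
    {t : ℝ} (ht : t ∈ Icc 0 T)
    (h0 : ∀ k z, pairing (y t) (trig k z) = pairing y₀ (trig k z) +
      (∫ r in (0 : ℝ)..t, weakDrift (trig k z) (y r)) + Y (trig k z) t)
    {φ : Torus → ℝ} (hφ : Smooth φ) :
    pairing (y t) φ = pairing y₀ φ + (∫ r in (0 : ℝ)..t, weakDrift φ (y r)) + Y φ t := by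
  obtain ⟨D, hD⟩ := h.exists_weakDrift_le
  have hα : 0 ≤ α := by linarith [h.one_lt]
  have hyt := (h.memC.1 t ht)
  set R : (Torus → ℝ) → ℝ := fun φ => pairing (y t) φ - pairing y₀ φ -
    (∫ r in (0 : ℝ)..t, weakDrift φ (y r)) - Y φ t with hR
  have hsub : ∀ r ∈ uIcc 0 t, r ∈ Icc 0 T := fun r hr => by
    rw [uIcc_of_le ht.1] at hr
    exact ⟨hr.1, hr.2.trans ht.2⟩
  have hadd : ∀ f f', Smooth f → Smooth f' → R (f + f') = R f + R f' := fun f f' hf hf' => by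
    have e1 : Y (f + f') t = Y f t + Y f' t := by
      refine (hY.integral _ (hf.add hf') t ht).unique ht.1
        (((hY.integral f hf t ht).add (hY.integral f' hf' t ht)).congr fun r hr => ?_)
      have hξ : ∀ i, Continuous fun x => ξ x i := fun i => (h.smooth i).continuous
      rw [transport_add _ hf.isC1 hf'.isC1, pairing_add_right
        (h.wiener ⟨hr.1, hr.2.trans ht.2⟩).1 (continuous_transport hξ hf.isC1)
        (continuous_transport hξ hf'.isC1)]
    have e2 : ∫ r in (0 : ℝ)..t, weakDrift (f + f') (y r) =
        (∫ r in (0 : ℝ)..t, weakDrift f (y r)) + ∫ r in (0 : ℝ)..t, weakDrift f' (y r) := by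
      rw [← intervalIntegral.integral_add (h.intervalIntegrable_weakDrift hf ht)
        (h.intervalIntegrable_weakDrift hf' ht)]
      exact intervalIntegral.integral_congr fun r hr =>
        (h.wiener (hsub r hr)).weakDrift_add hf hf'
    simp only [hR]
    rw [e1, e2, pairing_add_right hyt.1 hf.continuous hf'.continuous,
      pairing_add_right h.init.1 hf.continuous hf'.continuous]
    ring
  have hle : ∀ f, Smooth f → ‖R f‖ₑ ≤ ((normB α (y t)).toNNReal + (normB α y₀).toNNReal +
      D * t.toNNReal + C : ℝ≥0) * wienerNorm 1 (coeff f) := fun f hf => by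
    have hf0 : wienerNorm 0 (coeff f) ≤ wienerNorm 1 (coeff f) := wienerNorm_mono zero_le_one _
    have hfin : wienerNorm 1 (coeff f) ≠ ⊤ := (wienerNorm_lt_top_iff.2 (hf.wiener 1).2).ne
    have b1 : ∀ {w}, MemB α w → ‖pairing w f‖ₑ ≤ normB α w * wienerNorm 1 (coeff f) := fun hw => by
      rw [mul_comm]
      exact (enorm_pairing_le hα hw.1 (hf.wiener 0)).trans (by gcongr)
    have b2 : ‖∫ r in (0 : ℝ)..t, weakDrift f (y r)‖ₑ ≤
        D * ENNReal.ofReal t * wienerNorm 1 (coeff f) := by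
      rw [intervalIntegral.integral_of_le ht.1]
      refine (enorm_integral_le_lintegral_enorm _).trans ?_
      calc ∫⁻ r in Ioc 0 t, ‖weakDrift f (y r)‖ₑ
          ≤ ∫⁻ _ in Ioc 0 t, D * wienerNorm 1 (coeff f) := by
            refine setLIntegral_mono' measurableSet_Ioc fun r hr => ?_
            exact hD f hf r ⟨hr.1.le, hr.2.trans ht.2⟩
        _ = _ := by rw [setLIntegral_const, Real.volume_Ioc, sub_zero]; ring
    have tri : ∀ a b c d : ℝ, ‖a - b - c - d‖ₑ ≤ ‖a‖ₑ + ‖b‖ₑ + ‖c‖ₑ + ‖d‖ₑ := fun a b c d =>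
      (enorm_sub_le).trans (add_le_add_left (enorm_sub_le.trans
        (add_le_add_left enorm_sub_le _)) _)
    refine (tri _ _ _ _).trans ?_
    push_cast
    rw [ENNReal.coe_toNNReal hyt.2.ne, ENNReal.coe_toNNReal h.init.2.ne, add_mul, add_mul, add_mul]
    exact add_le_add (add_le_add (add_le_add (b1 hyt) (b1 h.init)) b2) (hY.bound f hf t ht)
  have := eq_zero_of_trig hadd hle (fun k z => by simp only [hR]; rw [h0 k z]; ring) hφ
  simp only [hR] at this
  linarith

/-! ### Duhamel's formula for a Fourier mode -/

/-- For a trigonometric test function, the weak formulation is a scalar linear equation, and solving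
it by variation of constants gives Duhamel's formula. -/
lemma PathData.weak_iff_duhamel (h : PathData T α γ B y y₀ ξ g) (hY : IsNoiseIntegral T γ y ξ g C Y)
    (k : Fin 2 → ℤ) (z : ℂ) :
    (∀ t ∈ Icc 0 T, pairing (y t) (trig k z) = pairing y₀ (trig k z) +
      (∫ r in (0 : ℝ)..t, weakDrift (trig k z) (y r)) + Y (trig k z) t) ↔
    ∀ t ∈ Icc 0 T, pairing (y t) (trig k z) =
      Real.exp (-(eigenvalue k * t)) * pairing y₀ (trig k z) -
      (∫ r in (0 : ℝ)..t, Real.exp (-(eigenvalue k * (t - r))) *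
        pairing (advection (y r)) (trig k z)) +
      (Y (trig k z) t - ∫ r in (0 : ℝ)..t,
        eigenvalue k * Real.exp (-(eigenvalue k * (t - r))) * Y (trig k z) r) := by
  have hs := smooth_trig k z
  have hdrift : ∀ r ∈ Icc 0 T, weakDrift (trig k z) (y r) =
      -pairing (advection (y r)) (trig k z) - eigenvalue k * pairing (y r) (trig k z) :=
    fun r hr => by
      have hw := h.wiener hr
      rw [weakDrift, pairing_add_right hw.1 (hw.continuous_transport_biotSavart hs.isC1)
        hs.laplacian.continuous, hw.pairing_advection hs.isC1, laplacian_trig, pairing_smul_right]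
      ring
  have e1 : ∀ t ∈ Icc 0 T, ∫ r in (0 : ℝ)..t, weakDrift (trig k z) (y r) =
      ∫ r in (0 : ℝ)..t, (-pairing (advection (y r)) (trig k z) -
        eigenvalue k * pairing (y r) (trig k z)) := fun t ht =>
    intervalIntegral.integral_congr fun r hr => by
      rw [uIcc_of_le ht.1] at hr
      exact hdrift r ⟨hr.1, hr.2.trans ht.2⟩
  have e2 : ∀ t, ∫ r in (0 : ℝ)..t, Real.exp (-(eigenvalue k * (t - r))) *
      -pairing (advection (y r)) (trig k z) = -∫ r in (0 : ℝ)..t,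
        Real.exp (-(eigenvalue k * (t - r))) * pairing (advection (y r)) (trig k z) := fun t => by
    simp only [mul_neg, intervalIntegral.integral_neg]
  have key := variation_of_constants (c := fun r => pairing (y r) (trig k z))
    (b := fun r => -pairing (advection (y r)) (trig k z)) (Y := Y (trig k z)) (lam := eigenvalue k)
    (c₀ := pairing y₀ (trig k z)) h.T_pos.le
    (h.memC.continuousOn_pairing h.one_lt hs.continuous)
    (h.memC.continuousOn_pairing_advection h.one_lt hs.isC1).neg (hY.continuousOn _ hs)
  simp only [e2, ← sub_eq_add_neg] at key
  rw [← key]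
  exact forall₂_congr fun t ht => by rw [e1 t ht]

/-- The Fourier modes of the stochastic convolution, expressed through the noise term of the weak
formulation. -/
lemma PathData.pairing_convolution (h : PathData T α γ B y y₀ ξ g)
    (hY : IsNoiseIntegral T γ y ξ g C Y) {t : ℝ} (ht : t ∈ Icc 0 T) {J : Torus → ℝ} (hJ : MemB α J)
    (hJi : HasYoungIntegral (normB α) (fun r => heat (t - r) (transport ξ (y r))) g t J)
    (k : Fin 2 → ℤ) (z : ℂ) :
    pairing J (trig k z) = -(Y (trig k z) t - ∫ r in (0 : ℝ)..t,
      eigenvalue k * Real.exp (-(eigenvalue k * (t - r))) * Y (trig k z) r) := by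
  have hs := smooth_trig k z
  have hreg : ∀ r ∈ Icc 0 t, Continuous (transport ξ (y r)) ∧
      Summable fun k => ‖coeff (transport ξ (y r)) k‖ := fun r hr =>
    h.memC.transport_regularity h.one_lt h.smooth ⟨hr.1, hr.2.trans ht.2⟩
  have h1 := hJi.pairing_trig (by linarith [h.one_lt])
    (fun r hr => continuous_heat (sub_nonneg.2 hr.2) (hreg r hr).2) hJ.1 k z
  obtain ⟨K, hK, hloc⟩ := hY.local_bound _ hs
  have hψ : ∀ r, HasDerivAt (fun r => Real.exp (-(eigenvalue k * (t - r))))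
      (eigenvalue k * Real.exp (-(eigenvalue k * (t - r)))) r := fun r => by
    have := ((((hasDerivAt_id r).const_sub t).const_mul (eigenvalue k)).neg).exp
    simpa [mul_comm] using this
  have h2 := hasYoungIntegral_mul_smooth ht.1 (show 1 < 2 * γ by linarith [h.half_lt]) hK hψ
    (by fun_prop) ((hY.continuousOn _ hs).mono (Icc_subset_Icc_right ht.2)) (hY.zero _ hs)
    fun s v hs0 hsv hv => hloc s v hs0 hsv (hv.trans ht.2)
  have h3 := h2.const_smul (-1)
  rw [sub_self, mul_zero, neg_zero, Real.exp_zero, one_mul, neg_one_smul] at h3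
  refine h1.unique ht.1 (h3.congr fun r hr => ?_)
  rw [pairing_heat_trig (sub_nonneg.2 hr.2) (hreg r hr).1 (hreg r hr).2,
    pairing_transport (fun i => (h.smooth i).isC1) h.divFree
      (h.wiener ⟨hr.1, hr.2.trans ht.2⟩).isC1 hs.isC1, smul_eq_mul]
  ring

/-- A mild solution satisfies Duhamel's formula for every Fourier mode. -/
lemma PathData.duhamel_of_mild (h : PathData T α γ B y y₀ ξ g) (hY : IsNoiseIntegral T γ y ξ g C Y)
    {t : ℝ} (ht : t ∈ Icc 0 T) {J : Torus → ℝ} (hJ : MemB α J)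
    (hJi : HasYoungIntegral (normB α) (fun r => heat (t - r) (transport ξ (y r))) g t J)
    (he : ∀ x, y t x = heat t y₀ x - (∫ r in (0 : ℝ)..t, heat (t - r) (advection (y r)) x) - J x)
    (k : Fin 2 → ℤ) (z : ℂ) :
    pairing (y t) (trig k z) = Real.exp (-(eigenvalue k * t)) * pairing y₀ (trig k z) -
      (∫ r in (0 : ℝ)..t, Real.exp (-(eigenvalue k * (t - r))) *
        pairing (advection (y r)) (trig k z)) +
      (Y (trig k z) t - ∫ r in (0 : ℝ)..t,
        eigenvalue k * Real.exp (-(eigenvalue k * (t - r))) * Y (trig k z) r) := by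
  have hs := (smooth_trig k z).continuous
  have hi := h.init.wiener h.one_lt
  have hisum := hi.summable (by norm_num)
  obtain ⟨-, hDc, hD⟩ := h.memC.drift_convolution h.one_lt ht
  have hyt : y t = heat t y₀ - (fun x => ∫ r in (0 : ℝ)..t, heat (t - r) (advection (y r)) x) - J :=
    funext he
  have hHc := continuous_heat ht.1 hisum
  rw [hyt, pairing_sub_left (hHc.sub hDc) hJ.1 hs, pairing_sub_left hHc hDc hs, hD,
    pairing_heat_trig ht.1 hi.1 hisum, h.pairing_convolution hY ht hJ hJi]
  ring

/-- Duhamel's formula for the Fourier modes gives the mild formulation. -/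
lemma PathData.mild_of_duhamel (h : PathData T α γ B y y₀ ξ g) (hY : IsNoiseIntegral T γ y ξ g C Y)
    {t : ℝ} (ht : t ∈ Icc 0 T)
    (hd : ∀ k, ∀ z ∈ ({1, Complex.I} : Set ℂ), pairing (y t) (trig k z) =
      Real.exp (-(eigenvalue k * t)) * pairing y₀ (trig k z) -
      (∫ r in (0 : ℝ)..t, Real.exp (-(eigenvalue k * (t - r))) *
        pairing (advection (y r)) (trig k z)) +
      (Y (trig k z) t - ∫ r in (0 : ℝ)..t,
        eigenvalue k * Real.exp (-(eigenvalue k * (t - r))) * Y (trig k z) r)) :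
    ∃ J, MemB α J ∧
      HasYoungIntegral (normB α) (fun r => heat (t - r) (transport ξ (y r))) g t J ∧
      ∀ x, IntervalIntegrable (fun r => heat (t - r) (advection (y r)) x) volume 0 t ∧
        y t x = heat t y₀ x - (∫ r in (0 : ℝ)..t, heat (t - r) (advection (y r)) x) - J x := by
  have hi := h.init.wiener h.one_lt
  have hisum := hi.summable (by norm_num)
  obtain ⟨hDi, hDc, hD⟩ := h.memC.drift_convolution h.one_lt ht
  obtain ⟨J, hJ, hJi⟩ := h.memV.exists_convolution h.one_lt h.half_lt h.le_one h.smooth h.nonneg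
    (fun r hr s hs => h.holder s hs r hr) ht
  have hHc := continuous_heat ht.1 hisum
  have e : y t = heat t y₀ - (fun x => ∫ r in (0 : ℝ)..t, heat (t - r) (advection (y r)) x) - J := by
    refine eq_of_pairing_trig_eq (h.wiener ht).1 ((hHc.sub hDc).sub hJ.1) fun k z hz => ?_
    have hs := (smooth_trig k z).continuous
    rw [hd k z hz, pairing_sub_left (hHc.sub hDc) hJ.1 hs, pairing_sub_left hHc hDc hs, hD,
      pairing_heat_trig ht.1 hi.1 hisum, h.pairing_convolution hY ht hJ hJi]
    ring
  exact ⟨J, hJ, hJi, fun x => ⟨hDi x, congrFun e x⟩⟩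

/-- The weak formulation at rational times extends to all times by continuity. -/
lemma PathData.weak_of_rat (h : PathData T α γ B y y₀ ξ g) (hY : IsNoiseIntegral T γ y ξ g C Y)
    {φ : Torus → ℝ} (hφ : Smooth φ)
    (hq : ∀ q : ℚ, (q : ℝ) ∈ Icc 0 T → pairing (y q) φ = pairing y₀ φ +
      (∫ r in (0 : ℝ)..q, weakDrift φ (y r)) + Y φ q) :
    ∀ t ∈ Icc 0 T, pairing (y t) φ = pairing y₀ φ +
      (∫ r in (0 : ℝ)..t, weakDrift φ (y r)) + Y φ t := by
  have hint : ContinuousOn (fun t => ∫ r in (0 : ℝ)..t, weakDrift φ (y r)) (Icc 0 T) := by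
    have h1 := (h.intervalIntegrable_weakDrift hφ ⟨h.T_pos.le, le_rfl⟩)
    have := intervalIntegral.continuousOn_primitive_interval
      ((intervalIntegrable_iff' (by simp)).1 h1)
    rwa [uIcc_of_le h.T_pos.le] at this
  refine EqOn.of_subset_closure (s := Ioo 0 T ∩ range ((↑) : ℚ → ℝ)) ?_
    (h.memC.continuousOn_pairing h.one_lt hφ.continuous)
    ((continuousOn_const.add hint).add (hY.continuousOn φ hφ))
    (inter_subset_left.trans Ioo_subset_Icc_self) ?_
  · rintro t ⟨ht, q, rfl⟩
    exact hq q (Ioo_subset_Icc_self ht)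
  · rw [← closure_Ioo h.T_pos.ne]
    exact closure_minimal (Rat.denseRange_cast.open_subset_closure_inter isOpen_Ioo) isClosed_closure

end

end Vorticity

/-- For the two-dimensional vorticity equation with transport noise driven by a fractional
Brownian motion with Hurst parameter `H > 1/2`, mild and weak solutions in `V^T` coincide. -/
theorem mainTheorem5 {Ω : Type*} [MeasurableSpace Ω] (P : Measure Ω)
    (H γ α T : ℝ) (hH : H < 1) (hγ : 1 / 2 < γ) (hγH : γ < H) (hα : 1 < α) (hT : 0 < T)
    (W : ℝ≥0 → Ω → ℝ) (hW : Vorticity.IsFractionalBrownianMotion H W P)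
    (ξ : Vorticity.Torus → Fin 2 → ℝ) (hξ : ∀ i, Vorticity.Smooth fun x => ξ x i)
    (hξdiv : Vorticity.DivFree ξ)
    (ω₀ : Ω → Vorticity.Torus → ℝ) (hω₀ : ∀ᵐ a ∂P, Vorticity.MemB α (ω₀ a))
    (ω : Ω → ℝ → Vorticity.Torus → ℝ) (hω : ∀ᵐ a ∂P, Vorticity.MemV T α γ (ω a)) :
    Vorticity.IsMildSolution P T α ξ W ω₀ ω ↔ Vorticity.IsWeakSolution P T α ξ W ω₀ ω := by
  have hdata : ∀ᵐ a ∂P, ∃ B, Vorticity.PathData T α γ B (ω a) (ω₀ a) ξ (Vorticity.path W a) := by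
    filter_upwards [hW.ae_holder (by linarith) hγH hT, hω₀, hω] with a ⟨B, hB, hh⟩ h₀ h₁
    exact ⟨B, hT, hα, hγ, by linarith, h₁, h₀, hξ, hξdiv, hB, hh⟩
  constructor
  · intro hm
    refine ⟨hm.mono fun a h => h.1, fun φ hφ t ht => ?_⟩
    filter_upwards [hm, hdata] with a ⟨_, hma⟩ ⟨B, h⟩
    obtain ⟨C, Y, hY⟩ := h.exists_noiseIntegral
    refine ⟨Y φ t, hY.integral φ hφ t ht, h.intervalIntegrable_weakDrift hφ ht,
      h.weak_of_trig hY ht (fun k z => ?_) hφ⟩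
    refine (h.weak_iff_duhamel hY k z).2 (fun s hs => ?_) t ht
    obtain ⟨J, hJ, hJi, he⟩ := hma s hs
    exact h.duhamel_of_mild hY hs hJ hJi (fun x => (he x).2) k z
  · rintro ⟨-, hw⟩
    -- Only countably many test functions and times are needed, so the null set is chosen uniformly.
    have hall : ∀ᵐ a ∂P, ∀ (k : Fin 2 → ℤ) (z : ({1, Complex.I} : Set ℂ)) (q : ℚ),
        (q : ℝ) ∈ Icc 0 T → ∃ J : ℝ, Vorticity.HasYoungIntegral enorm
          (fun r => Vorticity.pairing (ω a r) (Vorticity.transport ξ (Vorticity.trig k z)))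
          (Vorticity.path W a) q J ∧
        Vorticity.pairing (ω a q) (Vorticity.trig k z) =
          Vorticity.pairing (ω₀ a) (Vorticity.trig k z) +
          (∫ r in (0 : ℝ)..q, Vorticity.weakDrift (Vorticity.trig k z) (ω a r)) + J := by
      have : Countable ({1, Complex.I} : Set ℂ) := (Set.toFinite _).countable.to_subtype
      rw [ae_all_iff]; intro k
      rw [ae_all_iff]; intro z
      rw [ae_all_iff]; intro q
      by_cases hq : (q : ℝ) ∈ Icc 0 T
      · filter_upwards [hw _ (Vorticity.smooth_trig k z) q hq] with a ⟨J, hJ, _, he⟩ _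
        exact ⟨J, hJ, he⟩
      · exact .of_forall fun a hq' => absurd hq' hq
    filter_upwards [hall, hdata] with a ha ⟨B, h⟩
    obtain ⟨C, Y, hY⟩ := h.exists_noiseIntegral
    refine ⟨h.memC, fun t ht => h.mild_of_duhamel hY ht fun k z hz => ?_⟩
    refine (h.weak_iff_duhamel hY k z).1 (h.weak_of_rat hY (Vorticity.smooth_trig k z)
      fun q hq => ?_) t ht
    obtain ⟨J, hJ, he⟩ := ha k ⟨z, hz⟩ q hq
    rw [he, hJ.unique hq.1 (hY.integral _ (Vorticity.smooth_trig k z) q hq)]
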